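/- **Setting.** Let $\theta_j\ge 0$, $\kappa_j\ge 0$ ($j\in\mathbb N=\{1,2,\dots\}$). Assume that $(\kappa_j)$ is non-arithmetic (there is no integer $j_0>1$ dividing every $j$ with $\kappa_j\neq0$) and non-degenerate ($\kappa_j>0$ for some $j\ge2$). For $\sigma$ in the symmetric group $\mathfrak S_N$ let $C_j=C_j(\sigma)$ be the number of cycles of length $j$, and let $$P_N(\sigma)=\frac{1}{N!\,H_N}\prod_{j=1}^N(\theta_j+N\kappa_j)^{C_j},\qquad H_N=\frac1{N!}\sum_{\sigma\in\mathfrak S_N}\prod_{j=1}^N(\theta_j+N\kappa_j)^{C_j},$$ with expectation $E_N$. Let $L_1$ be the length of the cycle of $\sigma$ containing $1$, $L_2$ the length of the cycle containing the smallest element not in the previous cycle, and so on ($L_n=0$ if there are fewer than $n$ cycles). Put $$g_\theta(z)=\sum_{j\ge1}\frac{\theta_j}{j}z^j,\qquad g_\kappa(z)=\sum_{j\ge1}\frac{\kappa_j}{j}z^j,\qquad g^{\{n\}}(z)=z^n\frac{d^n g(z)}{dz^n},\qquad g_\kappa^{\{n\}}(R)=\lim_{r\uparrow R}g_\kappa^{\{n\}}(r)\in[0,\infty].$$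 **Assumptions** (supercritical case, $\theta^*=0$). The radius of convergence $R$ of $g_\kappa$ satisfies $0<R<\infty$. For some $\eta>0$ and $\varphi\in(0,\pi/2)$, both $g_\theta$ and $g_\kappa$ are given by their power series in $|z|<R$ and extend holomorphically to $$\Delta_0=\{z\in\mathbb C:\ |z|<|R(1+\eta e^{i\varphi})|,\ z\ne R,\ |\arg(z-R)|>\varphi\},$$ and $g_\theta$ is moreover regular (analytic) at $z=R$. There is a non-integer $s>1$ such that $g_\kappa^{\{n\}}(R)<\infty$ for all integers $0\le n<s$ and $g_\kappa^{\{n\}}(R)=\infty$ for all $n>s$, and there are a real $a_s\neq0$ and numbers $\delta_n>0$ such that, for every integer $n\ge0$, as $z\to R$ in $\Delta_0$, $$g_\kappa^{\{n\}}(z)=\Bigl(\frac zR\Bigr)^n\Bigl\{\sum_{n\le j<s}\frac{(-1)^{j-n}g_\kappa^{\{j\}}(R)}{(j-n)!}\Bigl(1-\frac zR\Bigr)^{j-n}+\frac{\Gamma(-s+n)\,a_s}{\Gamma(-s)}\Bigl(1-\frac zR\Bigr)^{s-n}\Bigr\}+O\Bigl(\Bigl|1-\frac zR\Bigr|^{s-n+\delta_n}\Bigr)$$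 (principal branch of the power; the sum is empty if $n>s$). Finally $g_\kappa^{\{1\}}(R)<1$. Put $\tilde\nu=1-g_\kappa^{\{1\}}(R)>0$. **Theorem.** $H_N>0$ for all sufficiently large $N$, so that $P_N$ is then well defined, and $\tilde\nu$ is the limiting expected fraction of points in long cycles: $$\lim_{K\to\infty}\liminf_{N\to\infty}\frac1N E_N\Bigl[\sum_{j>K}jC_j\Bigr]=\tilde\nu .$$ Let $\xi_1,\xi_2,\dots$ be independent Bernoulli random variables with success probability $\tilde\nu$, let $\tau_1=\min\{n\ge1:\xi_n=1\}$, and let $X_n=\mathbf 1_{\{\tau_1=n\}}$. Then $\tau_1$ is geometric, $P\{\tau_1=k\}=(1-\tilde\nu)^{k-1}\tilde\nu$ for $k\ge1$, and for each $m\in\mathbb N$, $$\frac{1}{N\tilde\nu}(L_1,\dots,L_m)\ \xrightarrow{\ d\ }\ (X_1,\dots,X_m)\qquad(N\to\infty),$$ where $L_1,\dots,L_m$ are taken under $P_N$. -/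

import Mathlib

open Filter Topology MeasureTheory ProbabilityTheory
open scoped NNReal ENNReal

namespace SurrogateSpatial

/-! ### The surrogate-spatial measure on permutations -/

/-- The cycle count `C_j(σ)`: the number of cycles of length `j` of `σ`, fixed points being counted
as cycles of length one. -/
def cycleCount {N : ℕ} (σ : Equiv.Perm (Fin N)) (j : ℕ) : ℕ :=
  σ.partition.parts.count j

/-- The multiplicative weight `∏_{j=1}^N (θ_j + N κ_j)^{C_j(σ)}`.  The values `θ 0`, `κ 0` are never
used. -/
noncomputable def weight (θ κ : ℕ → ℝ≥0) {N : ℕ} (σ : Equiv.Perm (Fin N)) : ℝ≥0 :=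
  ∏ j ∈ Finset.Icc 1 N, (θ j + N * κ j) ^ cycleCount σ j

/-- The normalization constant `H_N = (1 / N!) ∑_σ ∏_j (θ_j + N κ_j)^{C_j(σ)}`. -/
noncomputable def normConst (θ κ : ℕ → ℝ≥0) (N : ℕ) : ℝ≥0 :=
  (N.factorial : ℝ≥0)⁻¹ * ∑ σ : Equiv.Perm (Fin N), weight θ κ σ

/-- The probability `(N! H_N)⁻¹ ∏_j (θ_j + N κ_j)^{C_j(σ)}` of the permutation `σ`. -/
noncomputable def prob (θ κ : ℕ → ℝ≥0) {N : ℕ} (σ : Equiv.Perm (Fin N)) : ℝ≥0 :=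
  weight θ κ σ / (N.factorial * normConst θ κ N)

theorem sum_prob (θ κ : ℕ → ℝ≥0) (N : ℕ) (h : normConst θ κ N ≠ 0) :
    ∑ σ : Equiv.Perm (Fin N), (prob θ κ σ : ℝ≥0∞) = 1 := by
  have hN : (N.factorial : ℝ≥0) ≠ 0 := by exact_mod_cast N.factorial_ne_zero
  have h2 : (N.factorial : ℝ≥0) * normConst θ κ N
      = ∑ σ : Equiv.Perm (Fin N), weight θ κ σ := by
    rw [normConst, ← mul_assoc, mul_inv_cancel₀ hN, one_mul]
  have h3 : ∑ σ : Equiv.Perm (Fin N), prob θ κ σ = 1 := by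
    simp only [prob]
    rw [← Finset.sum_div, ← h2, div_self (mul_ne_zero hN h)]
  exact_mod_cast h3

open Classical in
/-- The surrogate-spatial distribution on the symmetric group.  It makes sense only if `H_N ≠ 0`; the
point mass at the identity is a filler for the degenerate case `H_N = 0`. -/
noncomputable def surrogatePMF (θ κ : ℕ → ℝ≥0) (N : ℕ) : PMF (Equiv.Perm (Fin N)) :=
  if h : normConst θ κ N ≠ 0 then
    PMF.ofFintype (fun σ => (prob θ κ σ : ℝ≥0∞)) (sum_prob θ κ N h)
  else PMF.pure 1

instance permMeasurableSpace (N : ℕ) : MeasurableSpace (Equiv.Perm (Fin N)) := ⊤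

instance permDiscrete (N : ℕ) : DiscreteMeasurableSpace (Equiv.Perm (Fin N)) :=
  ⟨fun _ => trivial⟩

/-- The surrogate-spatial probability measure `P_N` on the symmetric group. -/
noncomputable def surrogateMeasure (θ κ : ℕ → ℝ≥0) (N : ℕ) : Measure (Equiv.Perm (Fin N)) :=
  (surrogatePMF θ κ N).toMeasure

instance surrogateMeasure_isProbabilityMeasure (θ κ : ℕ → ℝ≥0) (N : ℕ) :
    IsProbabilityMeasure (surrogateMeasure θ κ N) := by
  unfold surrogateMeasure
  infer_instance

/-- `ν_K = liminf_N (1/N) E_N[∑_{j > K} j C_j]`: the limiting expected fraction of points in cycles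
longer than `K`. -/
noncomputable def longFraction (θ κ : ℕ → ℝ≥0) (K : ℕ) : ℝ :=
  liminf (fun N : ℕ => (1 / (N : ℝ)) *
    ∫ σ, (∑ j ∈ Finset.Ioc K N, (j : ℝ) * (cycleCount σ j : ℝ)) ∂(surrogateMeasure θ κ N)) atTop

/-! ### Lexicographically ordered cycle lengths -/

/-- The set of elements in the cycle of `σ` containing `x`. -/
def cyclePoints {N : ℕ} (σ : Equiv.Perm (Fin N)) (x : Fin N) : Finset (Fin N) :=
  Finset.univ.filter fun y => σ.SameCycle x y

/-- The elements that remain after removing the first `n` cycles, where one always removes the cycle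
containing the smallest remaining element. -/
def remaining {N : ℕ} (σ : Equiv.Perm (Fin N)) : ℕ → Finset (Fin N)
  | 0 => Finset.univ
  | n + 1 =>
    if h : (remaining σ n).Nonempty then
      remaining σ n \ cyclePoints σ ((remaining σ n).min' h)
    else ∅

/-- The length of the `(n+1)`-st cycle in the lexicographic order: `lexLength σ 0 = L_1`,
`lexLength σ 1 = L_2`, and so on, with value zero once all the cycles are exhausted. -/
def lexLength {N : ℕ} (σ : Equiv.Perm (Fin N)) (n : ℕ) : ℕ :=
  if h : (remaining σ n).Nonempty then (cyclePoints σ ((remaining σ n).min' h)).card else 0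

/-! ### Generating functions -/

/-- The coefficients `a_j / j` of the generating function `∑_{j ≥ 1} (a_j / j) z^j`; the coefficient
at `j = 0` is `a_0 / 0 = 0`. -/
noncomputable def genCoeff (a : ℕ → ℝ≥0) (j : ℕ) : ℂ :=
  ((a j : ℝ) : ℂ) / (j : ℂ)

/-- The domain `Δ₀(R, η, φ)`: a disk of radius larger than `R` with a sector at `R` cut out. -/
def deltaDomain (R η φ : ℝ) : Set ℂ :=
  {z | ‖z‖ < ‖(R : ℂ) * (1 + η * Complex.exp (φ * Complex.I))‖ ∧ z ≠ R ∧
    φ < |Complex.arg (z - R)|}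

/-- The modified derivative `g^{n}(z) = zⁿ dⁿg/dzⁿ`. -/
noncomputable def modDeriv (n : ℕ) (g : ℂ → ℂ) (z : ℂ) : ℂ :=
  z ^ n * iteratedDeriv n g z

/-- The main part, as `z → R`, of the `n`-th modified derivative of a function having the boundary
values `b j = g^{j}(R)` for `j < s` and the leading singular term `a (1 - z/R)^s`. -/
noncomputable def singularExpansion (R s a : ℝ) (b : ℕ → ℝ) (n : ℕ) (z : ℂ) : ℂ :=
  (z / R) ^ n *
    (∑ j ∈ Finset.Ico n ⌈s⌉₊,
        (-1 : ℂ) ^ (j - n) * (b j : ℂ) / ((j - n).factorial : ℂ) * (1 - z / R) ^ (j - n)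
      + ((Real.Gamma (-s + n) * a / Real.Gamma (-s) : ℝ) : ℂ) *
          (1 - z / R) ^ (((s - n : ℝ)) : ℂ))

/-! ### The limiting waiting time -/

/-- The time of the first success in a sequence of trials, the trial `ξ n` being performed at the time
`n + 1`; on the null event that there is no success the value is zero. -/
noncomputable def firstSuccess {Ω : Type*} (ξ : ℕ → Ω → Bool) (ω : Ω) : ℕ :=
  sInf {k | ∃ n, k = n + 1 ∧ ξ n ω = true}

end SurrogateSpatial

/-! Put `α_l = θ_l R^l`, `β_l = κ_l R^l`, `μ = g_κ^{1}(R) = ∑ β_l < 1`. The normalization `H_N` is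
the `N`-th Taylor coefficient of `exp (∑ x_l z^l / l)` with `x_l = θ_l + N κ_l`. Replacing `x_l` by
`x_l R^l` changes no probability and makes the weights summable, so the coefficients normalize to a
probability distribution `u_N` (`massFn`): the law of `∑ l Z_l` for independent Poisson variables
`Z_l` of mean `(α_l + N β_l) / l`. Its mass concentrates at `μ N`, strictly below the required size
`N`, and the deficit `(1 - μ) N` is made up by one big jump.

Singularity analysis gives `β_l ~ c l^{-s}` with `c = a / Γ(-s) > 0`
(`tendsto_coeff_of_singularExpansion`, `heavyTail_scaledCoeff`). Concentration comes from the
identity `E[n f(n)] = ∑ x_l E[f(n + l)]` with a truncated linear `f` (`tendsto_farMass`). In the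
recursion `n u(n) = ∑ x_l u(n - l)` at `n ≈ N`, short `l` contribute about `μ N u(n)` and the `l ≈
(1 - μ) N` contribute about `N · c ((1 - μ) N)^{-s}`. Solving for `u` gives the local limit `N^s
u_N(N - k) → c (1 - μ)^{-s} / (1 - μ)` (`tendsto_massFn_mul_rpow`); comparison with explicit super-
and subsolutions makes this rigorous.

Removing the cycle of the smallest remaining point is one step of the same recursion
(`sum_weightOn_lexMem`). From a size `N - k`, a cycle of fixed length `l` has probability about
`β_l`, and a cycle of length near `(1 - μ) N` has total probability about `1 - μ`. After a long
cycle about `μ N` points remain, a typical size for `u_N`, so that length `l` has probability about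
`β_l / μ` and all further cycles are short. This bounds the probability of `i` short cycles, one
long cycle, then short ones below by about `μ^i (1 - μ)`, and that of `m` short cycles by about
`μ^m`. Over `i < m` these numbers sum to one, so lower bounds alone determine the limit law
(`tendstoInDistribution_of_eventually_le`). -/

namespace SurrogateSpatial

/-! ### Sums over permutations -/

/-- The Taylor coefficients of `exp (∑ x_l z^l / l)`, defined by their recursion. -/
noncomputable def expCoeff (x : ℕ → ℝ) : ℕ → ℝ
  | 0 => 1
  | n + 1 => (∑ i : Fin (n + 1), x (i + 1) * expCoeff x (n - i)) / (n + 1)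

open Classical in
/-- The effect of a first cycle with length in `A` on a function of the number of points. -/
noncomputable def cycleStep (x : ℕ → ℝ) (A : Set ℕ) (f : ℕ → ℝ) (n : ℕ) : ℝ :=
  (∑ l ∈ (Finset.Icc 1 n).filter (· ∈ A), x l * f (n - l)) / n

/-- The total weight of the permutations with the first cycle lengths in prescribed sets, divided
by `n!`. -/
noncomputable def lexCoeff (x : ℕ → ℝ) : List (Set ℕ) → ℕ → ℝ
  | [] => expCoeff x
  | A :: As => cycleStep x A (lexCoeff x As)

/-- The recursion is `z H' = H ∑ x_l z^l` for `H = exp (∑ x_l z^l / l)`; in this form it reads as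
the removal of an unconstrained first cycle. -/
theorem expCoeff_eq_cycleStep (x : ℕ → ℝ) {n : ℕ} (hn : n ≠ 0) :
    expCoeff x n = cycleStep x Set.univ (expCoeff x) n := by
  obtain ⟨n, rfl⟩ := Nat.exists_eq_succ_of_ne_zero hn
  rw [expCoeff, cycleStep]
  congr 1
  · have := Finset.sum_Ico_add' (fun l => x l * expCoeff x (n + 1 - l)) 0 (n + 1) 1
    simp only [Nat.add_sub_add_right, zero_add] at this
    simp only [Set.mem_univ, Finset.filter_true]
    rw [Fin.sum_univ_eq_sum_range (fun i => x (i + 1) * expCoeff x (n - i)),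
      Finset.range_eq_Ico, this]
    rfl
  · push_cast; ring

/-! ### Splitting a permutation into the cycle of a marked point and the rest -/

variable {N : ℕ}

theorem cyclePoints_eq (σ : Equiv.Perm (Fin N)) (a : Fin N) :
    cyclePoints σ a = insert a (σ.cycleOf a).support := by
  ext y
  simp only [cyclePoints, Finset.mem_filter, Finset.mem_univ, true_and, Finset.mem_insert,
    Equiv.Perm.mem_support_cycleOf_iff]
  constructor
  · intro h
    by_cases hy : y = a
    · exact Or.inl hy
    · refine Or.inr ⟨h, ?_⟩
      rw [Equiv.Perm.mem_support]
      intro hfix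
      exact hy ((Equiv.Perm.SameCycle.eq_of_left h hfix).symm)
  · rintro (rfl | h)
    · exact Equiv.Perm.SameCycle.refl _ _
    · exact h.1

theorem mem_cyclePoints_self (σ : Equiv.Perm (Fin N)) (a : Fin N) : a ∈ cyclePoints σ a := by
  simp [cyclePoints_eq]

/-- The permutations of the points of `S`. -/
def permsOn (S : Finset (Fin N)) : Finset (Equiv.Perm (Fin N)) :=
  Finset.univ.filter fun σ => σ.support ⊆ S

theorem mem_permsOn {S : Finset (Fin N)} {σ : Equiv.Perm (Fin N)} :
    σ ∈ permsOn S ↔ σ.support ⊆ S := by simp [permsOn]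

/-- The cyclic permutations of the points of `A ∋ a`. -/
def cyclesOn (A : Finset (Fin N)) (a : Fin N) : Finset (Equiv.Perm (Fin N)) :=
  (permsOn A).filter fun c => cyclePoints c a = A

/-- The weight of a permutation of the points of `S`. -/
noncomputable def weightOn (x : ℕ → ℝ) (S : Finset (Fin N)) (σ : Equiv.Perm (Fin N)) : ℝ :=
  (σ.cycleType.map x).prod * x 1 ^ (S.card - σ.support.card)

theorem cyclePoints_subset {S : Finset (Fin N)} {σ : Equiv.Perm (Fin N)} (h : σ ∈ permsOn S)
    {a : Fin N} (ha : a ∈ S) : cyclePoints σ a ⊆ S := by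
  rw [cyclePoints_eq]
  refine Finset.insert_subset ha ((Equiv.Perm.support_cycleOf_le σ a).trans (mem_permsOn.1 h))

theorem cycleOf_eq_self_of_mem_cyclesOn {A : Finset (Fin N)} {a : Fin N} {c : Equiv.Perm (Fin N)}
    (hc : c ∈ cyclesOn A a) : c.cycleOf a = c := by
  rw [cyclesOn, Finset.mem_filter, mem_permsOn] at hc
  ext y
  by_cases h : c.SameCycle a y
  · rw [h.cycleOf_apply]
  · rw [Equiv.Perm.cycleOf_apply_of_not_sameCycle h]
    have : y ∉ c.support := fun hy => h (by
      have := hc.1 hy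
      rw [← hc.2] at this
      simpa [cyclePoints] using this)
    rw [Equiv.Perm.notMem_support.1 this]

theorem disjoint_of_mem {A S : Finset (Fin N)} {c τ : Equiv.Perm (Fin N)}
    (hc : c ∈ permsOn A) (hτ : τ ∈ permsOn (S \ A)) : c.Disjoint τ := by
  rw [Equiv.Perm.disjoint_iff_disjoint_support]
  exact Finset.disjoint_of_subset_left (mem_permsOn.1 hc)
    (Finset.disjoint_of_subset_right (mem_permsOn.1 hτ) Finset.disjoint_sdiff)

theorem cycleOf_mul_left {A S : Finset (Fin N)} {c τ : Equiv.Perm (Fin N)} {a : Fin N}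
    (ha : a ∈ A) (hc : c ∈ permsOn A) (hτ : τ ∈ permsOn (S \ A)) :
    (c * τ).cycleOf a = c.cycleOf a := by
  rw [(disjoint_of_mem hc hτ).cycleOf_mul_distrib, (Equiv.Perm.cycleOf_eq_one_iff τ).2, mul_one]
  rw [← Equiv.Perm.notMem_support]
  intro h
  exact (Finset.mem_sdiff.1 (mem_permsOn.1 hτ h)).2 ha

theorem cycleOf_mul_right {A S : Finset (Fin N)} {c τ : Equiv.Perm (Fin N)} {a : Fin N}
    (ha : a ∉ A) (hc : c ∈ permsOn A) (hτ : τ ∈ permsOn (S \ A)) :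
    (c * τ).cycleOf a = τ.cycleOf a := by
  rw [(disjoint_of_mem hc hτ).cycleOf_mul_distrib, (Equiv.Perm.cycleOf_eq_one_iff c).2, one_mul]
  rw [← Equiv.Perm.notMem_support]
  exact fun h => ha (mem_permsOn.1 hc h)

/-- Weights are multiplicative over disjoint cycles. Since `cycleType` omits fixed points, a cycle
of length one has to be counted through the power of `x 1` instead. -/
theorem weightOn_mul (x : ℕ → ℝ) {A S : Finset (Fin N)} {a : Fin N} {c τ : Equiv.Perm (Fin N)}
    (hA : A ⊆ S) (hc : c ∈ cyclesOn A a) (hτ : τ ∈ permsOn (S \ A)) :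
    weightOn x S (c * τ) = x A.card * weightOn x (S \ A) τ := by
  have hc' := (Finset.mem_filter.1 hc)
  have hd := disjoint_of_mem hc'.1 hτ
  have h1 : τ.support.card ≤ (S \ A).card := Finset.card_le_card (mem_permsOn.1 hτ)
  have h2 : (S \ A).card = S.card - A.card := Finset.card_sdiff_of_subset hA
  have h3 : A.card ≤ S.card := Finset.card_le_card hA
  rw [weightOn, weightOn, hd.cycleType_mul, hd.card_support_mul, Multiset.map_add,
    Multiset.prod_add]
  have hcc := cycleOf_eq_self_of_mem_cyclesOn hc
  have hA2 := hc'.2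
  rw [cyclePoints_eq, hcc] at hA2
  by_cases hc1 : c = 1
  · subst hc1
    have : A.card = 1 := by rw [← hA2]; simp
    rw [this]
    simp only [Equiv.Perm.cycleType_one, Multiset.map_zero, Multiset.prod_zero, one_mul,
      Equiv.Perm.support_one, Finset.card_empty, zero_add]
    rw [show S.card - τ.support.card = (S \ A).card - τ.support.card + 1 by omega, pow_succ]
    ring
  · have hcyc : c.IsCycle := by
      rw [← hcc]
      apply Equiv.Perm.isCycle_cycleOf
      intro h
      apply hc1
      rw [← hcc]
      exact (Equiv.Perm.cycleOf_eq_one_iff c).2 h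
    have has : a ∈ c.support := by
      rw [← hcc, Equiv.Perm.mem_support_cycleOf_iff]
      refine ⟨Equiv.Perm.SameCycle.refl _ _, ?_⟩
      rw [Equiv.Perm.mem_support]
      intro h
      apply hc1
      rw [← hcc]
      exact (Equiv.Perm.cycleOf_eq_one_iff c).2 h
    rw [Finset.insert_eq_of_mem has] at hA2
    rw [hcyc.cycleType, hA2, h2]
    simp only [Multiset.map_singleton, Multiset.prod_singleton]
    rw [show S.card - (A.card + τ.support.card) = S.card - A.card - τ.support.card by omega]
    ring

theorem cycleOf_mem_cyclesOn (σ : Equiv.Perm (Fin N)) (a : Fin N) :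
    σ.cycleOf a ∈ cyclesOn (cyclePoints σ a) a := by
  rw [cyclesOn, Finset.mem_filter]
  refine ⟨?_, ?_⟩
  · rw [mem_permsOn, cyclePoints_eq]
    exact Finset.subset_insert _ _
  rw [cyclePoints_eq, cyclePoints_eq]
  congr 2
  ext y
  by_cases h : (σ.cycleOf a).SameCycle a y
  · rw [h.cycleOf_apply]
  · rw [Equiv.Perm.cycleOf_apply_of_not_sameCycle h]
    by_contra hne
    have hne' : (σ.cycleOf a) y ≠ y := fun h' => hne (by rw [h'])
    have hy2 := Equiv.Perm.mem_support_cycleOf_iff.1 (Equiv.Perm.mem_support.2 hne')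
    have ha := Equiv.Perm.mem_support.1 hy2.2
    exact h ((Equiv.Perm.isCycle_cycleOf σ ha).sameCycle
      (by rwa [Equiv.Perm.cycleOf_apply_self]) hne')

theorem mul_inv_cycleOf_mem_permsOn {S : Finset (Fin N)} {σ : Equiv.Perm (Fin N)}
    (hσ : σ ∈ permsOn S) (a : Fin N) :
    σ * (σ.cycleOf a)⁻¹ ∈ permsOn (S \ cyclePoints σ a) := by
  rw [mem_permsOn]
  intro y hy
  rw [Equiv.Perm.mem_support, Equiv.Perm.mul_apply] at hy
  rw [Finset.mem_sdiff]
  have hnot : y ∉ cyclePoints σ a := by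
    intro hmem
    apply hy
    have hs : σ.SameCycle a y := by simpa [cyclePoints] using hmem
    have h2 : σ.SameCycle a (σ⁻¹ y) := Equiv.Perm.sameCycle_symm_apply_right.2 hs
    have : (σ.cycleOf a)⁻¹ y = σ⁻¹ y := by
      rw [Equiv.Perm.inv_eq_iff_eq, h2.cycleOf_apply]
      simp
    rw [this]; simp
  refine ⟨?_, hnot⟩
  have : (σ.cycleOf a)⁻¹ y = y := by
    rw [Equiv.Perm.inv_eq_iff_eq, Equiv.Perm.cycleOf_apply_of_not_sameCycle]
    intro h
    exact hnot (by simpa [cyclePoints] using h)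
  rw [this] at hy
  exact mem_permsOn.1 hσ (Equiv.Perm.mem_support.2 hy)

theorem cycleOf_mul_rest {S : Finset (Fin N)} {σ : Equiv.Perm (Fin N)}
    (hσ : σ ∈ permsOn S) (a : Fin N) : σ.cycleOf a * (σ * (σ.cycleOf a)⁻¹) = σ := by
  have := (disjoint_of_mem (Finset.mem_filter.1 (cycleOf_mem_cyclesOn σ a)).1
    (mul_inv_cycleOf_mem_permsOn hσ a)).commute
  rw [this.eq, inv_mul_cancel_right]

/-- Splitting off the cycle of `a`. -/
theorem sum_permsOn_eq (x : ℕ → ℝ) (g : Finset (Fin N) → Equiv.Perm (Fin N) → ℝ)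
    {S : Finset (Fin N)} {a : Fin N} (ha : a ∈ S) :
    ∑ σ ∈ permsOn S, weightOn x S σ * g (cyclePoints σ a) (σ * (σ.cycleOf a)⁻¹)
      = ∑ A ∈ S.powerset.filter (a ∈ ·), (cyclesOn A a).card * (x A.card *
          ∑ τ ∈ permsOn (S \ A), weightOn x (S \ A) τ * g A τ) := by
  have h1 : ∀ A ∈ S.powerset.filter (a ∈ ·), ((cyclesOn A a).card : ℝ) * (x A.card *
          ∑ τ ∈ permsOn (S \ A), weightOn x (S \ A) τ * g A τ)
      = ∑ p ∈ cyclesOn A a ×ˢ permsOn (S \ A), x A.card * (weightOn x (S \ A) p.2 * g A p.2) := by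
    intro A _
    rw [Finset.sum_product]
    simp [Finset.mul_sum]
  rw [Finset.sum_congr rfl h1, Finset.sum_sigma']
  -- A permutation corresponds to the triple formed by the point set of the cycle through `a`, that
  -- cycle `c`, and `τ = σ c⁻¹`. The inverse map is the product `c τ`, the factors having disjoint
  -- supports.
  refine Finset.sum_bij' (fun σ _ => ⟨cyclePoints σ a, (σ.cycleOf a, σ * (σ.cycleOf a)⁻¹)⟩)
    (fun p _ => p.2.1 * p.2.2) ?_ ?_ ?_ ?_ ?_
  · intro σ hσ
    simp only [Finset.mem_sigma, Finset.mem_filter, Finset.mem_powerset, Finset.mem_product]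
    exact ⟨⟨cyclePoints_subset hσ ha, mem_cyclePoints_self σ a⟩, cycleOf_mem_cyclesOn σ a,
      mul_inv_cycleOf_mem_permsOn hσ a⟩
  · rintro ⟨A, c, τ⟩ hp
    simp only [Finset.mem_sigma, Finset.mem_filter, Finset.mem_powerset, Finset.mem_product] at hp
    obtain ⟨⟨hA, haA⟩, hc, hτ⟩ := hp
    rw [mem_permsOn]
    have := (disjoint_of_mem (Finset.mem_filter.1 hc).1 hτ).support_mul
    rw [this]
    exact Finset.union_subset ((mem_permsOn.1 (Finset.mem_filter.1 hc).1).trans hA)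
      ((mem_permsOn.1 hτ).trans Finset.sdiff_subset)
  · intro σ hσ
    exact cycleOf_mul_rest hσ a
  · rintro ⟨A, c, τ⟩ hp
    simp only [Finset.mem_sigma, Finset.mem_filter, Finset.mem_powerset, Finset.mem_product] at hp
    obtain ⟨⟨hA, haA⟩, hc, hτ⟩ := hp
    have hcc := cycleOf_eq_self_of_mem_cyclesOn hc
    have hc' := Finset.mem_filter.1 hc
    have h1 : (c * τ).cycleOf a = c := by rw [cycleOf_mul_left haA hc'.1 hτ, hcc]
    have h2 : cyclePoints (c * τ) a = A := by
      rw [cyclePoints_eq, h1, ← hc'.2, cyclePoints_eq, hcc]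
    have h3 : c * τ * c⁻¹ = τ := by
      rw [(disjoint_of_mem hc'.1 hτ).commute.eq, mul_assoc, mul_inv_cancel, mul_one]
    simp only [h1, h2, h3]
  · intro σ hσ
    have := weightOn_mul x (cyclePoints_subset hσ ha)
      (cycleOf_mem_cyclesOn σ a) (mul_inv_cycleOf_mem_permsOn hσ a)
    rw [cycleOf_mul_rest hσ a] at this
    rw [this, mul_assoc]

theorem card_permsOn (S : Finset (Fin N)) : (permsOn S).card = S.card.factorial := by
  have h := Fintype.card_congr (Equiv.Perm.subtypeEquivSubtypePerm (fun a => a ∈ S))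
  rw [Fintype.card_perm, Fintype.card_coe] at h
  rw [h, Fintype.card_subtype]
  congr 1
  ext σ
  simp only [mem_permsOn, Finset.mem_filter, Finset.mem_univ, true_and]
  constructor
  · intro hs b hb
    by_contra hne
    exact hb (hs (Equiv.Perm.mem_support.2 hne))
  · intro hs b hb
    by_contra hne
    exact Equiv.Perm.mem_support.1 hb (hs b hne)

/-- A set containing `a` is determined by its other elements, which leaves `choose (|S| - 1) (l -
1)` sets of size `l`. -/
theorem sum_powerset_mem_eq (f : ℕ → ℝ) {S : Finset (Fin N)} {a : Fin N} (ha : a ∈ S) :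
    ∑ A ∈ S.powerset.filter (a ∈ ·), f A.card
      = ∑ l ∈ Finset.Icc 1 S.card, ((S.card - 1).choose (l - 1) : ℝ) * f l := by
  have h1 : ∑ A ∈ S.powerset.filter (a ∈ ·), f A.card
      = ∑ B ∈ (S.erase a).powerset, f (B.card + 1) := by
    refine Finset.sum_bij' (fun A _ => A.erase a) (fun B _ => insert a B) ?_ ?_ ?_ ?_ ?_
    · intro A hA
      simp only [Finset.mem_filter, Finset.mem_powerset] at hA ⊢
      exact Finset.erase_subset_erase a hA.1
    · intro B hB
      simp only [Finset.mem_filter, Finset.mem_powerset] at hB ⊢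
      exact ⟨Finset.insert_subset ha (hB.trans (Finset.erase_subset _ _)),
        Finset.mem_insert_self _ _⟩
    · intro A hA
      exact Finset.insert_erase (Finset.mem_filter.1 hA).2
    · intro B hB
      exact Finset.erase_insert fun h => by
        simpa using Finset.mem_powerset.1 hB h
    · intro A hA
      rw [Finset.card_erase_add_one (Finset.mem_filter.1 hA).2]
  rw [h1, Finset.sum_powerset_apply_card (fun m => f (m + 1)), Finset.card_erase_of_mem ha]
  have hpos : 0 < S.card := Finset.card_pos.2 ⟨a, ha⟩
  rw [Nat.sub_add_cancel hpos, Finset.range_eq_Ico]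
  have := Finset.sum_Ico_add' (fun l => ((S.card - 1).choose (l - 1) : ℝ) * f l) 0 S.card 1
  simp only [Nat.add_sub_cancel, zero_add] at this
  simp only [nsmul_eq_mul]
  rw [this]
  rfl

theorem choose_mul_factorial_mul_factorial' {n l : ℕ} (hl : 1 ≤ l) (hln : l ≤ n) :
    ((n - 1).choose (l - 1) : ℝ) * (l - 1).factorial * (n - l).factorial = (n - 1).factorial := by
  have := Nat.choose_mul_factorial_mul_factorial (show l - 1 ≤ n - 1 by omega)
  rw [show n - 1 - (l - 1) = n - l by omega] at this
  exact_mod_cast this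

/-- No explicit enumeration of cycles is needed: with all weights equal to one, splitting off the
cycle of `a` writes `n!` as a sum over `B ∋ a` of the number of cycles on `B` times `(n - |B|)!`. By
induction every term with `B ≠ A` has its expected value, and `∑ choose (n-1) (l-1) (l-1)! (n-l)! =
n!` forces the last one. -/
theorem card_cyclesOn {A : Finset (Fin N)} {a : Fin N} (ha : a ∈ A) :
    ((cyclesOn A a).card : ℝ) = (A.card - 1).factorial := by
  induction hn : A.card using Nat.strong_induction_on generalizing A with
  | _ n ih =>
  have h := sum_permsOn_eq (fun _ => 1) (fun _ _ => 1) ha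
  simp only [weightOn, Multiset.map_const', Multiset.prod_replicate, one_pow, mul_one, one_mul,
    Finset.sum_const, nsmul_eq_mul, card_permsOn] at h
  have hA : A ∈ A.powerset.filter (a ∈ ·) := by simp [ha]
  have hpos : 0 < n := hn ▸ Finset.card_pos.2 ⟨a, ha⟩
  set f : ℕ → ℝ := fun l => (l - 1).factorial * (n - l).factorial with hf
  have h2 := sum_powerset_mem_eq f ha
  rw [← Finset.add_sum_erase _ _ hA] at h h2
  have h3 : ∀ B ∈ (A.powerset.filter (a ∈ ·)).erase A,
      ((cyclesOn B a).card : ℝ) * ((A \ B).card.factorial : ℝ) = f B.card := by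
    intro B hB
    simp only [Finset.mem_erase, Finset.mem_filter, Finset.mem_powerset] at hB
    have hlt : B.card < n := hn ▸ Finset.card_lt_card (Finset.ssubset_iff_subset_ne.2 ⟨hB.2.1, hB.1⟩)
    rw [ih _ hlt hB.2.2 rfl, Finset.card_sdiff_of_subset hB.2.1, hn]
  rw [Finset.sum_congr rfl h3] at h
  have h4 : ∑ l ∈ Finset.Icc 1 A.card, ((A.card - 1).choose (l - 1) : ℝ) * f l = n.factorial := by
    rw [hn, Finset.sum_congr rfl (g := fun _ => ((n - 1).factorial : ℝ))]
    · rw [Finset.sum_const, Nat.card_Icc, nsmul_eq_mul, Nat.add_sub_cancel]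
      exact_mod_cast Nat.mul_factorial_pred hpos.ne'
    · intro l hl
      rw [Finset.mem_Icc] at hl
      rw [hf, ← choose_mul_factorial_mul_factorial' hl.1 hl.2]
      ring
  rw [h4] at h2
  have h5 : f A.card = (n - 1).factorial := by simp [hf, hn]
  rw [h5] at h2
  simp only [Finset.sdiff_self, Finset.card_empty, Nat.factorial_zero, Nat.cast_one, mul_one] at h
  rw [hn] at h
  linarith

/-- When the inner sum depends only on the size of the cycle, the combinatorial factors collapse by
`choose (n-1) (l-1) (l-1)! (n-l)! = (n-1)!`. What remains is the kernel `x_l / n`, the same for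
every marked point. -/
theorem sum_permsOn_eq_sum_card (x : ℕ → ℝ) (g : Finset (Fin N) → Equiv.Perm (Fin N) → ℝ)
    {S : Finset (Fin N)} {a : Fin N} (ha : a ∈ S) (f : ℕ → ℝ)
    (hf : ∀ A ⊆ S, a ∈ A → ∑ τ ∈ permsOn (S \ A), weightOn x (S \ A) τ * g A τ
      = (S.card - A.card).factorial * f A.card) :
    ∑ σ ∈ permsOn S, weightOn x S σ * g (cyclePoints σ a) (σ * (σ.cycleOf a)⁻¹)
      = S.card.factorial * ((∑ l ∈ Finset.Icc 1 S.card, x l * f l) / S.card) := by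
  rw [sum_permsOn_eq x g ha]
  have h1 : ∀ A ∈ S.powerset.filter (a ∈ ·), ((cyclesOn A a).card : ℝ) * (x A.card *
          ∑ τ ∈ permsOn (S \ A), weightOn x (S \ A) τ * g A τ)
      = (fun l => ((l - 1).factorial : ℝ) * (x l * ((S.card - l).factorial * f l))) A.card := by
    intro A hA
    simp only [Finset.mem_filter, Finset.mem_powerset] at hA
    rw [card_cyclesOn hA.2, hf A hA.1 hA.2]
  have hpos : 0 < S.card := Finset.card_pos.2 ⟨a, ha⟩
  have hpos' : (S.card : ℝ) ≠ 0 := by exact_mod_cast hpos.ne'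
  have hfac : (S.card.factorial : ℝ) = S.card * (S.card - 1).factorial := by
    exact_mod_cast (Nat.mul_factorial_pred hpos.ne').symm
  rw [Finset.sum_congr rfl h1, sum_powerset_mem_eq
    (fun l => ((l - 1).factorial : ℝ) * (x l * ((S.card - l).factorial * f l))) ha, hfac, mul_comm (S.card : ℝ), mul_assoc,
    mul_div_cancel₀ _ hpos', Finset.mul_sum]
  refine Finset.sum_congr rfl fun l hl => ?_
  rw [Finset.mem_Icc] at hl
  rw [← choose_mul_factorial_mul_factorial' hl.1 hl.2]
  ring

/-! ### Total weights, without and with constraints on the first cycle lengths -/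

theorem sum_weightOn (x : ℕ → ℝ) (S : Finset (Fin N)) :
    ∑ σ ∈ permsOn S, weightOn x S σ = S.card.factorial * expCoeff x S.card := by
  induction hn : S.card using Nat.strong_induction_on generalizing S with
  | _ n ih =>
  rcases S.eq_empty_or_nonempty with rfl | ⟨a, ha⟩
  · have : permsOn (∅ : Finset (Fin N)) = {1} := by
      ext σ
      simp [mem_permsOn]
    rw [this]
    simp only [Finset.card_empty] at hn
    subst hn
    simp [weightOn, expCoeff]
  · have hpos : 0 < n := hn ▸ Finset.card_pos.2 ⟨a, ha⟩
    have h := sum_permsOn_eq_sum_card x (fun _ _ => 1) ha (fun l => expCoeff x (n - l)) ?_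
    · simp only [mul_one] at h
      rw [h, hn, expCoeff_eq_cycleStep x hpos.ne']
      simp [cycleStep]
    · intro A hA haA
      simp only [mul_one]
      have h1 : (S \ A).card = n - A.card := by rw [Finset.card_sdiff_of_subset hA, hn]
      have h2 : 0 < A.card := Finset.card_pos.2 ⟨a, haA⟩
      rw [ih (n - A.card) (by omega) (S \ A) h1, hn]

/-- The first cycle lengths of the permutation `σ` of the points of `S` are in prescribed sets. -/
def LexMem (σ : Equiv.Perm (Fin N)) : List (Set ℕ) → Finset (Fin N) → Prop
  | [], _ => True
  | A :: As, S => ∃ h : S.Nonempty, (cyclePoints σ (S.min' h)).card ∈ A ∧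
      LexMem σ As (S \ cyclePoints σ (S.min' h))

theorem LexMem.congr {σ τ : Equiv.Perm (Fin N)} (As : List (Set ℕ)) (S : Finset (Fin N))
    (h : ∀ a ∈ S, cyclePoints σ a = cyclePoints τ a) : LexMem σ As S ↔ LexMem τ As S := by
  induction As generalizing S with
  | nil => rfl
  | cons A As ih =>
    simp only [LexMem]
    refine exists_congr fun hS => ?_
    rw [h _ (S.min'_mem hS), ih]
    exact fun a ha => h a (Finset.mem_sdiff.1 ha).1

open Classical in
-- Once the cycle of the smallest point is removed, the rest is an arbitrary weighted permutation of
-- the remaining points, and only their number matters. Each prescribed set therefore contributes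
-- one `cycleStep`.
theorem sum_weightOn_lexMem (x : ℕ → ℝ) (As : List (Set ℕ)) (S : Finset (Fin N)) :
    ∑ σ ∈ permsOn S, weightOn x S σ * (if LexMem σ As S then 1 else 0)
      = S.card.factorial * lexCoeff x As S.card := by
  induction As generalizing S with
  | nil => simpa [LexMem, lexCoeff] using sum_weightOn x S
  | cons A As ih =>
    rcases S.eq_empty_or_nonempty with rfl | hS
    · simp [LexMem, lexCoeff, cycleStep]
    · have ha := S.min'_mem hS
      set a := S.min' hS with ha_def
      have h := sum_permsOn_eq_sum_card x
        (fun B τ => if B.card ∈ A ∧ LexMem τ As (S \ B) then 1 else 0) ha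
        (fun l => if l ∈ A then lexCoeff x As (S.card - l) else 0) ?_
      · simp only [lexCoeff, cycleStep]
        rw [Finset.sum_filter]
        simp only [mul_ite, mul_zero] at h ⊢
        rw [← h]
        refine Finset.sum_congr rfl fun σ hσ => ?_
        refine if_congr ?_ rfl rfl
        have : LexMem σ (A :: As) S ↔ (cyclePoints σ a).card ∈ A ∧
            LexMem σ As (S \ cyclePoints σ a) := by
          simp only [LexMem]
          exact ⟨fun ⟨_, h⟩ => h, fun h => ⟨hS, h⟩⟩
        rw [this]
        -- Outside the cycle of `a`, the permutations `σ` and `σ (σ.cycleOf a)⁻¹` have the same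
        -- cycles.
        refine and_congr_right fun _ => LexMem.congr _ _ fun b hb => ?_
        rw [cyclePoints_eq, cyclePoints_eq]
        conv_lhs => rw [← cycleOf_mul_rest hσ a]
        rw [cycleOf_mul_right (Finset.mem_sdiff.1 hb).2
          (Finset.mem_filter.1 (cycleOf_mem_cyclesOn σ a)).1 (mul_inv_cycleOf_mem_permsOn hσ a)]
      · intro B hB _
        by_cases hBA : B.card ∈ A
        · simp only [hBA, true_and, if_true]
          rw [ih, Finset.card_sdiff_of_subset hB]
        · simp [hBA]

/-! ### The surrogate-spatial measure through lexicographic coefficients -/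

/-- Double counting: over each cycle of length `j`, the map `x ↦ σ.cycleOf x` has exactly `j`
preimages. Length one is separate because fixed points are not cycle factors. -/
theorem card_filter_card_cyclePoints (σ : Equiv.Perm (Fin N)) {j : ℕ} (hj : j ≠ 0) :
    (Finset.univ.filter fun x => (cyclePoints σ x).card = j).card = j * cycleCount σ j := by
  have hcard : ∀ x, x ∈ σ.support → (cyclePoints σ x).card = (σ.cycleOf x).support.card := by
    intro x hx
    rw [cyclePoints_eq, Finset.insert_eq_of_mem]
    rw [Equiv.Perm.mem_support_cycleOf_iff]
    exact ⟨Equiv.Perm.SameCycle.refl _ _, hx⟩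
  have hcard1 : ∀ x, x ∉ σ.support → (cyclePoints σ x).card = 1 := by
    intro x hx
    rw [cyclePoints_eq, (Equiv.Perm.cycleOf_eq_one_iff σ).2 (Equiv.Perm.notMem_support.1 hx)]
    simp
  rw [cycleCount, Equiv.Perm.parts_partition, Multiset.count_add, Multiset.count_replicate]
  rcases eq_or_ne j 1 with rfl | hj1
  · have h0 : Multiset.count 1 σ.cycleType = 0 := by
      rw [Multiset.count_eq_zero]
      intro h
      exact absurd (Equiv.Perm.two_le_of_mem_cycleType h) (by norm_num)
    rw [h0, if_pos rfl, zero_add, one_mul, ← Finset.card_compl]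
    congr 1
    ext x
    simp only [Finset.mem_filter, Finset.mem_univ, true_and, Finset.mem_compl]
    refine ⟨fun h hx => ?_, hcard1 x⟩
    rw [hcard x hx] at h
    exact absurd (Equiv.Perm.two_le_card_support_cycleOf_iff.2 (Equiv.Perm.mem_support.1 hx))
      (by omega)
  · rw [if_neg (Ne.symm hj1), add_zero, Equiv.Perm.cycleType_def, Multiset.count_map]
    have hmaps : ∀ x ∈ Finset.univ.filter (fun x => (cyclePoints σ x).card = j),
        σ.cycleOf x ∈ σ.cycleFactorsFinset.filter (fun c => c.support.card = j) := by
      intro x hx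
      rw [Finset.mem_filter] at hx
      have hxs : x ∈ σ.support := by
        by_contra h
        exact hj1 (hx.2 ▸ (hcard1 x h).symm ▸ rfl)
      rw [Finset.mem_filter, Equiv.Perm.cycleOf_mem_cycleFactorsFinset_iff]
      exact ⟨hxs, (hcard x hxs).symm.trans hx.2⟩
    rw [Finset.card_eq_sum_card_fiberwise hmaps]
    have hfib : ∀ c ∈ σ.cycleFactorsFinset.filter (fun c => c.support.card = j),
        ((Finset.univ.filter (fun x => (cyclePoints σ x).card = j)).filter
          (fun x => σ.cycleOf x = c)).card = j := by
      intro c hc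
      rw [Finset.mem_filter] at hc
      refine Eq.trans ?_ hc.2
      congr 1
      ext x
      simp only [Finset.mem_filter, Finset.mem_univ, true_and]
      constructor
      · rintro ⟨h1, rfl⟩
        have hxs : x ∈ σ.support := by
          by_contra h
          exact hj1 (h1 ▸ (hcard1 x h).symm ▸ rfl)
        rw [Equiv.Perm.mem_support_cycleOf_iff]
        exact ⟨Equiv.Perm.SameCycle.refl _ _, hxs⟩
      · intro hx
        have hxs := Equiv.Perm.mem_cycleFactorsFinset_support_le hc.1 hx
        have h2 := (Equiv.Perm.cycle_is_cycleOf hx hc.1).symm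
        exact ⟨by rw [hcard x hxs, h2, hc.2], h2⟩
    rw [Finset.sum_congr rfl hfib, Finset.sum_const, smul_eq_mul, mul_comm]
    congr 1
    rw [Finset.card_def, Finset.filter_val]
    congr 1
    exact Multiset.filter_congr fun c _ => eq_comm

/-- Counting by points rather than by cycles prepares the use of exchangeability: each point has the
same cycle length distribution. -/
theorem sum_mul_cycleCount (σ : Equiv.Perm (Fin N)) (K : ℕ) :
    ∑ j ∈ Finset.Ioc K N, (j : ℝ) * cycleCount σ j
      = ∑ x : Fin N, if (cyclePoints σ x).card ∈ Set.Ioi K then 1 else 0 := by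
  have h1 : ∀ j ∈ Finset.Ioc K N, (j : ℝ) * cycleCount σ j
      = ∑ x : Fin N, if (cyclePoints σ x).card = j then 1 else 0 := by
    intro j hj
    rw [Finset.mem_Ioc] at hj
    rw [← Nat.cast_mul, ← card_filter_card_cyclePoints σ (by omega), Finset.sum_boole]
  rw [Finset.sum_congr rfl h1, Finset.sum_comm]
  refine Finset.sum_congr rfl fun x _ => ?_
  rw [Finset.sum_ite_eq]
  refine if_congr ?_ rfl rfl
  have : (cyclePoints σ x).card ≤ N := by simpa using Finset.card_le_univ (cyclePoints σ x)
  simp [this]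

/-- The weights `θ_j + N κ_j`. -/
noncomputable def cycleWeight (θ κ : ℕ → ℝ≥0) (N : ℕ) (j : ℕ) : ℝ := θ j + N * κ j

theorem weight_eq_weightOn (θ κ : ℕ → ℝ≥0) (σ : Equiv.Perm (Fin N)) :
    (weight θ κ σ : ℝ) = weightOn (cycleWeight θ κ N) Finset.univ σ := by
  have h1 : (weight θ κ σ : ℝ)
      = ∏ j ∈ Finset.Icc 1 N, cycleWeight θ κ N j ^ σ.partition.parts.count j := by
    simp [weight, cycleWeight, cycleCount]
  have hsub : σ.partition.parts.toFinset ⊆ Finset.Icc 1 N := by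
    intro j hj
    rw [Multiset.mem_toFinset] at hj
    rw [Finset.mem_Icc]
    refine ⟨σ.partition.parts_pos hj, ?_⟩
    have := Multiset.le_sum_of_mem hj
    rw [σ.partition.parts_sum, Fintype.card_fin] at this
    exact this
  rw [h1, ← Finset.prod_subset hsub, ← Finset.prod_multiset_map_count,
    Equiv.Perm.parts_partition, Multiset.map_add, Multiset.prod_add, weightOn]
  · simp
  · intro j _ hj
    rw [Multiset.mem_toFinset] at hj
    rw [Multiset.count_eq_zero.2 hj, pow_zero]

theorem normConst_eq_expCoeff (θ κ : ℕ → ℝ≥0) (N : ℕ) :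
    (normConst θ κ N : ℝ) = expCoeff (cycleWeight θ κ N) N := by
  have h := sum_weightOn (cycleWeight θ κ N) (Finset.univ : Finset (Fin N))
  have hu : permsOn (Finset.univ : Finset (Fin N)) = Finset.univ := by
    ext σ; simp [mem_permsOn]
  rw [hu, Finset.card_univ, Fintype.card_fin] at h
  rw [normConst]
  push_cast
  simp only [weight_eq_weightOn]
  rw [h, inv_mul_cancel_left₀ (by exact_mod_cast N.factorial_ne_zero)]

theorem integral_surrogateMeasure (θ κ : ℕ → ℝ≥0) (hN : normConst θ κ N ≠ 0)
    (g : Equiv.Perm (Fin N) → ℝ) :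
    ∫ σ, g σ ∂(surrogateMeasure θ κ N)
      = (∑ σ ∈ permsOn Finset.univ, weightOn (cycleWeight θ κ N) Finset.univ σ * g σ)
        / (N.factorial * expCoeff (cycleWeight θ κ N) N) := by
  have hu : permsOn (Finset.univ : Finset (Fin N)) = Finset.univ := by
    ext σ; simp [mem_permsOn]
  rw [surrogateMeasure, PMF.integral_eq_sum, hu, Finset.sum_div]
  refine Finset.sum_congr rfl fun σ _ => ?_
  rw [surrogatePMF, dif_pos hN, PMF.ofFintype_apply, ← weight_eq_weightOn, ← normConst_eq_expCoeff]
  simp [prob]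
  ring

/-- The sets must avoid `0`: when the cycles are exhausted `lexLength` takes the value zero, whereas
`LexMem` fails for a nonempty list. -/
theorem lexMem_remaining_iff (σ : Equiv.Perm (Fin N)) (As : List (Set ℕ)) (h0 : ∀ A ∈ As, 0 ∉ A)
    (k : ℕ) : LexMem σ As (remaining σ k) ↔
      ∀ (i : ℕ) (hi : i < As.length), lexLength σ (k + i) ∈ As[i] := by
  induction As generalizing k with
  | nil => simp [LexMem]
  | cons A As ih =>
    have ih' := ih (fun B hB => h0 B (List.mem_cons_of_mem _ hB)) (k + 1)
    simp only [LexMem]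
    by_cases h : (remaining σ k).Nonempty
    · have hrem : remaining σ (k + 1)
          = remaining σ k \ cyclePoints σ ((remaining σ k).min' h) := by
        rw [remaining, dif_pos h]
      have hlen : lexLength σ k = (cyclePoints σ ((remaining σ k).min' h)).card := by
        rw [lexLength, dif_pos h]
      rw [hrem] at ih'
      constructor
      · rintro ⟨_, h1, h2⟩ i hi
        cases i with
        | zero => simpa [hlen] using h1
        | succ i =>
          have := ih'.1 h2 i (by simpa using hi)
          simpa [add_assoc, add_comm 1 i] using this
      · intro hall
        refine ⟨h, ?_, ?_⟩
        · have : lexLength σ k ∈ A := hall 0 (by simp)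
          rwa [hlen] at this
        · refine ih'.2 fun i hi => ?_
          have := hall (i + 1) (by simpa using hi)
          simpa [add_assoc, add_comm 1 i] using this
    · constructor
      · rintro ⟨h', _⟩
        exact absurd h' h
      · intro hall
        have := hall 0 (by simp)
        simp only [add_zero, List.getElem_cons_zero] at this
        rw [lexLength, dif_neg h] at this
        exact absurd this (h0 A (by simp))

theorem measureReal_lexLength (θ κ : ℕ → ℝ≥0) (hN : normConst θ κ N ≠ 0) (As : List (Set ℕ))
    (h0 : ∀ A ∈ As, 0 ∉ A) :
    (surrogateMeasure θ κ N).real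
        {σ | ∀ (i : ℕ) (hi : i < As.length), lexLength σ i ∈ As[i]}
      = lexCoeff (cycleWeight θ κ N) As N / expCoeff (cycleWeight θ κ N) N := by
  classical
  have hf : (N.factorial : ℝ) ≠ 0 := by exact_mod_cast N.factorial_ne_zero
  rw [← integral_indicator_one (MeasurableSet.of_discrete), integral_surrogateMeasure θ κ hN]
  have h := sum_weightOn_lexMem (cycleWeight θ κ N) As (Finset.univ : Finset (Fin N))
  rw [Finset.card_univ, Fintype.card_fin] at h
  rw [← mul_div_mul_left (lexCoeff _ As N) _ hf, ← h]
  congr 1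
  refine Finset.sum_congr rfl fun σ _ => ?_
  rw [Set.indicator_apply]
  congr 1
  refine if_congr ?_ rfl rfl
  have := lexMem_remaining_iff σ As h0 0
  simp only [remaining, zero_add] at this
  rw [this]
  rfl

/-- All `N` points contribute equally, so the expectation is `N` times the probability that one
marked point lies in a cycle longer than `K`. -/
theorem integral_sum_mul_cycleCount (θ κ : ℕ → ℝ≥0) (hN : normConst θ κ N ≠ 0) (K : ℕ) :
    ∫ σ, (∑ j ∈ Finset.Ioc K N, (j : ℝ) * (cycleCount σ j : ℝ)) ∂(surrogateMeasure θ κ N)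
      = N * (cycleStep (cycleWeight θ κ N) (Set.Ioi K) (expCoeff (cycleWeight θ κ N)) N
        / expCoeff (cycleWeight θ κ N) N) := by
  classical
  have hf : (N.factorial : ℝ) ≠ 0 := by exact_mod_cast N.factorial_ne_zero
  set x := cycleWeight θ κ N with hx
  have h1 : ∀ a : Fin N, ∑ σ ∈ permsOn (Finset.univ : Finset (Fin N)), weightOn x Finset.univ σ *
      (if (cyclePoints σ a).card ∈ Set.Ioi K then 1 else 0)
      = N.factorial * cycleStep x (Set.Ioi K) (expCoeff x) N := by
    intro a
    have h := sum_permsOn_eq_sum_card x (S := Finset.univ)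
        (fun B _ => if B.card ∈ Set.Ioi K then 1 else 0) (Finset.mem_univ a)
        (fun l => if l ∈ Set.Ioi K then expCoeff x (N - l) else 0) ?_
    · rw [h, Finset.card_univ, Fintype.card_fin, cycleStep, Finset.sum_filter]
      simp
    · intro A hA _
      by_cases hK : A.card ∈ Set.Ioi K
      · simp only [hK, if_true, mul_one]
        rw [sum_weightOn, Finset.card_sdiff_of_subset hA, Finset.card_univ, Fintype.card_fin]
      · simp [hK]
  rw [integral_surrogateMeasure θ κ hN]
  simp only [sum_mul_cycleCount, Finset.mul_sum]
  rw [Finset.sum_comm, Finset.sum_congr rfl fun a _ => h1 a, Finset.sum_const, Finset.card_univ,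
    Fintype.card_fin, nsmul_eq_mul, ← mul_div_mul_left _ (expCoeff x N) hf]
  ring

/-! ### The probability distribution with weights `expCoeff` -/

theorem nat_mul_expCoeff (x : ℕ → ℝ) (n : ℕ) :
    n * expCoeff x n = ∑ l ∈ Finset.Icc 1 n, x l * expCoeff x (n - l) := by
  rcases eq_or_ne n 0 with rfl | hn
  · simp
  · have hn' : (n : ℝ) ≠ 0 := by exact_mod_cast hn
    conv_lhs => rw [expCoeff_eq_cycleStep x hn, cycleStep, mul_div_cancel₀ _ hn']
    simp

theorem expCoeff_nonneg {x : ℕ → ℝ} (hx : ∀ l, 0 ≤ x l) (n : ℕ) : 0 ≤ expCoeff x n := by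
  induction n using Nat.strong_induction_on with
  | _ n ih =>
  rcases eq_or_ne n 0 with rfl | hn
  · simp [expCoeff]
  · rw [expCoeff_eq_cycleStep x hn, cycleStep]
    refine div_nonneg (Finset.sum_nonneg fun l hl => ?_) (Nat.cast_nonneg n)
    simp only [Set.mem_univ, Finset.filter_true, Finset.mem_Icc] at hl
    exact mul_nonneg (hx l) (ih _ (by omega))

theorem nat_mul_expCoeff_antidiagonal {x : ℕ → ℝ} (hx0 : x 0 = 0) (n : ℕ) :
    n * expCoeff x n = ∑ p ∈ Finset.HasAntidiagonal.antidiagonal n, x p.1 * expCoeff x p.2 := by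
  rw [nat_mul_expCoeff, Finset.Nat.sum_antidiagonal_eq_sum_range_succ
    (fun i j => x i * expCoeff x j), Finset.sum_range_succ', hx0, zero_mul, add_zero]
  rw [Finset.range_eq_Ico]
  have := Finset.sum_Ico_add' (fun l => x l * expCoeff x (n - l)) 0 n 1
  rw [this]
  rfl

/-- Write `h_n` for the coefficients and `X = ∑ x_l`. Summing `n h_n = ∑ x_l h_{n-l}` over `n < k`
gives `∑ n h_n ≤ X ∑ h_n`, so the indices far above `X` cannot carry much of the sum. -/
theorem summable_expCoeff {x : ℕ → ℝ} (hx : ∀ l, 0 ≤ x l) (hs : Summable x) :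
    Summable (expCoeff x) := by
  have hh := expCoeff_nonneg hx
  set X := ∑' l, x l with hX
  have hX0 : 0 ≤ X := tsum_nonneg hx
  have h1 : ∀ k, ∑ n ∈ Finset.range k, n * expCoeff x n
      ≤ X * ∑ n ∈ Finset.range k, expCoeff x n := by
    intro k
    have h2 : ∀ n ∈ Finset.range k, n * expCoeff x n
        ≤ ∑ m ∈ Finset.range k, if m ≤ n then x (n - m) * expCoeff x m else 0 := by
      intro n hn
      rw [Finset.mem_range] at hn
      rw [nat_mul_expCoeff, ← Finset.sum_filter]
      refine (Finset.sum_bij_ne_zero (fun l _ _ => n - l) ?_ ?_ ?_ ?_).le.trans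
        (Finset.sum_le_sum_of_subset_of_nonneg (s := Finset.range n) ?_ ?_)
      · intro l hl _
        rw [Finset.mem_Icc] at hl
        exact Finset.mem_range.2 (by omega)
      · intro l hl _ l' hl' _ h
        rw [Finset.mem_Icc] at hl hl'
        omega
      · intro m hm _
        rw [Finset.mem_range] at hm
        refine ⟨n - m, Finset.mem_Icc.2 (by omega), ?_, by omega⟩
        rwa [show n - (n - m) = m by omega]
      · intro l hl _
        rw [Finset.mem_Icc] at hl
        rw [show n - (n - l) = l by omega]
      · intro m hm
        rw [Finset.mem_range] at hm
        exact Finset.mem_filter.2 ⟨Finset.mem_range.2 (by omega), hm.le⟩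
      · intro m _ _
        exact mul_nonneg (hx _) (hh _)
    refine (Finset.sum_le_sum h2).trans ?_
    rw [Finset.sum_comm, Finset.mul_sum]
    refine Finset.sum_le_sum fun m hm => ?_
    rw [← Finset.sum_filter, ← Finset.sum_mul]
    refine mul_le_mul_of_nonneg_right ?_ (hh m)
    have h3 : (Finset.range k).filter (m ≤ ·) = Finset.Ico m k := by
      ext n
      simp only [Finset.mem_filter, Finset.mem_range, Finset.mem_Ico]
      omega
    rw [h3, Finset.sum_Ico_eq_sum_range]
    simp only [Nat.add_sub_cancel_left]
    exact hs.sum_le_tsum _ fun _ _ => hx _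
  -- With `S_k` the partial sums, the bound becomes `n0 (S_k - S_{n0}) ≤ X S_k`; since `X < n0 / 2`,
  -- it follows that `S_k ≤ 2 S_{n0}`.
  obtain ⟨n0, hn0⟩ := exists_nat_gt (2 * X)
  refine summable_of_sum_range_le hh (c := 2 * ∑ n ∈ Finset.range n0, expCoeff x n) fun k => ?_
  have h3 : (n0 : ℝ) * (∑ n ∈ Finset.range k, expCoeff x n - ∑ n ∈ Finset.range n0, expCoeff x n)
      ≤ ∑ n ∈ Finset.range k, n * expCoeff x n := by
    rcases le_total k n0 with hk | hk
    · have : ∑ n ∈ Finset.range k, expCoeff x n ≤ ∑ n ∈ Finset.range n0, expCoeff x n :=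
        Finset.sum_le_sum_of_subset_of_nonneg (Finset.range_mono hk) fun _ _ _ => hh _
      have h4 : 0 ≤ ∑ n ∈ Finset.range k, n * expCoeff x n :=
        Finset.sum_nonneg fun n _ => mul_nonneg (Nat.cast_nonneg n) (hh n)
      have h5 : (n0 : ℝ) * (∑ n ∈ Finset.range k, expCoeff x n
        - ∑ n ∈ Finset.range n0, expCoeff x n) ≤ 0 :=
        mul_nonpos_of_nonneg_of_nonpos (Nat.cast_nonneg _) (by linarith)
      linarith
    · rw [← Finset.sum_range_add_sum_Ico _ hk, ← Finset.sum_range_add_sum_Ico _ hk,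
        add_sub_cancel_left, Finset.mul_sum]
      have h4 : 0 ≤ ∑ n ∈ Finset.range n0, n * expCoeff x n :=
        Finset.sum_nonneg fun n _ => mul_nonneg (Nat.cast_nonneg n) (hh n)
      have h5 : ∑ n ∈ Finset.Ico n0 k, (n0 : ℝ) * expCoeff x n
          ≤ ∑ n ∈ Finset.Ico n0 k, n * expCoeff x n := by
        refine Finset.sum_le_sum fun n hn => ?_
        rw [Finset.mem_Ico] at hn
        exact mul_le_mul_of_nonneg_right (by exact_mod_cast hn.1) (hh n)
      linarith
  have h6 := h1 k
  have h7 : 0 ≤ ∑ n ∈ Finset.range k, expCoeff x n := Finset.sum_nonneg fun n _ => hh n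
  have h8 : 0 < (n0 : ℝ) := by linarith
  nlinarith

/-- Integration by parts for the distribution with weights `expCoeff`. -/
theorem hasSum_nat_mul_expCoeff {x : ℕ → ℝ} (hx : ∀ l, 0 ≤ x l) (hx0 : x 0 = 0) (hs : Summable x)
    {f : ℕ → ℝ} {B : ℝ} (hf : ∀ n, |f n| ≤ B) :
    HasSum (fun n : ℕ => n * f n * expCoeff x n) (∑' l, x l * ∑' m, expCoeff x m * f (l + m)) := by
  have hh := expCoeff_nonneg hx
  have hsum := summable_expCoeff hx hs
  set F : ℕ × ℕ → ℝ := fun p => x p.1 * (expCoeff x p.2 * f (p.1 + p.2)) with hF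
  have hFs : Summable F := by
    have h1 := (hs.mul_of_nonneg hsum hx hh).mul_right B
    refine Summable.of_norm_bounded h1 fun p => ?_
    rw [hF, Real.norm_eq_abs, abs_mul, abs_mul, abs_of_nonneg (hx _), abs_of_nonneg (hh _),
      ← mul_assoc]
    exact mul_le_mul_of_nonneg_left (hf _) (mul_nonneg (hx _) (hh _))
  have h2 : ∑' l, x l * ∑' m, expCoeff x m * f (l + m) = ∑' p, F p := by
    rw [hFs.tsum_prod]
    simp only [hF, tsum_mul_left]
  rw [h2]
  -- Grouping the pairs `(l, m)` by `n = l + m`, the recursion evaluates each diagonal as `n h_n f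
  -- n`.
  have h3 := (Finset.HasAntidiagonal.sigmaAntidiagonalEquivProd (A := ℕ)).hasSum_iff.2 hFs.hasSum
  have h4 := h3.sigma fun n => hasSum_fintype _
  convert h4 using 2 with n
  rw [show (n : ℝ) * f n * expCoeff x n = n * expCoeff x n * f n by ring,
    nat_mul_expCoeff_antidiagonal hx0, Finset.sum_mul, ← Finset.sum_coe_sort]
  refine Finset.sum_congr rfl fun p _ => ?_
  have := Finset.HasAntidiagonal.mem_antidiagonal.1 p.2
  simp [hF, Finset.HasAntidiagonal.sigmaAntidiagonalEquivProd, this, mul_assoc]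

/-! ### Comparison lemmas for the recursion -/

/-- A comparison principle. By `h1` the function `exp (-a (n - m₀))` is a supersolution of the
homogeneous recursion for `n > m₀`, and by `h2` the constant `D` is one of the recursion with source
`E`. For `n ≤ m₀` the exponential is at least one and dominates `f`. -/
theorem le_exp_add_of_recursion {y f : ℕ → ℝ} {P : ℕ → Prop} [DecidablePred P] {N : ℕ}
    {m₀ a D E : ℝ} (hy : ∀ l, 0 ≤ y l) (hD : 0 ≤ D) (hf0 : ∀ n : ℕ, (n : ℝ) ≤ m₀ → f n ≤ 1) (ha : 0 ≤ a)
    (hm : 0 ≤ m₀)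
    (hf : ∀ n ≤ N, m₀ < n → n * f n ≤ ∑ l ∈ (Finset.Icc 1 n).filter P, y l * f (n - l) + E)
    (h1 : ∀ n ≤ N, ∑ l ∈ (Finset.Icc 1 n).filter P, y l * Real.exp (a * l) ≤ m₀)
    (h2 : ∀ n ≤ N, (∑ l ∈ (Finset.Icc 1 n).filter P, y l) * D + E ≤ m₀ * D) :
    ∀ n ≤ N, f n ≤ Real.exp (-(a * (n - m₀))) + D := by
  intro n hn
  induction n using Nat.strong_induction_on with
  | _ n ih =>
  rcases le_or_gt (n : ℝ) m₀ with hnm | hnm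
  · have : (1 : ℝ) ≤ Real.exp (-(a * (n - m₀))) := by
      rw [Real.one_le_exp_iff]
      nlinarith
    linarith [hf0 n hnm]
  · have hn0 : (0 : ℝ) < n := hm.trans_lt hnm
    have h3 : ∑ l ∈ (Finset.Icc 1 n).filter P, y l * f (n - l)
        ≤ ∑ l ∈ (Finset.Icc 1 n).filter P,
          (y l * Real.exp (a * l) * Real.exp (-(a * (n - m₀))) + y l * D) := by
      refine Finset.sum_le_sum fun l hl => ?_
      rw [Finset.mem_filter, Finset.mem_Icc] at hl
      have h4 := ih (n - l) (by omega) (by omega)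
      rw [Nat.cast_sub hl.1.2] at h4
      rw [mul_assoc, ← Real.exp_add, ← mul_add]
      refine mul_le_mul_of_nonneg_left (h4.trans_eq ?_) (hy l)
      congr 2
      ring
    rw [Finset.sum_add_distrib, ← Finset.sum_mul, ← Finset.sum_mul] at h3
    have h5 := hf n hn hnm
    have h6 := mul_le_mul_of_nonneg_right (h1 n hn) (Real.exp_pos (-(a * (n - m₀)))).le
    have h7 := h2 n hn
    refine le_of_mul_le_mul_left (h5.trans ?_) hn0
    have h8 := mul_le_mul_of_nonneg_right hnm.le
      (add_nonneg (Real.exp_pos (-(a * (n - m₀)))).le hD)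
    nlinarith

/-- The mirror image: `D (1 - exp (-a (n - m₀)))` is a subsolution, and it is nonpositive for `n ≤
m₀`, so there only `0 ≤ f` is needed. -/
theorem ge_of_recursion {y f : ℕ → ℝ} {P : ℕ → Prop} [DecidablePred P] {N : ℕ}
    {m₀ a D E : ℝ} (hy : ∀ l, 0 ≤ y l) (hD : 0 ≤ D) (hf0 : ∀ n : ℕ, 0 ≤ f n) (ha : 0 ≤ a)
    (hm : 0 ≤ m₀)
    (hf : ∀ n ≤ N, m₀ < n → ∑ l ∈ (Finset.Icc 1 n).filter P, y l * f (n - l) + E ≤ n * f n)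
    (h1 : ∀ n ≤ N, ∑ l ∈ (Finset.Icc 1 n).filter P, y l * Real.exp (a * l) ≤ m₀)
    (h2 : ∀ n ≤ N, m₀ < n → N * D ≤ (∑ l ∈ (Finset.Icc 1 n).filter P, y l) * D + E) :
    ∀ n ≤ N, D * (1 - Real.exp (-(a * (n - m₀)))) ≤ f n := by
  intro n hn
  induction n using Nat.strong_induction_on with
  | _ n ih =>
  rcases le_or_gt (n : ℝ) m₀ with hnm | hnm
  · have : (1 : ℝ) ≤ Real.exp (-(a * (n - m₀))) := by
      rw [Real.one_le_exp_iff]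
      nlinarith
    exact (mul_nonpos_of_nonneg_of_nonpos hD (by linarith)).trans (hf0 n)
  · have hn0 : (0 : ℝ) < n := hm.trans_lt hnm
    have h3 : ∑ l ∈ (Finset.Icc 1 n).filter P,
          (y l * D - y l * Real.exp (a * l) * (Real.exp (-(a * (n - m₀))) * D))
        ≤ ∑ l ∈ (Finset.Icc 1 n).filter P, y l * f (n - l) := by
      refine Finset.sum_le_sum fun l hl => ?_
      rw [Finset.mem_filter, Finset.mem_Icc] at hl
      have h4 := ih (n - l) (by omega) (by omega)
      rw [Nat.cast_sub hl.1.2] at h4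
      have h9 : Real.exp (-(a * ((n : ℝ) - l - m₀)))
          = Real.exp (a * l) * Real.exp (-(a * (n - m₀))) := by
        rw [← Real.exp_add]; congr 1; ring
      rw [h9] at h4
      refine le_trans (le_of_eq ?_) (mul_le_mul_of_nonneg_left h4 (hy l))
      ring
    rw [Finset.sum_sub_distrib, ← Finset.sum_mul, ← Finset.sum_mul] at h3
    have h5 := hf n hn hnm
    have h6 := mul_le_mul_of_nonneg_right ((h1 n hn).trans hnm.le)
      (mul_nonneg (Real.exp_pos (-(a * (n - m₀)))).le hD)
    have h7 := h2 n hn hnm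
    have h8 : (n : ℝ) * D ≤ N * D := mul_le_mul_of_nonneg_right (by exact_mod_cast hn) hD
    refine le_of_mul_le_mul_left (le_trans ?_ h5) hn0
    nlinarith

/-! ### Heavy-tailed weights -/

/-- The weights `α_l + N β_l`, where `β` is summable with `β_l ~ c l^{-s}` and `α_l = O(l^{-s})`. -/
structure HeavyTail (α β : ℕ → ℝ) (s c μ : ℝ) : Prop where
  alpha_nonneg : ∀ l, 0 ≤ α l
  beta_nonneg : ∀ l, 0 ≤ β l
  alpha_zero : α 0 = 0
  beta_zero : β 0 = 0
  one_lt : 1 < s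
  c_pos : 0 < c
  tendsto : Tendsto (fun l : ℕ => β l * (l : ℝ) ^ s) atTop (𝓝 c)
  bdd : ∃ C, ∀ l : ℕ, α l * (l : ℝ) ^ s ≤ C
  hasSum : HasSum β μ
  mu_lt : μ < 1

/-- The weights `α_l + N β_l`. -/
def affineWeight (α β : ℕ → ℝ) (N l : ℕ) : ℝ := α l + N * β l

/-- The probability distribution proportional to `expCoeff`. -/
noncomputable def massFn (α β : ℕ → ℝ) (N n : ℕ) : ℝ :=
  expCoeff (affineWeight α β N) n / ∑' k, expCoeff (affineWeight α β N) k

namespace HeavyTail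

variable {α β : ℕ → ℝ} {s c μ : ℝ}

theorem exists_le_rpow (h : HeavyTail α β s c μ) :
    ∃ C, 0 < C ∧ ∀ l : ℕ, α l ≤ C * (l : ℝ) ^ (-s) ∧ β l ≤ C * (l : ℝ) ^ (-s) := by
  obtain ⟨C₁, hC₁⟩ := h.bdd
  obtain ⟨C₂, hC₂⟩ := h.tendsto.bddAbove_range
  refine ⟨max 1 (max C₁ C₂), lt_max_of_lt_left one_pos, fun l => ?_⟩
  rcases Nat.eq_zero_or_pos l with rfl | hl
  · rw [h.alpha_zero, h.beta_zero]
    have : (0 : ℝ) ≤ max 1 (max C₁ C₂) * ((0 : ℕ) : ℝ) ^ (-s) := by positivity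
    exact ⟨this, this⟩
  · have hl' : (0 : ℝ) < l := by exact_mod_cast hl
    have hp : 0 < (l : ℝ) ^ s := Real.rpow_pos_of_pos hl' s
    rw [Real.rpow_neg hl'.le, ← div_eq_mul_inv, le_div_iff₀ hp, le_div_iff₀ hp]
    exact ⟨(hC₁ l).trans (le_max_of_le_right (le_max_left _ _)),
      (hC₂ ⟨l, rfl⟩).trans (le_max_of_le_right (le_max_right _ _))⟩

theorem summable_alpha (h : HeavyTail α β s c μ) : Summable α := by
  obtain ⟨C, _, hC⟩ := h.exists_le_rpow
  refine Summable.of_nonneg_of_le h.alpha_nonneg (fun l => (hC l).1) ?_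
  exact (Real.summable_nat_rpow.2 (by linarith [h.one_lt])).mul_left C

theorem mu_pos (h : HeavyTail α β s c μ) : 0 < μ := by
  have h1 : ∀ᶠ l : ℕ in atTop, 0 < β l * (l : ℝ) ^ s := h.tendsto.eventually (lt_mem_nhds h.c_pos)
  obtain ⟨l, hl⟩ := h1.exists
  have h2 : 0 < β l := pos_of_mul_pos_left hl (by positivity)
  rw [← h.hasSum.tsum_eq]
  exact h.hasSum.summable.tsum_pos h.beta_nonneg l h2

theorem weight_nonneg (h : HeavyTail α β s c μ) (N l : ℕ) : 0 ≤ affineWeight α β N l :=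
  add_nonneg (h.alpha_nonneg l) (mul_nonneg (Nat.cast_nonneg N) (h.beta_nonneg l))

theorem weight_zero (h : HeavyTail α β s c μ) (N : ℕ) : affineWeight α β N 0 = 0 := by
  simp [affineWeight, h.alpha_zero, h.beta_zero]

theorem summable_weight (h : HeavyTail α β s c μ) (N : ℕ) : Summable (affineWeight α β N) :=
  h.summable_alpha.add (h.hasSum.summable.mul_left _)

theorem tsum_expCoeff_pos (h : HeavyTail α β s c μ) (N : ℕ) :
    0 < ∑' k, expCoeff (affineWeight α β N) k :=
  (summable_expCoeff (h.weight_nonneg N) (h.summable_weight N)).tsum_pos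
    (expCoeff_nonneg (h.weight_nonneg N)) 0 (by simp [expCoeff])

theorem massFn_nonneg (h : HeavyTail α β s c μ) (N n : ℕ) : 0 ≤ massFn α β N n :=
  div_nonneg (expCoeff_nonneg (h.weight_nonneg N) n) (h.tsum_expCoeff_pos N).le

theorem hasSum_massFn (h : HeavyTail α β s c μ) (N : ℕ) : HasSum (massFn α β N) 1 := by
  have := (summable_expCoeff (h.weight_nonneg N) (h.summable_weight N)).hasSum.div_const
    (∑' k, expCoeff (affineWeight α β N) k)
  rwa [div_self (h.tsum_expCoeff_pos N).ne'] at this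

theorem massFn_le_one (h : HeavyTail α β s c μ) (N n : ℕ) : massFn α β N n ≤ 1 :=
  le_hasSum (h.hasSum_massFn N) n fun _ _ => h.massFn_nonneg N _

theorem nat_mul_massFn (N n : ℕ) :
    n * massFn α β N n
      = ∑ l ∈ Finset.Icc 1 n, affineWeight α β N l * massFn α β N (n - l) := by
  simp only [massFn, ← mul_div_assoc]
  rw [← Finset.sum_div, nat_mul_expCoeff]

theorem hasSum_nat_mul_massFn (h : HeavyTail α β s c μ) (N : ℕ) {f : ℕ → ℝ} {B : ℝ}
    (hf : ∀ n, |f n| ≤ B) :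
    HasSum (fun n : ℕ => n * f n * massFn α β N n)
      (∑' l, affineWeight α β N l * ∑' m, massFn α β N m * f (l + m)) := by
  have := (hasSum_nat_mul_expCoeff (h.weight_nonneg N) (h.weight_zero N) (h.summable_weight N)
    hf).div_const (∑' k, expCoeff (affineWeight α β N) k)
  simp only [mul_div_assoc] at this
  refine Eq.subst (motive := fun t => HasSum (fun n : ℕ => n * f n * massFn α β N n) t) ?_ this
  rw [← tsum_div_const]
  refine tsum_congr fun l => ?_
  rw [mul_div_assoc, ← tsum_div_const]
  congr 1
  refine tsum_congr fun m => ?_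
  rw [massFn]; ring

theorem summable_massFn_mul (h : HeavyTail α β s c μ) (N : ℕ) {f : ℕ → ℝ} {B : ℝ}
    (hf : ∀ n, |f n| ≤ B) : Summable fun n => massFn α β N n * f n := by
  refine Summable.of_norm_bounded ((h.hasSum_massFn N).summable.mul_right B) fun n => ?_
  rw [Real.norm_eq_abs, abs_mul, abs_of_nonneg (h.massFn_nonneg N n)]
  exact mul_le_mul_of_nonneg_left (hf n) (h.massFn_nonneg N n)

/-- The mass outside of a neighbourhood of `μ N`. -/
noncomputable def farMass (α β : ℕ → ℝ) (μ ε : ℝ) (N : ℕ) : ℝ :=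
  ∑' n : ℕ, if ε * N < |(n : ℝ) - μ * N| then massFn α β N n else 0

/-- For `s ≤ 2` the sequence `β` has no first moment. Capping `l / N` at `2`, the oscillation of a
test function with values in `[-1, 1]`, allows dominated convergence. -/
theorem tendsto_tsum_min (h : HeavyTail α β s c μ) :
    Tendsto (fun N : ℕ => ∑' l : ℕ, β l * min 2 ((l : ℝ) / N)) atTop (𝓝 0) := by
  have := tendsto_tsum_of_dominated_convergence (𝓕 := atTop)
    (f := fun (N l : ℕ) => β l * min 2 ((l : ℝ) / N)) (g := fun _ => 0)
    (bound := fun l => β l * 2) (h.hasSum.summable.mul_right 2) ?_ ?_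
  · simpa using this
  · intro l
    have h1 : Tendsto (fun N : ℕ => (l : ℝ) / N) atTop (𝓝 0) := tendsto_const_div_atTop_nhds_zero_nat _
    have h2 := (tendsto_const_nhds (x := (2 : ℝ))).min h1
    simpa using h2.const_mul (β l)
  · refine Eventually.of_forall fun N l => ?_
    have h0 : 0 ≤ min 2 ((l : ℝ) / N) := le_min two_pos.le (by positivity)
    rw [Real.norm_eq_abs, abs_mul, abs_of_nonneg (h.beta_nonneg l), abs_of_nonneg h0]
    exact mul_le_mul_of_nonneg_left (min_le_left _ _) (h.beta_nonneg l)

theorem farMass_nonneg (h : HeavyTail α β s c μ) (ε : ℝ) (N : ℕ) : 0 ≤ farMass α β μ ε N :=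
  tsum_nonneg fun n => by
    split_ifs
    · exact h.massFn_nonneg N n
    · exact le_rfl

theorem summable_farMass (h : HeavyTail α β s c μ) (ε : ℝ) (N : ℕ) :
    Summable fun n : ℕ => if ε * N < |(n : ℝ) - μ * N| then massFn α β N n else 0 := by
  refine Summable.of_nonneg_of_le (fun n => ?_) (fun n => ?_) (h.hasSum_massFn N).summable
  all_goals split_ifs
  exacts [h.massFn_nonneg N n, le_rfl, le_rfl, h.massFn_nonneg N n]

/-- A Chebyshev argument with a truncated test function `ψ` in place of `n / N - μ`, since a
variance need not exist. Integration by parts expresses `E[(n / N) ψ]` through the shifts of `ψ`. A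
shift by `l` raises `ψ` by at most `min 2 (l / N)`, hence `E[(n / N - μ) ψ]` has an upper bound
tending to zero. -/
theorem tendsto_farMass (h : HeavyTail α β s c μ) {ε : ℝ} (hε : 0 < ε) :
    Tendsto (farMass α β μ ε) atTop (𝓝 0) := by
  -- Because `ψ` saturates at `±1`, the bound `(n / N - μ) ψ ≥ e²` on the far set requires `e ≤ 1`.
  set e := min ε 1 with he
  have he0 : 0 < e := lt_min hε one_pos
  set A := ∑' l, α l with hA
  have hlim : Tendsto (fun N : ℕ => (e ^ 2)⁻¹ * (∑' l : ℕ, β l * min 2 ((l : ℝ) / N) + A / N)) atTop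
      (𝓝 0) := by
    simpa using (h.tendsto_tsum_min.add (tendsto_const_div_atTop_nhds_zero_nat A)).const_mul _
  refine squeeze_zero' (Eventually.of_forall fun N => h.farMass_nonneg ε N) ?_ hlim
  filter_upwards [eventually_gt_atTop 0] with N hN
  have hN' : (0 : ℝ) < N := by exact_mod_cast hN
  set ψ : ℕ → ℝ := fun n => max (-1) (min 1 ((n : ℝ) / N - μ)) with hψ
  have hψ1 : ∀ n, |ψ n| ≤ 1 := fun n => by
    rw [abs_le]
    exact ⟨le_max_left _ _, max_le (by norm_num) (min_le_left _ _)⟩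
  set u := massFn α β N with hu
  set a : ℕ → ℝ := fun l => ∑' m, u m * ψ (l + m) with ha
  have hsm : ∀ l, Summable fun m => u m * ψ (l + m) := fun l =>
    h.summable_massFn_mul N fun n => hψ1 _
  have ha1 : ∀ l, |a l| ≤ 1 := by
    intro l
    have h1 := (hsm l).norm
    refine (norm_tsum_le_tsum_norm h1).trans ?_
    rw [← (h.hasSum_massFn N).tsum_eq]
    refine h1.tsum_le_tsum (fun m => ?_) (h.hasSum_massFn N).summable
    rw [Real.norm_eq_abs, abs_mul, abs_of_nonneg (h.massFn_nonneg N m)]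
    exact mul_le_of_le_one_right (h.massFn_nonneg N m) (hψ1 _)
  have had : ∀ l, a l - a 0 ≤ min 2 ((l : ℝ) / N) := by
    intro l
    rw [ha]
    simp only
    rw [← (hsm l).tsum_sub (hsm 0)]
    have h1 : ∀ m, u m * ψ (l + m) - u m * ψ (0 + m) ≤ u m * min 2 ((l : ℝ) / N) := by
      intro m
      rw [← mul_sub]
      refine mul_le_mul_of_nonneg_left (le_min ?_ ?_) (h.massFn_nonneg N m)
      · linarith [(abs_le.1 (hψ1 (l + m))).2, (abs_le.1 (hψ1 (0 + m))).1]
      · have hl0 : 0 ≤ (l : ℝ) / N := by positivity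
        rw [sub_le_iff_le_add]
        simp only [hψ]
        refine max_le ?_ ?_
        · linarith [le_max_left (-1) (min 1 (((0 + m : ℕ) : ℝ) / N - μ))]
        · refine le_trans ?_ (add_le_add_right (le_max_right _ _) _)
          rw [← min_add_add_left]
          refine le_min ((min_le_left _ _).trans (by linarith)) ((min_le_right _ _).trans ?_)
          push_cast
          apply le_of_eq
          ring
    refine (((hsm l).sub (hsm 0)).tsum_le_tsum h1
      ((h.hasSum_massFn N).summable.mul_right _)).trans ?_
    rw [tsum_mul_right, (h.hasSum_massFn N).tsum_eq, one_mul]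
  have hS := (h.hasSum_nat_mul_massFn N hψ1).div_const (N : ℝ)
  have hS0 : HasSum (fun m => u m * ψ m) (a 0) := by
    simpa [ha] using (hsm 0).hasSum
  have hS2 := hS.sub (hS0.mul_left μ)
  -- The `α` part is bounded by its total mass `A`, negligible after division by `N`. The `β` part
  -- gives `μ a 0`, which cancels later, plus the capped first moment.
  have hle : ∑' l, affineWeight α β N l * a l ≤ A + N * (μ * a 0 + ∑' l : ℕ, β l * min 2 ((l : ℝ) / N)) := by
    have hsmin : Summable fun l : ℕ => β l * min 2 ((l : ℝ) / N) := by
      refine Summable.of_nonneg_of_le (fun l => mul_nonneg (h.beta_nonneg l)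
        (le_min two_pos.le (by positivity)))
        (fun l => mul_le_mul_of_nonneg_left (min_le_left _ _) (h.beta_nonneg l))
        (h.hasSum.summable.mul_right 2)
    have h2 : HasSum (fun l => α l + N * (β l * a 0 + β l * min 2 ((l : ℝ) / N)))
        (A + N * (μ * a 0 + ∑' l : ℕ, β l * min 2 ((l : ℝ) / N))) :=
      h.summable_alpha.hasSum.add (((h.hasSum.mul_right (a 0)).add hsmin.hasSum).mul_left _)
    rw [← h2.tsum_eq]
    refine Summable.tsum_le_tsum (fun l => ?_) ?_ h2.summable
    · rw [affineWeight, add_mul, mul_assoc]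
      refine add_le_add ?_ (mul_le_mul_of_nonneg_left ?_ hN'.le)
      · exact mul_le_of_le_one_right (h.alpha_nonneg l) (abs_le.1 (ha1 l)).2
      · rw [← mul_add]
        exact mul_le_mul_of_nonneg_left (by linarith [had l]) (h.beta_nonneg l)
    · refine Summable.of_norm_bounded (h.summable_weight N) fun l => ?_
      rw [Real.norm_eq_abs, abs_mul, abs_of_nonneg (h.weight_nonneg N l)]
      exact mul_le_of_le_one_right (h.weight_nonneg N l) (ha1 l)
  have hfar : e ^ 2 * farMass α β μ ε N ≤ (∑' l, affineWeight α β N l * a l) / N - μ * a 0 := by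
    rw [farMass, ← tsum_mul_left, ← hS2.tsum_eq]
    refine Summable.tsum_le_tsum (fun n => ?_) ((h.summable_farMass ε N).mul_left _) hS2.summable
    have hd : (n : ℝ) * ψ n * u n / N - μ * (u n * ψ n) = ((n : ℝ) / N - μ) * ψ n * u n := by ring
    rw [hd]
    have hun : 0 ≤ u n := h.massFn_nonneg N n
    set d : ℝ := (n : ℝ) / N - μ with hd'
    have hψd : ψ n = max (-1) (min 1 d) := rfl
    have hiff : ε * N < |(n : ℝ) - μ * N| ↔ ε < |d| := by
      have : |(n : ℝ) - μ * N| = |d| * N := by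
        rw [← abs_of_pos hN', ← abs_mul, abs_of_pos hN', hd', sub_mul, div_mul_cancel₀ _ hN'.ne']
      rw [this]
      exact mul_lt_mul_iff_left₀ hN'
    have key : e ^ 2 * (if ε < |d| then 1 else 0) ≤ d * ψ n := by
      have he1 : e ≤ 1 := min_le_right _ _
      have he2 : e ≤ ε := min_le_left _ _
      rw [hψd]
      rcases le_total d (-1) with h1 | h1
      · rw [min_eq_right (by linarith), max_eq_left h1]
        split_ifs <;> nlinarith
      · rcases le_total d 1 with h2 | h2
        · rw [min_eq_right h2, max_eq_right h1]
          split_ifs with h3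
          · rw [mul_one, ← pow_two, ← sq_abs d]
            exact pow_le_pow_left₀ he0.le (by linarith) 2
          · nlinarith
        · rw [min_eq_left h2, max_eq_right (by norm_num)]
          split_ifs <;> nlinarith
    have := mul_le_mul_of_nonneg_right key hun
    refine le_trans (le_of_eq ?_) this
    simp only [hiff]
    split_ifs <;> simp [hu]
  rw [inv_mul_eq_div, le_div_iff₀ (by positivity), mul_comm]
  refine hfar.trans ?_
  rw [sub_le_iff_le_add, div_le_iff₀ hN']
  refine hle.trans (le_of_eq ?_)
  field_simp
  ring

end HeavyTail

/-! ### Local asymptotics -/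

theorem sum_Icc_sub_eq (g : ℕ → ℝ) (n : ℕ) :
    ∑ l ∈ Finset.Icc 1 n, g (n - l) = ∑ m ∈ Finset.range n, g m := by
  refine Finset.sum_bij' (fun l _ => n - l) (fun m _ => n - m) ?_ ?_ ?_ ?_ ?_
  all_goals
    intro l hl
    simp only [Finset.mem_Icc, Finset.mem_range] at hl ⊢
    try omega

theorem sum_filter_sub_le_tsum {g : ℕ → ℝ} (hg : ∀ m, 0 ≤ g m) (hs : Summable g) (n : ℕ)
    (P : ℕ → Prop) [DecidablePred P] :
    ∑ l ∈ (Finset.Icc 1 n).filter P, g (n - l) ≤ ∑' m, g m := by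
  refine (Finset.sum_le_sum_of_subset_of_nonneg (Finset.filter_subset _ _)
    fun _ _ _ => hg _).trans ?_
  rw [sum_Icc_sub_eq]
  exact hs.sum_le_tsum _ fun _ _ => hg _

namespace HeavyTail

variable {α β : ℕ → ℝ} {s c μ : ℝ}

/-- From `log (N / l) ≤ N / l - 1` one gets `(l / N) log N ≤ δ log l + 1`. An exponential tilt at
rate `A log N / N` thus costs only a small power of `l` on lengths up to `δ N`. -/
theorem exp_log_div_le {A δ : ℝ} (hA : 0 ≤ A) {N l : ℕ} (hl : 1 ≤ l) (hN : 1 ≤ N)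
    (hlN : (l : ℝ) ≤ δ * N) :
    Real.exp (A * Real.log N / N * l) ≤ Real.exp A * (l : ℝ) ^ (A * δ) := by
  have hl' : (0 : ℝ) < l := by exact_mod_cast hl
  have hN' : (0 : ℝ) < N := by exact_mod_cast hN
  rw [Real.rpow_def_of_pos hl', ← Real.exp_add, Real.exp_le_exp]
  have h1 : Real.log ((N : ℝ) / l) ≤ N / l - 1 := Real.log_le_sub_one_of_pos (by positivity)
  rw [Real.log_div hN'.ne' hl'.ne'] at h1
  have h2 : (l : ℝ) / N ≤ δ := by rwa [div_le_iff₀ hN']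
  have h3 : 0 ≤ Real.log l := Real.log_nonneg (by exact_mod_cast hl)
  have h4 : (l : ℝ) / N * Real.log l ≤ δ * Real.log l := mul_le_mul_of_nonneg_right h2 h3
  have h5 : (l : ℝ) / N * (Real.log N - Real.log l) ≤ l / N * (N / l - 1) :=
    mul_le_mul_of_nonneg_left h1 (by positivity)
  have h6 : (l : ℝ) / N * (N / l - 1) ≤ 1 := by
    have : (l : ℝ) / N * (N / l) = 1 := by field_simp
    have : 0 ≤ (l : ℝ) / N := by positivity
    linarith
  have h7 : (l : ℝ) / N * Real.log N ≤ δ * Real.log l + 1 := by linarith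
  have h8 := mul_le_mul_of_nonneg_left h7 hA
  have h9 : A * Real.log N / N * l = A * (l / N * Real.log N) := by ring
  rw [h9]
  linarith

/-- The tilt tends to one for fixed `l`, and for small `δ` the tilted weights, divided by `N`, have
a summable majorant. Dominated convergence returns the untilted total `μ`. -/
theorem eventually_sum_weight_mul_exp_le (h : HeavyTail α β s c μ) {A ε : ℝ} (hA : 0 < A)
    (hε : 0 < ε) : ∃ δ₀ > 0, ∀ δ > 0, δ ≤ δ₀ → ∀ᶠ N : ℕ in atTop, ∀ n : ℕ,
      ∑ l ∈ (Finset.Icc 1 n).filter (fun l : ℕ => (l : ℝ) ≤ δ * N),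
        affineWeight α β N l * Real.exp (A * Real.log N / N * l) ≤ (μ + ε) * N := by
  obtain ⟨C, hC0, hC⟩ := h.exists_le_rpow
  have hs := h.one_lt
  -- With this `δ₀`, `A δ ≤ (s - 1) / 2`, so the majorant `l^{-s + (s - 1)/2}` still has exponent
  -- below `-1`.
  refine ⟨(s - 1) / (2 * A), by have := sub_pos.2 hs; positivity, fun δ hδ0 hδ => ?_⟩
  have hAδ : A * δ ≤ (s - 1) / 2 := by
    calc A * δ ≤ A * ((s - 1) / (2 * A)) := mul_le_mul_of_nonneg_left hδ hA.le
      _ = (s - 1) / 2 := by field_simp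
  set F : ℕ → ℕ → ℝ := fun N l => if (l : ℝ) ≤ δ * N then
    (β l + α l / N) * Real.exp (A * Real.log N / N * l) else 0 with hF
  set g : ℕ → ℝ := fun l => 2 * C * Real.exp A * (l : ℝ) ^ (-s + (s - 1) / 2) with hg
  have hgs : Summable g := (Real.summable_nat_rpow.2 (by linarith)).mul_left _
  have hlogN : Tendsto (fun N : ℕ => Real.log N / N) atTop (𝓝 0) := by
    have h1 := (Real.isLittleO_log_id_atTop.tendsto_div_nhds_zero).comp tendsto_natCast_atTop_atTop
    exact h1
  have hF0 : ∀ N l, 0 ≤ F N l := by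
    intro N l
    simp only [hF]
    split_ifs
    · exact mul_nonneg (add_nonneg (h.beta_nonneg l)
        (div_nonneg (h.alpha_nonneg l) (Nat.cast_nonneg N))) (Real.exp_pos _).le
    · exact le_rfl
  have hFle : ∀ᶠ N : ℕ in atTop, ∀ l, ‖F N l‖ ≤ g l := by
    filter_upwards [eventually_ge_atTop 1] with N hN l
    have hN' : (1 : ℝ) ≤ N := by exact_mod_cast hN
    rw [Real.norm_eq_abs, abs_of_nonneg (hF0 N l)]
    simp only [hF, hg]
    split_ifs with hl
    · rcases Nat.eq_zero_or_pos l with rfl | hl0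
      · rw [h.beta_zero, h.alpha_zero]
        simp only [zero_div, add_zero, zero_mul]
        positivity
      · have hl' : (1 : ℝ) ≤ l := by exact_mod_cast hl0
        have hl'' : (0 : ℝ) < l := by linarith
        have h1 : β l + α l / N ≤ 2 * C * (l : ℝ) ^ (-s) := by
          have h2 : α l / N ≤ α l := div_le_self (h.alpha_nonneg l) hN'
          linarith [(hC l).1, (hC l).2]
        have h3 := exp_log_div_le hA.le hl0 hN hl
        have h4 : (l : ℝ) ^ (A * δ) ≤ (l : ℝ) ^ ((s - 1) / 2) :=
          Real.rpow_le_rpow_of_exponent_le hl' hAδ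
        calc (β l + α l / N) * Real.exp (A * Real.log N / N * l)
            ≤ (2 * C * (l : ℝ) ^ (-s)) * (Real.exp A * (l : ℝ) ^ ((s - 1) / 2)) :=
              mul_le_mul h1 (h3.trans (mul_le_mul_of_nonneg_left h4 (Real.exp_pos _).le))
                (Real.exp_pos _).le (by positivity)
          _ = 2 * C * Real.exp A * (l : ℝ) ^ (-s + (s - 1) / 2) := by
              rw [Real.rpow_add hl'']; ring
    · positivity
  have hlim : Tendsto (fun N => ∑' l, F N l) atTop (𝓝 (∑' l, β l)) := by
    refine tendsto_tsum_of_dominated_convergence hgs (fun l => ?_) hFle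
    have h1 : Tendsto (fun N : ℕ => (β l + α l / N) * Real.exp (A * Real.log N / N * l)) atTop
        (𝓝 (β l)) := by
      have h2 := (tendsto_const_nhds (x := β l)).add (tendsto_const_div_atTop_nhds_zero_nat (α l))
      have h3 := ((hlogN.const_mul A).mul_const (l : ℝ)).rexp
      have h4 := h2.mul h3
      simpa [mul_div_assoc] using h4
    refine h1.congr' ?_
    have h5 : ∀ᶠ N : ℕ in atTop, (l : ℝ) ≤ δ * N :=
      (tendsto_natCast_atTop_atTop.const_mul_atTop hδ0).eventually_ge_atTop _
    filter_upwards [h5] with N hN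
    simp only [hF, if_pos hN]
  rw [h.hasSum.tsum_eq] at hlim
  filter_upwards [hlim.eventually (ge_mem_nhds (show μ < μ + ε by linarith)), hFle,
    eventually_ge_atTop 1] with N h1 h2 hN n
  have hN' : (0 : ℝ) < N := by exact_mod_cast hN
  have hFs : Summable (F N) := Summable.of_norm_bounded hgs h2
  refine le_trans ?_ (mul_le_mul_of_nonneg_right h1 hN'.le)
  rw [← tsum_mul_right]
  refine le_trans (Finset.sum_le_sum fun l hl => ?_)
    ((hFs.mul_right (N : ℝ)).sum_le_tsum _ fun l _ => mul_nonneg (hF0 N l) hN'.le)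
  rw [Finset.mem_filter] at hl
  simp only [hF, if_pos hl.2, affineWeight]
  apply le_of_eq
  field_simp
  ring

theorem eventually_le_sum_weight (h : HeavyTail α β s c μ) {ε δ : ℝ} (hε : 0 < ε) (hδ : 0 < δ) :
    ∀ᶠ N : ℕ in atTop, ∀ n : ℕ, δ * N ≤ n → (μ - ε) * N ≤
      ∑ l ∈ (Finset.Icc 1 n).filter (fun l : ℕ => (l : ℝ) ≤ δ * N), affineWeight α β N l := by
  have h1 := h.hasSum.tendsto_sum_nat.eventually (lt_mem_nhds (show μ - ε < μ by linarith))
  obtain ⟨K, hK⟩ := h1.exists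
  have h5 : ∀ᶠ N : ℕ in atTop, (K : ℝ) ≤ δ * N :=
    (tendsto_natCast_atTop_atTop.const_mul_atTop hδ).eventually_ge_atTop _
  filter_upwards [h5] with N hN n hn
  have h6 : (μ - ε) * N ≤ ∑ l ∈ Finset.range K, affineWeight α β N l := by
    refine (mul_le_mul_of_nonneg_right hK.le (Nat.cast_nonneg N)).trans ?_
    rw [Finset.sum_mul]
    refine Finset.sum_le_sum fun l _ => ?_
    rw [affineWeight]
    linarith [h.alpha_nonneg l]
  refine h6.trans ?_
  rw [← Finset.sum_filter_ne_zero]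
  refine Finset.sum_le_sum_of_subset_of_nonneg (fun l hl => ?_) fun l _ _ => h.weight_nonneg N l
  rw [Finset.mem_filter, Finset.mem_range] at hl
  have hl0 : l ≠ 0 := by
    rintro rfl
    exact hl.2 (h.weight_zero N)
  have hlK : (l : ℝ) ≤ K := by exact_mod_cast hl.1.le
  rw [Finset.mem_filter, Finset.mem_Icc]
  refine ⟨⟨Nat.one_le_iff_ne_zero.2 hl0, ?_⟩, hlK.trans hN⟩
  exact_mod_cast (hlK.trans hN).trans hn

/-! ### Size of the weights at lengths of order `N` -/

theorem weight_le_of_mul_le (h : HeavyTail α β s c μ) {C : ℝ} (hC0 : 0 < C)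
    (hC : ∀ l : ℕ, α l ≤ C * (l : ℝ) ^ (-s) ∧ β l ≤ C * (l : ℝ) ^ (-s)) {δ : ℝ} (hδ : 0 < δ)
    {N l : ℕ} (hN : 1 ≤ N) (hl : δ * N ≤ l) :
    affineWeight α β N l ≤ N * (N : ℝ) ^ (-s) * (2 * C * δ ^ (-s)) := by
  have hN' : (1 : ℝ) ≤ N := by exact_mod_cast hN
  have hN0 : (0 : ℝ) < N := by linarith
  have h1 : (l : ℝ) ^ (-s) ≤ (δ * N) ^ (-s) :=
    Real.rpow_le_rpow_of_nonpos (by positivity) hl (by linarith [h.one_lt])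
  rw [Real.mul_rpow hδ.le hN0.le] at h1
  have h2 := mul_le_mul_of_nonneg_left h1 hC0.le
  have h3 := mul_le_mul_of_nonneg_left ((hC l).2.trans h2) hN0.le
  have h4 : α l ≤ N * (C * (δ ^ (-s) * (N : ℝ) ^ (-s))) := by
    refine ((hC l).1.trans h2).trans ?_
    exact le_mul_of_one_le_left (by positivity) hN'
  rw [affineWeight]
  nlinarith

theorem eventually_beta_le (h : HeavyTail α β s c μ) {ε : ℝ} (hε : 0 < ε) :
    ∀ᶠ l : ℕ in atTop, β l ≤ (c + ε) * (l : ℝ) ^ (-s) ∧ (c - ε) * (l : ℝ) ^ (-s) ≤ β l := by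
  filter_upwards [h.tendsto.eventually (ge_mem_nhds (show c < c + ε by linarith)),
    h.tendsto.eventually (le_mem_nhds (show c - ε < c by linarith)), eventually_gt_atTop 0]
    with l h1 h2 hl
  have hl' : (0 : ℝ) < l := by exact_mod_cast hl
  have hp : 0 < (l : ℝ) ^ s := Real.rpow_pos_of_pos hl' s
  rw [Real.rpow_neg hl'.le, ← div_eq_mul_inv, ← div_eq_mul_inv, le_div_iff₀ hp, div_le_iff₀ hp]
  exact ⟨h1, h2⟩

/-- Unlike the preceding crude bound this one has nearly the sharp constant `c`. One `ε` pays for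
`β_l ~ c l^{-s}`, the other for `α_l`, which lacks the factor `N`. -/
theorem eventually_weight_le (h : HeavyTail α β s c μ) {ε δ : ℝ} (hε : 0 < ε) (hδ : 0 < δ) :
    ∀ᶠ N : ℕ in atTop, ∀ l : ℕ, δ * N ≤ l →
      affineWeight α β N l ≤ N * (N : ℝ) ^ (-s) * ((c + 2 * ε) * δ ^ (-s)) := by
  obtain ⟨C, hC0, hC⟩ := h.exists_le_rpow
  obtain ⟨L, hL⟩ := eventually_atTop.1 (h.eventually_beta_le hε)
  have h5 : ∀ᶠ N : ℕ in atTop, (L : ℝ) ≤ δ * N :=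
    (tendsto_natCast_atTop_atTop.const_mul_atTop hδ).eventually_ge_atTop _
  have h6 : ∀ᶠ N : ℕ in atTop, C ≤ ε * N :=
    (tendsto_natCast_atTop_atTop.const_mul_atTop hε).eventually_ge_atTop _
  filter_upwards [h5, h6, eventually_ge_atTop 1] with N h5 h6 hN l hl
  have hN0 : (0 : ℝ) < N := by exact_mod_cast hN
  have h1 : (l : ℝ) ^ (-s) ≤ (δ * N) ^ (-s) :=
    Real.rpow_le_rpow_of_nonpos (by positivity) hl (by linarith [h.one_lt])
  rw [Real.mul_rpow hδ.le hN0.le] at h1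
  have hb := (hL l (by exact_mod_cast h5.trans hl)).1
  have hpos : 0 ≤ (l : ℝ) ^ (-s) := by positivity
  have h7 : affineWeight α β N l ≤ N * (c + 2 * ε) * (l : ℝ) ^ (-s) := by
    rw [affineWeight]
    have h8 := mul_le_mul_of_nonneg_left hb hN0.le
    have h9 := mul_le_mul_of_nonneg_right h6 hpos
    nlinarith [(hC l).1]
  have hc := h.c_pos
  refine (h7.trans (mul_le_mul_of_nonneg_left h1 (by positivity))).trans (le_of_eq ?_)
  ring

theorem eventually_le_weight (h : HeavyTail α β s c μ) {ε δ δ' : ℝ} (hε : 0 < ε) (hεc : ε < c)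
    (hδ : 0 < δ) (hδ' : 0 < δ') :
    ∀ᶠ N : ℕ in atTop, ∀ l : ℕ, δ * N ≤ l → l ≤ δ' * N →
      N * (N : ℝ) ^ (-s) * ((c - ε) * δ' ^ (-s)) ≤ affineWeight α β N l := by
  obtain ⟨L, hL⟩ := eventually_atTop.1 (h.eventually_beta_le hε)
  have h5 : ∀ᶠ N : ℕ in atTop, (L : ℝ) ≤ δ * N :=
    (tendsto_natCast_atTop_atTop.const_mul_atTop hδ).eventually_ge_atTop _
  filter_upwards [h5, eventually_ge_atTop 1] with N h5 hN l hl hl'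
  have hN0 : (0 : ℝ) < N := by exact_mod_cast hN
  have hl0 : (0 : ℝ) < l := lt_of_lt_of_le (by positivity) hl
  have h1 : (δ' * N) ^ (-s) ≤ (l : ℝ) ^ (-s) :=
    Real.rpow_le_rpow_of_nonpos hl0 hl' (by linarith [h.one_lt])
  rw [Real.mul_rpow hδ'.le hN0.le] at h1
  have hb := (hL l (by exact_mod_cast h5.trans hl)).2
  have h8 := mul_le_mul_of_nonneg_left ((mul_le_mul_of_nonneg_left h1
    (sub_pos.2 hεc).le).trans hb) hN0.le
  rw [affineWeight]
  refine le_trans (le_of_eq ?_) (h8.trans (le_add_of_nonneg_left (h.alpha_nonneg l)))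
  ring

/-- The point `N - k` lies at least `ε N / 2` beyond the threshold `(1 - ε) N`, so `A ε ≥ 4 s` makes
the exponential error at most `N^{-2s}`, negligible against `N^{-s}`. -/
theorem exp_neg_log_mul_le {A ε s : ℝ} (hAε : 4 * s ≤ A * ε) (hA : 0 ≤ A) {N k : ℕ}
    (hN : 1 ≤ N) (hk : 2 * (k : ℝ) ≤ ε * N) (hkN : k ≤ N) :
    Real.exp (-(A * Real.log N / N * (((N - k : ℕ) : ℝ) - (1 - ε) * N))) ≤ (N : ℝ) ^ (-(2 * s)) := by
  have hN0 : (0 : ℝ) < N := by exact_mod_cast hN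
  have hlog : 0 ≤ Real.log N := Real.log_nonneg (by exact_mod_cast hN)
  rw [Real.rpow_def_of_pos hN0, Real.exp_le_exp, Nat.cast_sub hkN]
  have h1 : ε * N / 2 ≤ (N : ℝ) - k - (1 - ε) * N := by linarith
  have h2 := mul_le_mul_of_nonneg_left h1 (show 0 ≤ A * Real.log N / N by positivity)
  have h3 : A * Real.log N / N * (ε * N / 2) = (A * ε) * Real.log N / 2 := by field_simp
  have h4 := mul_le_mul_of_nonneg_right hAε hlog
  linarith

/-- The recursion is split at `l = δ N`. Longer jumps act as a source: if the jump from `n > (1 - ε)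
N` lands within `ε N` of `μ N`, its length exceeds `(1 - μ - 2 ε) N` and the sharp weight bound
applies. If it lands elsewhere, the crude bound is multiplied by the vanishing far mass. -/
theorem eventually_massFn_le (h : HeavyTail α β s c μ) {ε : ℝ} (hε : 0 < ε)
    (hεν : 4 * ε < 1 - μ) (k : ℕ) :
    ∀ᶠ N : ℕ in atTop, massFn α β N (N - k) * (N : ℝ) ^ s
      ≤ (c + 2 * ε) * (1 - μ - 2 * ε) ^ (-s) / (1 - μ - 2 * ε) + ε := by
  have hμ := h.mu_pos
  have hs := h.one_lt
  have hc := h.c_pos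
  obtain ⟨C, hC0, hC⟩ := h.exists_le_rpow
  set ν := 1 - μ with hν
  set A := 4 * s / ε with hA
  have hA0 : 0 < A := by positivity
  have hAε : A * ε = 4 * s := by rw [hA]; field_simp
  obtain ⟨δ, hδ, hδN⟩ := h.eventually_sum_weight_mul_exp_le hA0 hε
  set e : ℕ → ℝ := fun N => (c + 2 * ε) * (ν - 2 * ε) ^ (-s)
    + 2 * C * δ ^ (-s) * farMass α β μ ε N with he
  have hν2 : 0 < ν - 2 * ε := by linarith
  have hlim : Tendsto (fun N : ℕ => (N : ℝ) ^ (-s) + e N / (ν - 2 * ε)) atTop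
      (𝓝 (0 + ((c + 2 * ε) * (ν - 2 * ε) ^ (-s) + 2 * C * δ ^ (-s) * 0) / (ν - 2 * ε))) := by
    refine ((tendsto_rpow_neg_atTop (by linarith)).comp tendsto_natCast_atTop_atTop).add
      (Tendsto.div_const ?_ _)
    exact tendsto_const_nhds.add ((h.tendsto_farMass hε).const_mul _)
  rw [mul_zero, add_zero, zero_add] at hlim
  filter_upwards [hδN δ hδ le_rfl, h.eventually_weight_le hε hν2, eventually_ge_atTop 1,
    hlim.eventually (ge_mem_nhds (lt_add_of_pos_right _ hε)), eventually_ge_atTop k,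
    (tendsto_natCast_atTop_atTop.const_mul_atTop hε).eventually_ge_atTop (2 * (k : ℝ))]
    with N h1 h2 hN h3 hkN hk
  have hN0 : (0 : ℝ) < N := by exact_mod_cast hN
  have hfar0 := h.farMass_nonneg ε N
  have he0 : 0 ≤ e N := by simp only [he]; positivity
  have hlog : 0 ≤ Real.log N := Real.log_nonneg (by exact_mod_cast hN)
  -- `D` is chosen so that `E = (1 - μ - 2 ε) N D`. Together with the short weights, at most `(μ +
  -- ε) N`, this gives exactly `m₀ D = (1 - ε) N D`.
  have key := le_exp_add_of_recursion (y := affineWeight α β N) (f := massFn α β N)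
    (P := fun l : ℕ => (l : ℝ) ≤ δ * N) (N := N) (m₀ := (1 - ε) * N) (a := A * Real.log N / N)
    (D := (N : ℝ) ^ (-s) * e N / (ν - 2 * ε)) (E := N * (N : ℝ) ^ (-s) * e N)
    (h.weight_nonneg N) (by positivity) (fun n _ => h.massFn_le_one N n) (by positivity)
    (mul_nonneg (by linarith) hN0.le) ?_ ?_ ?_ (N - k) (Nat.sub_le _ _)
  · have h4 := exp_neg_log_mul_le hAε.ge hA0.le hN hk hkN
    have h5 := mul_le_mul_of_nonneg_right (key.trans (add_le_add_left h4 _))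
      (Real.rpow_nonneg hN0.le s)
    refine h5.trans (le_trans (le_of_eq ?_) h3)
    have h6 : (N : ℝ) ^ (-(2 * s)) * (N : ℝ) ^ s = (N : ℝ) ^ (-s) := by
      rw [← Real.rpow_add hN0]; congr 1; ring
    have h7 : (N : ℝ) ^ (-s) * (N : ℝ) ^ s = 1 := by
      rw [← Real.rpow_add hN0]; simp
    rw [add_mul, h6]
    congr 1
    rw [div_mul_eq_mul_div, mul_right_comm, h7, one_mul]
  · intro n hn hnm
    rw [nat_mul_massFn, ← Finset.sum_filter_add_sum_filter_not _ (fun l : ℕ => (l : ℝ) ≤ δ * N)]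
    refine add_le_add le_rfl ?_
    set far : ℕ → ℝ := fun m => if ε * N < |(m : ℝ) - μ * N| then massFn α β N m else 0 with hfar
    have hfarn : ∀ m, 0 ≤ far m := fun m => by
      simp only [hfar]
      split_ifs
      exacts [h.massFn_nonneg N m, le_rfl]
    have h4 : ∀ l ∈ (Finset.Icc 1 n).filter (fun l : ℕ => ¬ (l : ℝ) ≤ δ * N),
        affineWeight α β N l * massFn α β N (n - l)
          ≤ N * (N : ℝ) ^ (-s) * ((c + 2 * ε) * (ν - 2 * ε) ^ (-s)) * massFn α β N (n - l)
            + N * (N : ℝ) ^ (-s) * (2 * C * δ ^ (-s)) * far (n - l) := by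
      intro l hl
      rw [Finset.mem_filter, Finset.mem_Icc, not_le] at hl
      have hu := h.massFn_nonneg N (n - l)
      by_cases hm : ε * N < |((n - l : ℕ) : ℝ) - μ * N|
      · have hfl : far (n - l) = massFn α β N (n - l) := if_pos hm
        rw [hfl]
        refine le_add_of_nonneg_of_le (by positivity) ?_
        exact mul_le_mul_of_nonneg_right (h.weight_le_of_mul_le hC0 hC hδ hN hl.2.le) hu
      · have hfl : far (n - l) = 0 := if_neg hm
        rw [hfl, mul_zero, add_zero]
        refine mul_le_mul_of_nonneg_right (h2 l ?_) hu
        rw [not_lt, Nat.cast_sub hl.1.2] at hm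
        have := (abs_le.1 hm).2
        rw [hν]
        linarith
    refine (Finset.sum_le_sum h4).trans ?_
    rw [Finset.sum_add_distrib, ← Finset.mul_sum, ← Finset.mul_sum]
    have h5 := sum_filter_sub_le_tsum (h.massFn_nonneg N) (h.hasSum_massFn N).summable n
      (fun l : ℕ => ¬ (l : ℝ) ≤ δ * N)
    rw [(h.hasSum_massFn N).tsum_eq] at h5
    have h6 := sum_filter_sub_le_tsum hfarn (h.summable_farMass ε N) n
      (fun l : ℕ => ¬ (l : ℝ) ≤ δ * N)
    have h7 := mul_le_mul_of_nonneg_left h5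
      (show 0 ≤ N * (N : ℝ) ^ (-s) * ((c + 2 * ε) * (ν - 2 * ε) ^ (-s)) by positivity)
    have h8 := mul_le_mul_of_nonneg_left h6
      (show 0 ≤ N * (N : ℝ) ^ (-s) * (2 * C * δ ^ (-s)) by positivity)
    refine (add_le_add h7 h8).trans (le_of_eq ?_)
    simp only [he, hfar, farMass]
    ring
  · intro n _
    refine (h1 n).trans (mul_le_mul_of_nonneg_right ?_ hN0.le)
    linarith
  · intro n _
    have h4 : ∑ l ∈ (Finset.Icc 1 n).filter (fun l : ℕ => (l : ℝ) ≤ δ * N), affineWeight α β N l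
        ≤ (μ + ε) * N := by
      refine le_trans (Finset.sum_le_sum fun l _ => ?_) (h1 n)
      refine le_mul_of_one_le_right (h.weight_nonneg N l) (Real.one_le_exp (by positivity))
    have hD : 0 ≤ (N : ℝ) ^ (-s) * e N / (ν - 2 * ε) := by positivity
    refine (add_le_add_left (mul_le_mul_of_nonneg_right h4 hD) _).trans (le_of_eq ?_)
    have h5 : N * (N : ℝ) ^ (-s) * e N
        = (ν - 2 * ε) * N * ((N : ℝ) ^ (-s) * e N / (ν - 2 * ε)) := by
      field_simp
    rw [h5, hν]
    ring

/-- The same splitting, keeping of the long jumps only those landing within `ε N` of `μ N`. Their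
lengths are at most `(1 - μ + ε) N`, and they see mass at least `1 - ε`. -/
theorem eventually_le_massFn (h : HeavyTail α β s c μ) {ε : ℝ} (hε : 0 < ε)
    (hεν : 4 * ε < 1 - μ) (hεc : ε < c) (k : ℕ) :
    ∀ᶠ N : ℕ in atTop, (c - ε) * (1 - μ + ε) ^ (-s) * (1 - ε) / (1 - μ + ε) * (1 - ε)
      ≤ massFn α β N (N - k) * (N : ℝ) ^ s := by
  have hμ := h.mu_pos
  have hs := h.one_lt
  set ν := 1 - μ with hν
  set A := 4 * s / ε with hA
  have hA0 : 0 < A := by positivity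
  have hAε : A * ε = 4 * s := by rw [hA]; field_simp
  obtain ⟨δ₀, hδ₀, hδN⟩ := h.eventually_sum_weight_mul_exp_le hA0 hε
  -- The bound `δ ≤ ε` ensures that every jump from beyond `(1 - ε) N` into the bulk is longer than
  -- `δ N`, so the restriction to long jumps loses none of them.
  set δ := min δ₀ ε with hδ
  have hδ0 : 0 < δ := lt_min hδ₀ hε
  have hδε : δ ≤ ε := min_le_right _ _
  have hν2 : 0 < ν - 2 * ε := by linarith
  have hν1 : 0 < ν + ε := by linarith
  have hexp0 : Tendsto (fun N : ℕ => (N : ℝ) ^ (-(2 * s))) atTop (𝓝 0) :=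
    (tendsto_rpow_neg_atTop (by linarith)).comp tendsto_natCast_atTop_atTop
  filter_upwards [hδN δ hδ0 (min_le_left _ _), h.eventually_le_weight hε hεc hν2 hν1,
    eventually_ge_atTop 1, hexp0.eventually (ge_mem_nhds hε), eventually_ge_atTop k,
    (tendsto_natCast_atTop_atTop.const_mul_atTop hε).eventually_ge_atTop (2 * (k : ℝ)),
    h.eventually_le_sum_weight hε hδ0, (h.tendsto_farMass hε).eventually (ge_mem_nhds hε)]
    with N h1 h2 hN h3 hkN hk h9 h10
  have hN0 : (0 : ℝ) < N := by exact_mod_cast hN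
  have hlog : 0 ≤ Real.log N := Real.log_nonneg (by exact_mod_cast hN)
  set e := (c - ε) * (ν + ε) ^ (-s) * (1 - ε) with he
  have hce : 0 < c - ε := sub_pos.2 hεc
  have hε1 : 0 < 1 - ε := by linarith
  have he0 : 0 ≤ e := by positivity
  -- Here `E = (1 - μ + ε) N D`, which complements the lower bound `(μ - ε) N` for the short weights
  -- to `N D`.
  have key := ge_of_recursion (y := affineWeight α β N) (f := massFn α β N)
    (P := fun l : ℕ => (l : ℝ) ≤ δ * N) (N := N) (m₀ := (1 - ε) * N) (a := A * Real.log N / N)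
    (D := (N : ℝ) ^ (-s) * e / (ν + ε)) (E := N * (N : ℝ) ^ (-s) * e)
    (h.weight_nonneg N) (by positivity) (fun n => h.massFn_nonneg N n) (by positivity)
    (by positivity) ?_ ?_ ?_ (N - k) (Nat.sub_le _ _)
  · have h4 := exp_neg_log_mul_le hAε.ge hA0.le hN hk hkN
    have h5 := mul_le_mul_of_nonneg_right key (Real.rpow_nonneg hN0.le s)
    refine le_trans ?_ h5
    have h7 : (N : ℝ) ^ (-s) * (N : ℝ) ^ s = 1 := by
      rw [← Real.rpow_add hN0]; simp
    have h8 : (N : ℝ) ^ (-s) * e / (ν + ε)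
        * (1 - Real.exp (-(A * Real.log N / N * (((N - k : ℕ) : ℝ) - (1 - ε) * N)))) * (N : ℝ) ^ s
        = ((N : ℝ) ^ (-s) * (N : ℝ) ^ s) * (e / (ν + ε)
        * (1 - Real.exp (-(A * Real.log N / N * (((N - k : ℕ) : ℝ) - (1 - ε) * N))))) := by ring
    rw [h8, h7, one_mul]
    exact mul_le_mul_of_nonneg_left (by linarith) (by positivity)
  · intro n hn hnm
    rw [nat_mul_massFn, ← Finset.sum_filter_add_sum_filter_not (Finset.Icc 1 n)
      (fun l : ℕ => (l : ℝ) ≤ δ * N) (fun l => affineWeight α β N l * massFn α β N (n - l))]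
    refine add_le_add le_rfl ?_
    set far : ℕ → ℝ := fun m => if ε * N < |(m : ℝ) - μ * N| then massFn α β N m else 0 with hfar
    set near : ℕ → ℝ := fun m => if ε * N < |(m : ℝ) - μ * N| then 0 else massFn α β N m with hnear
    have hnf : ∀ m, near m = massFn α β N m - far m := fun m => by
      simp only [hnear, hfar]
      split_ifs <;> simp
    have hnearn : ∀ m, 0 ≤ near m := fun m => by
      simp only [hnear]
      split_ifs
      exacts [le_rfl, h.massFn_nonneg N m]
    have hnearle : ∀ m, near m ≤ massFn α β N m := fun m => by
      simp only [hnear]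
      split_ifs
      exacts [h.massFn_nonneg N m, le_rfl]
    have hsum : HasSum near (1 - farMass α β μ ε N) := by
      rw [funext hnf]
      exact (h.hasSum_massFn N).sub (h.summable_farMass ε N).hasSum
    have hsum2 : ∑ l ∈ (Finset.Icc 1 n).filter (fun l : ℕ => ¬ (l : ℝ) ≤ δ * N), near (n - l)
        = 1 - farMass α β μ ε N := by
      rw [← hsum.tsum_eq, tsum_eq_sum (s := Finset.range n), ← sum_Icc_sub_eq]
      · refine Finset.sum_subset (Finset.filter_subset _ _) fun l hl hl' => ?_
        rw [Finset.mem_filter, not_and, not_not] at hl'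
        have hl2 := hl' hl
        rw [Finset.mem_Icc] at hl
        simp only [hnear]
        rw [if_pos]
        rw [Nat.cast_sub hl.2]
        refine lt_of_lt_of_le ?_ (le_abs_self _)
        have h11 : δ * N ≤ ε * N := mul_le_mul_of_nonneg_right hδε hN0.le
        have h12 : 4 * ε * N < ν * N := mul_lt_mul_of_pos_right hεν hN0
        rw [hν] at h12
        linarith [mul_pos hε hN0]
      · intro m hm
        rw [Finset.mem_range, not_lt] at hm
        simp only [hnear]
        rw [if_pos]
        refine lt_of_lt_of_le ?_ (le_abs_self _)
        have hm' : (n : ℝ) ≤ m := by exact_mod_cast hm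
        have h12 : 4 * ε * N < ν * N := mul_lt_mul_of_pos_right hεν hN0
        rw [hν] at h12
        linarith [mul_pos hε hN0]
    have h4 : ∀ l ∈ (Finset.Icc 1 n).filter (fun l : ℕ => ¬ (l : ℝ) ≤ δ * N),
        N * (N : ℝ) ^ (-s) * ((c - ε) * (ν + ε) ^ (-s)) * near (n - l)
          ≤ affineWeight α β N l * massFn α β N (n - l) := by
      intro l hl
      rw [Finset.mem_filter, Finset.mem_Icc, not_le] at hl
      by_cases hm : ε * N < |((n - l : ℕ) : ℝ) - μ * N|
      · have : near (n - l) = 0 := if_pos hm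
        rw [this, mul_zero]
        exact mul_nonneg (h.weight_nonneg N l) (h.massFn_nonneg N _)
      · have : near (n - l) = massFn α β N (n - l) := if_neg hm
        rw [this]
        rw [not_lt, Nat.cast_sub hl.1.2, abs_le] at hm
        have hn' : (n : ℝ) ≤ N := by exact_mod_cast hn
        refine mul_le_mul_of_nonneg_right (h2 l ?_ ?_) (h.massFn_nonneg N _)
        · rw [hν]; linarith
        · rw [hν]; linarith
    refine le_trans ?_ (Finset.sum_le_sum h4)
    rw [← Finset.mul_sum, hsum2, he]
    have h11 : 1 - ε ≤ 1 - farMass α β μ ε N := by linarith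
    refine le_trans (le_of_eq ?_) (mul_le_mul_of_nonneg_left h11
      (show 0 ≤ N * (N : ℝ) ^ (-s) * ((c - ε) * (ν + ε) ^ (-s)) by positivity))
    ring
  · intro n _
    refine (h1 n).trans (mul_le_mul_of_nonneg_right ?_ hN0.le)
    linarith
  · intro n _ hnm
    have h4 : δ * N ≤ n := by
      refine le_trans (mul_le_mul_of_nonneg_right ?_ hN0.le) hnm.le
      linarith
    have hD : 0 ≤ (N : ℝ) ^ (-s) * e / (ν + ε) := by positivity
    have h5 : N * (N : ℝ) ^ (-s) * e = (ν + ε) * N * ((N : ℝ) ^ (-s) * e / (ν + ε)) := by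
      field_simp
    have h6 := mul_le_mul_of_nonneg_right (h9 n h4) hD
    rw [h5]
    refine le_trans (le_of_eq ?_) (add_le_add_left h6 _)
    rw [hν]
    ring

/-- The local limit theorem. -/
theorem tendsto_massFn_mul_rpow (h : HeavyTail α β s c μ) (k : ℕ) :
    Tendsto (fun N : ℕ => massFn α β N (N - k) * (N : ℝ) ^ s) atTop
      (𝓝 (c * (1 - μ) ^ (-s) / (1 - μ))) := by
  have hν : 0 < 1 - μ := sub_pos.2 h.mu_lt
  have hc := h.c_pos
  have hid : Tendsto (fun ε : ℝ => ε) (𝓝[>] 0) (𝓝 0) := tendsto_nhdsWithin_of_tendsto_nhds tendsto_id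
  have hsmall : ∀ᶠ ε : ℝ in 𝓝[>] 0, 0 < ε ∧ 4 * ε < 1 - μ ∧ ε < c := by
    filter_upwards [self_mem_nhdsWithin, hid.eventually (gt_mem_nhds (show 0 < (1 - μ) / 4 by linarith)),
      hid.eventually (gt_mem_nhds hc)] with ε h1 h2 h3
    exact ⟨h1, by linarith, h3⟩
  rw [tendsto_order]
  constructor
  · intro b hb
    have hlim : Tendsto (fun ε : ℝ => (c - ε) * (1 - μ + ε) ^ (-s) * (1 - ε) / (1 - μ + ε) * (1 - ε))
        (𝓝[>] 0) (𝓝 ((c - 0) * (1 - μ + 0) ^ (-s) * (1 - 0) / (1 - μ + 0) * (1 - 0))) := by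
      have h1 := (tendsto_const_nhds (x := 1 - μ)).add hid
      have hne : 1 - μ + 0 ≠ 0 := by linarith
      exact (((((tendsto_const_nhds.sub hid).mul (h1.rpow_const (Or.inl hne))).mul
        (tendsto_const_nhds.sub hid)).div h1 hne).mul (tendsto_const_nhds.sub hid))
    simp only [sub_zero, add_zero, mul_one] at hlim
    obtain ⟨ε, h1, h2, h3, h4⟩ := ((hlim.eventually (lt_mem_nhds hb)).and hsmall).exists
    filter_upwards [h.eventually_le_massFn h2 h3 h4 k] with N hN
    exact h1.trans_le hN
  · intro b hb
    have hlim : Tendsto (fun ε : ℝ => (c + 2 * ε) * (1 - μ - 2 * ε) ^ (-s) / (1 - μ - 2 * ε) + ε)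
        (𝓝[>] 0) (𝓝 ((c + 2 * 0) * (1 - μ - 2 * 0) ^ (-s) / (1 - μ - 2 * 0) + 0)) := by
      have h1 := (tendsto_const_nhds (x := 1 - μ)).sub (hid.const_mul 2)
      have hne : 1 - μ - 2 * 0 ≠ 0 := by linarith
      exact (((tendsto_const_nhds.add (hid.const_mul 2)).mul (h1.rpow_const (Or.inl hne))).div
        h1 hne).add hid
    simp only [mul_zero, sub_zero, add_zero] at hlim
    obtain ⟨ε, h1, h2, h3, _⟩ := ((hlim.eventually (gt_mem_nhds hb)).and hsmall).exists
    filter_upwards [h.eventually_massFn_le h2 h3 k] with N hN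
    exact hN.trans_lt h1

end HeavyTail

/-! ### Lower bounds for the joint distribution of the cycle lengths -/

theorem cycleStep_nonneg {x f : ℕ → ℝ} (hx : ∀ l, 0 ≤ x l) (hf : ∀ n, 0 ≤ f n) (A : Set ℕ)
    (n : ℕ) : 0 ≤ cycleStep x A f n :=
  div_nonneg (Finset.sum_nonneg fun _ _ => mul_nonneg (hx _) (hf _)) (Nat.cast_nonneg n)

theorem sum_div_le_cycleStep {x f : ℕ → ℝ} (hx : ∀ l, 0 ≤ x l) (hf : ∀ n, 0 ≤ f n) {A : Set ℕ}
    {n : ℕ} {T : Finset ℕ} (hT : ∀ l ∈ T, (1 ≤ l ∧ l ≤ n) ∧ l ∈ A) :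
    (∑ l ∈ T, x l * f (n - l)) / n ≤ cycleStep x A f n := by
  classical
  rw [cycleStep]
  refine div_le_div_of_nonneg_right (Finset.sum_le_sum_of_subset_of_nonneg (fun l hl => ?_)
    fun _ _ _ => mul_nonneg (hx _) (hf _)) (Nat.cast_nonneg n)
  rw [Finset.mem_filter, Finset.mem_Icc]
  exact hT l hl

/-- The lexicographic coefficients divided by the total mass. -/
noncomputable def lexMass (α β : ℕ → ℝ) (N : ℕ) : List (Set ℕ) → ℕ → ℝ
  | [] => massFn α β N
  | A :: As => cycleStep (affineWeight α β N) A (lexMass α β N As)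

theorem lexMass_eq (α β : ℕ → ℝ) (N : ℕ) (As : List (Set ℕ)) (n : ℕ) :
    lexMass α β N As n
      = lexCoeff (affineWeight α β N) As n / ∑' k, expCoeff (affineWeight α β N) k := by
  induction As generalizing n with
  | nil => rfl
  | cons A As ih =>
    simp only [lexMass, lexCoeff, cycleStep, ih, ← mul_div_assoc]
    rw [← Finset.sum_div, div_right_comm]

namespace HeavyTail

variable {α β : ℕ → ℝ} {s c μ : ℝ}

theorem lexMass_nonneg (h : HeavyTail α β s c μ) (N : ℕ) (As : List (Set ℕ)) (n : ℕ) :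
    0 ≤ lexMass α β N As n := by
  induction As generalizing n with
  | nil => exact h.massFn_nonneg N n
  | cons A As ih => exact cycleStep_nonneg (h.weight_nonneg N) ih A n

/-- The points at distance at most `ε N` from `μ N`. -/
noncomputable def bulk (μ ε : ℝ) (N : ℕ) : Finset ℕ :=
  (Finset.range N).filter fun n : ℕ => |(n : ℝ) - μ * N| ≤ ε * N

/-- In the limit, the total mass of `F N` near `μ N` is at least `p`. -/
def BulkGe (μ : ℝ) (F : ℕ → ℕ → ℝ) (p : ℝ) : Prop :=
  ∀ ε > 0, ∀ d < p, ∀ᶠ N : ℕ in atTop, d ≤ ∑ n ∈ bulk μ ε N, F N n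

/-- In the limit, the value of `N^s F N` close to `N` is at least `d`. -/
def LocalGe (s : ℝ) (F : ℕ → ℕ → ℝ) (d : ℝ) : Prop :=
  ∀ k : ℕ, ∀ d' < d, ∀ᶠ N : ℕ in atTop, d' ≤ F N (N - k) * (N : ℝ) ^ s

theorem bulk_mono {μ ε ε' : ℝ} (hε : ε ≤ ε') (N : ℕ) : bulk μ ε N ⊆ bulk μ ε' N := by
  intro n hn
  rw [bulk, Finset.mem_filter] at hn ⊢
  exact ⟨hn.1, hn.2.trans (mul_le_mul_of_nonneg_right hε (Nat.cast_nonneg N))⟩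

theorem bulkGe_massFn (h : HeavyTail α β s c μ) : BulkGe μ (massFn α β) 1 := by
  intro ε hε d hd
  -- At this radius the whole neighbourhood of `μ N` lies below `N`, so the restriction `n < N` in
  -- `bulk` removes nothing.
  set e := min ε ((1 - μ) / 2) with he
  have hν : 0 < 1 - μ := sub_pos.2 h.mu_lt
  have he0 : 0 < e := lt_min hε (by linarith)
  filter_upwards [(h.tendsto_farMass he0).eventually (ge_mem_nhds (sub_pos.2 hd)),
    eventually_gt_atTop 0] with N hN hN0
  have hN0' : (0 : ℝ) < N := by exact_mod_cast hN0
  refine le_trans ?_ (Finset.sum_le_sum_of_subset_of_nonneg (bulk_mono (min_le_left _ _ : e ≤ ε) N)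
    fun n _ _ => h.massFn_nonneg N n)
  have h1 := (h.hasSum_massFn N).sub (h.summable_farMass e N).hasSum
  have h2 := h1.tsum_eq
  rw [tsum_eq_sum (s := bulk μ e N)] at h2
  · have h3 : ∑ n ∈ bulk μ e N, (massFn α β N n
        - if e * N < |(n : ℝ) - μ * N| then massFn α β N n else 0) = ∑ n ∈ bulk μ e N, massFn α β N n := by
      refine Finset.sum_congr rfl fun n hn => ?_
      rw [bulk, Finset.mem_filter] at hn
      rw [if_neg (not_lt.2 hn.2), sub_zero]
    rw [h3] at h2
    rw [h2]
    change d ≤ 1 - farMass α β μ e N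
    linarith
  · intro n hn
    rw [if_pos, sub_self]
    by_contra hcon
    rw [not_lt] at hcon
    refine hn ?_
    rw [bulk, Finset.mem_filter, Finset.mem_range]
    refine ⟨?_, hcon⟩
    have h3 := (abs_le.1 hcon).2
    have h4 : e * N ≤ (1 - μ) / 2 * N := mul_le_mul_of_nonneg_right (min_le_right _ _) hN0'.le
    have h5 : (n : ℝ) < N := by nlinarith
    exact_mod_cast h5

/-- Supplies the slack for the following steps: a strict inequality at the limiting constants
survives a small `ε` and a `p'` slightly below `p`. -/
theorem exists_lt_of_tendsto_const_mul {g : ℝ → ℝ} {q p d : ℝ} (hg : Tendsto g (𝓝[>] 0) (𝓝 q))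
    (hd : d < q * p) {e : ℝ} (he : 0 < e) :
    ∃ ε, 0 < ε ∧ ε < e ∧ ∃ p' < p, d < g ε * p' := by
  have h1 : Tendsto (fun ε => g ε * p) (𝓝[>] 0) (𝓝 (q * p)) := hg.mul_const p
  have h2 : ∀ᶠ ε : ℝ in 𝓝[>] 0, 0 < ε ∧ ε < e := by
    filter_upwards [Ioo_mem_nhdsGT he] with ε hε using hε
  obtain ⟨ε, h3, h4, h5⟩ := ((h1.eventually (lt_mem_nhds hd)).and h2).exists
  have h6 : Tendsto (fun p' => g ε * p') (𝓝[<] p) (𝓝 (g ε * p)) :=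
    (tendsto_const_nhds.mul tendsto_id).mono_left nhdsWithin_le_nhds
  obtain ⟨p', h7, h8⟩ := ((h6.eventually (lt_mem_nhds h3)).and self_mem_nhdsWithin).exists
  exact ⟨ε, h4, h5, p', h8, h7⟩

/-- From `n ≈ μ N` a cycle of fixed length `l` has weight about `N β_l / n ≈ β_l / μ`, and `n - l`
is again close to `μ N`. -/
theorem bulkGe_step (h : HeavyTail α β s c μ) {F : ℕ → ℕ → ℝ} (hF : ∀ N n, 0 ≤ F N n) {p : ℝ}
    (hp : BulkGe μ F p) (K : ℕ) :
    BulkGe μ (fun N => cycleStep (affineWeight α β N) (Set.Icc 1 K) (F N))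
      ((∑ l ∈ Finset.Icc 1 K, β l) / μ * p) := by
  intro ε hε d hd
  have hμ := h.mu_pos
  have hν : 0 < 1 - μ := sub_pos.2 h.mu_lt
  set m := ∑ l ∈ Finset.Icc 1 K, β l with hm
  have hm0 : 0 ≤ m := Finset.sum_nonneg fun l _ => h.beta_nonneg l
  have hg : Tendsto (fun e : ℝ => m / (μ + e)) (𝓝[>] 0) (𝓝 (m / μ)) := by
    have h1 : Tendsto (fun e : ℝ => μ + e) (𝓝[>] 0) (𝓝 (μ + 0)) :=
      (tendsto_const_nhds.add tendsto_id).mono_left nhdsWithin_le_nhds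
    rw [add_zero] at h1
    exact tendsto_const_nhds.div h1 hμ.ne'
  obtain ⟨e, he0, he1, p', hp', hdp⟩ := exists_lt_of_tendsto_const_mul hg hd
    (lt_min hε (lt_min hμ hν) : 0 < min ε (min μ (1 - μ)))
  have heε : e < ε := he1.trans_le (min_le_left _ _)
  have heμ : e < μ := he1.trans_le ((min_le_right _ _).trans (min_le_left _ _))
  have heν : e < 1 - μ := he1.trans_le ((min_le_right _ _).trans (min_le_right _ _))
  filter_upwards [hp (e / 2) (by positivity) p' hp', eventually_gt_atTop 0,
    (tendsto_natCast_atTop_atTop.const_mul_atTop (half_pos he0)).eventually_ge_atTop (K : ℝ),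
    (tendsto_natCast_atTop_atTop.const_mul_atTop (sub_pos.2 heμ)).eventually_ge_atTop ((K : ℝ) + 1)]
    with N hN hN0 hK hK2
  have hN0' : (0 : ℝ) < N := by exact_mod_cast hN0
  have hstep : ∀ n, 0 ≤ cycleStep (affineWeight α β N) (Set.Icc 1 K) (F N) n :=
    cycleStep_nonneg (h.weight_nonneg N) (hF N) _
  refine le_trans ?_ (Finset.sum_le_sum_of_subset_of_nonneg (bulk_mono heε.le N)
    fun n _ _ => hstep n)
  have h1 : ∀ n ∈ bulk μ e N, (μ + e)⁻¹ * ∑ l ∈ Finset.Icc 1 K, β l * F N (n - l)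
      ≤ cycleStep (affineWeight α β N) (Set.Icc 1 K) (F N) n := by
    intro n hn
    rw [bulk, Finset.mem_filter, abs_le] at hn
    have hnK : (K : ℝ) + 1 ≤ n := by nlinarith [hn.2.1]
    have hn0 : (0 : ℝ) < n := by linarith [(Nat.cast_nonneg K : (0 : ℝ) ≤ K)]
    refine le_trans ?_ (sum_div_le_cycleStep (T := Finset.Icc 1 K) (h.weight_nonneg N) (hF N) ?_)
    · rw [le_div_iff₀ hn0, Finset.mul_sum, Finset.sum_mul]
      refine Finset.sum_le_sum fun l _ => ?_
      have h2 : (μ + e)⁻¹ * n ≤ N := by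
        rw [inv_mul_le_iff₀ (by positivity)]
        nlinarith [hn.2.2]
      have h3 : (N : ℝ) * β l ≤ affineWeight α β N l :=
        le_add_of_nonneg_left (h.alpha_nonneg l)
      have h4 : (μ + e)⁻¹ * n * β l ≤ N * β l := mul_le_mul_of_nonneg_right h2 (h.beta_nonneg l)
      have h5 := mul_le_mul_of_nonneg_right (h4.trans h3) (hF N (n - l))
      linarith
    · intro l hl
      rw [Finset.mem_Icc] at hl
      have : (l : ℝ) ≤ K := by exact_mod_cast hl.2
      exact ⟨⟨hl.1, by exact_mod_cast (by linarith : (l : ℝ) ≤ n)⟩, hl⟩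
  refine le_trans ?_ (Finset.sum_le_sum h1)
  rw [← Finset.mul_sum, Finset.sum_comm]
  have h2 : ∀ l ∈ Finset.Icc 1 K, β l * p' ≤ ∑ n ∈ bulk μ e N, β l * F N (n - l) := by
    intro l hl
    rw [Finset.mem_Icc] at hl
    rw [← Finset.mul_sum]
    refine mul_le_mul_of_nonneg_left (hN.trans ?_) (h.beta_nonneg l)
    -- The bulk of radius `e / 2`, translated by `l ≤ K ≤ (e / 2) N`, stays inside the bulk of
    -- radius `e`.
    have h3 : ∑ m ∈ bulk μ (e / 2) N, F N m
        = ∑ n ∈ (bulk μ (e / 2) N).image (· + l), F N (n - l) := by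
      rw [Finset.sum_image fun a _ b _ hab => Nat.add_right_cancel hab]
      simp
    rw [h3]
    refine Finset.sum_le_sum_of_subset_of_nonneg (fun n hn => ?_) fun _ _ _ => hF _ _
    rw [Finset.mem_image] at hn
    obtain ⟨m, hm, rfl⟩ := hn
    rw [bulk, Finset.mem_filter, abs_le] at hm
    rw [bulk, Finset.mem_filter, abs_le, Finset.mem_range]
    have hl0 : (0 : ℝ) ≤ l := Nat.cast_nonneg l
    have hlK : (l : ℝ) ≤ K := by exact_mod_cast hl.2
    push_cast
    refine ⟨?_, by linarith, by linarith⟩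
    have h6 : e * N < (1 - μ) * N := mul_lt_mul_of_pos_right heν hN0'
    have h7 : ((m + l : ℕ) : ℝ) < N := by push_cast; linarith
    exact_mod_cast h7
  refine le_trans hdp.le (le_trans (le_of_eq ?_)
    (mul_le_mul_of_nonneg_left (Finset.sum_le_sum h2) (by positivity)))
  rw [← Finset.sum_mul, ← hm]
  ring

theorem localGe_massFn (h : HeavyTail α β s c μ) :
    LocalGe s (massFn α β) (c * (1 - μ) ^ (-s) / (1 - μ)) := fun k _ hd =>
  (h.tendsto_massFn_mul_rpow k).eventually (le_mem_nhds hd)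

/-- A short cycle leads from `N - k` to `N - (k + l)` with factor at least `N β_l / (N - k) ≥ β_l`.
This is why `LocalGe` is required for all `k`. -/
theorem localGe_step_short (h : HeavyTail α β s c μ) {F : ℕ → ℕ → ℝ} (hF : ∀ N n, 0 ≤ F N n)
    {d : ℝ} (hd : LocalGe s F d) (K : ℕ) :
    LocalGe s (fun N => cycleStep (affineWeight α β N) (Set.Icc 1 K) (F N))
      ((∑ l ∈ Finset.Icc 1 K, β l) * d) := by
  intro k d₁ hd₁
  obtain ⟨_, _, _, d', hd', hlt⟩ := exists_lt_of_tendsto_const_mul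
    (g := fun _ => ∑ l ∈ Finset.Icc 1 K, β l) tendsto_const_nhds hd₁ one_pos
  have h1 : ∀ᶠ N : ℕ in atTop, ∀ l ∈ Finset.Icc 1 K, d' ≤ F N (N - (k + l)) * (N : ℝ) ^ s := by
    rw [eventually_all_finset]
    exact fun l _ => hd (k + l) d' hd'
  filter_upwards [h1, eventually_gt_atTop (k + K)] with N hN hNk
  have hn0 : (0 : ℝ) < ((N - k : ℕ) : ℝ) := by exact_mod_cast (by omega : 0 < N - k)
  have hnN : ((N - k : ℕ) : ℝ) ≤ N := by exact_mod_cast Nat.sub_le N k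
  have hs0 : 0 ≤ (N : ℝ) ^ s := by positivity
  refine hlt.le.trans (le_trans ?_ (mul_le_mul_of_nonneg_right
    (sum_div_le_cycleStep (T := Finset.Icc 1 K) (h.weight_nonneg N) (hF N) ?_) hs0))
  · rw [div_mul_eq_mul_div, le_div_iff₀ hn0, Finset.sum_mul, Finset.sum_mul, Finset.sum_mul]
    refine Finset.sum_le_sum fun l hl => ?_
    have h2 := mul_le_mul_of_nonneg_left (hN l hl) (h.beta_nonneg l)
    have h3 : (N : ℝ) * β l ≤ affineWeight α β N l := le_add_of_nonneg_left (h.alpha_nonneg l)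
    have h4 : 0 ≤ F N (N - k - l) * (N : ℝ) ^ s := mul_nonneg (hF _ _) hs0
    rw [← Nat.sub_sub] at h2
    calc β l * d' * ((N - k : ℕ) : ℝ)
        ≤ β l * (F N (N - k - l) * (N : ℝ) ^ s) * ((N - k : ℕ) : ℝ) :=
          mul_le_mul_of_nonneg_right h2 hn0.le
      _ ≤ β l * (F N (N - k - l) * (N : ℝ) ^ s) * N :=
          mul_le_mul_of_nonneg_left hnN (mul_nonneg (h.beta_nonneg l) h4)
      _ = N * β l * (F N (N - k - l) * (N : ℝ) ^ s) := by ring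
      _ ≤ affineWeight α β N l * (F N (N - k - l) * (N : ℝ) ^ s) :=
          mul_le_mul_of_nonneg_right h3 h4
      _ = affineWeight α β N l * F N (N - k - l) * (N : ℝ) ^ s := by ring
  · intro l hl
    rw [Finset.mem_Icc] at hl
    exact ⟨⟨hl.1, by omega⟩, hl⟩

/-- The lengths at distance at most `ε N` from `(1 - μ) N`. -/
def longWindow (μ ε : ℝ) (N : ℕ) : Set ℕ := {l | |(l : ℝ) - (1 - μ) * N| ≤ ε * N ∧ 1 ≤ l}

/-- A cycle leading from `N - k` to a bulk point has length about `(1 - μ) N`, hence weight about `c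
(1 - μ)^{-s} N^{1-s}`, nearly independent of the target. Summation over the targets yields the bulk
mass `p`, and division by `N - k` leaves the order `N^{-s}`. -/
theorem localGe_step_long (h : HeavyTail α β s c μ) {F : ℕ → ℕ → ℝ} (hF : ∀ N n, 0 ≤ F N n)
    {p : ℝ} (hp : BulkGe μ F p) {ε : ℝ} (hε : 0 < ε) :
    LocalGe s (fun N => cycleStep (affineWeight α β N) (longWindow μ ε N) (F N))
      (c * (1 - μ) ^ (-s) * p) := by
  intro k d hd
  have hν : 0 < 1 - μ := sub_pos.2 h.mu_lt
  have hc := h.c_pos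
  have hs := h.one_lt
  rcases lt_or_ge d 0 with hdneg | hd0
  · exact Eventually.of_forall fun N => hdneg.le.trans (mul_nonneg
      (cycleStep_nonneg (h.weight_nonneg N) (hF N) _ _) (by positivity))
  have hg : Tendsto (fun e : ℝ => (c - e) * (1 - μ + e) ^ (-s)) (𝓝[>] 0)
      (𝓝 (c * (1 - μ) ^ (-s))) := by
    have hid : Tendsto (fun e : ℝ => e) (𝓝[>] 0) (𝓝 0) :=
      tendsto_id.mono_left nhdsWithin_le_nhds
    have h1 := (tendsto_const_nhds (x := 1 - μ)).add hid
    have h2 := (tendsto_const_nhds (x := c)).sub hid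
    rw [add_zero] at h1
    rw [sub_zero] at h2
    exact h2.mul (h1.rpow_const (Or.inl hν.ne'))
  obtain ⟨e, he0, he1, p', hp', hdp⟩ := exists_lt_of_tendsto_const_mul hg hd
    (lt_min (lt_min hε hc) hν : 0 < min (min ε c) (1 - μ))
  have heε : e < ε := he1.trans_le ((min_le_left _ _).trans (min_le_left _ _))
  have hec : e < c := he1.trans_le ((min_le_left _ _).trans (min_le_right _ _))
  have heν : e < 1 - μ := he1.trans_le (min_le_right _ _)
  filter_upwards [hp (e / 2) (by positivity) p' hp', eventually_gt_atTop 0,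
    (tendsto_natCast_atTop_atTop.const_mul_atTop (half_pos he0)).eventually_ge_atTop (k : ℝ),
    h.eventually_le_weight he0 hec (sub_pos.2 heν) (show 0 < 1 - μ + e by linarith),
    eventually_gt_atTop k]
    with N hN hN0 hk hw hNk
  have hN0' : (0 : ℝ) < N := by exact_mod_cast hN0
  have hn0 : (0 : ℝ) < ((N - k : ℕ) : ℝ) := by exact_mod_cast (by omega : 0 < N - k)
  have hnN : ((N - k : ℕ) : ℝ) ≤ N := by exact_mod_cast Nat.sub_le N k
  have hs0 : 0 < (N : ℝ) ^ s := by positivity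
  have hmem : ∀ m ∈ bulk μ (e / 2) N, m < N - k ∧
      |((N - k - m : ℕ) : ℝ) - (1 - μ) * N| ≤ e * N := by
    intro m hm
    rw [bulk, Finset.mem_filter, abs_le] at hm
    have h6 : e * N < (1 - μ) * N := mul_lt_mul_of_pos_right heν hN0'
    have h8 : m < N - k := by
      have h7 : ((m + k : ℕ) : ℝ) < N := by push_cast; linarith
      have : m + k < N := by exact_mod_cast h7
      omega
    refine ⟨h8, ?_⟩
    rw [Nat.cast_sub h8.le, Nat.cast_sub hNk.le, abs_le]
    have hk0 : (0 : ℝ) ≤ k := Nat.cast_nonneg k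
    constructor <;> linarith
  refine hdp.le.trans (le_trans ?_ (mul_le_mul_of_nonneg_right
    (sum_div_le_cycleStep (T := (bulk μ (e / 2) N).image (N - k - ·)) (h.weight_nonneg N)
      (hF N) ?_) hs0.le))
  · rw [Finset.sum_image, div_mul_eq_mul_div, le_div_iff₀ hn0]
    · have hcoef : 0 < (c - e) * (1 - μ + e) ^ (-s) := by
        have := sub_pos.2 hec
        positivity
      have h1 : ∀ m ∈ bulk μ (e / 2) N,
          N * (N : ℝ) ^ (-s) * ((c - e) * (1 - μ + e) ^ (-s)) * F N m
            ≤ affineWeight α β N (N - k - m) * F N (N - k - (N - k - m)) := by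
        intro m hm
        obtain ⟨h2, h3⟩ := hmem m hm
        rw [abs_le] at h3
        rw [show N - k - (N - k - m) = m by omega]
        exact mul_le_mul_of_nonneg_right (hw _ (by linarith) (by linarith)) (hF N m)
      have h2 := Finset.sum_le_sum h1
      rw [← Finset.mul_sum] at h2
      have h3 := mul_le_mul_of_nonneg_right h2 hs0.le
      refine le_trans ?_ h3
      have h4 : (N : ℝ) ^ (-s) * (N : ℝ) ^ s = 1 := by
        rw [← Real.rpow_add hN0']; simp
      have h5 : N * (N : ℝ) ^ (-s) * ((c - e) * (1 - μ + e) ^ (-s)) *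
          (∑ m ∈ bulk μ (e / 2) N, F N m) * (N : ℝ) ^ s
          = ((N : ℝ) ^ (-s) * (N : ℝ) ^ s) * ((c - e) * (1 - μ + e) ^ (-s) *
            ∑ m ∈ bulk μ (e / 2) N, F N m) * N := by ring
      rw [h5, h4, one_mul]
      have h6 := mul_le_mul_of_nonneg_left hN hcoef.le
      exact mul_le_mul h6 hnN hn0.le (hd0.trans (hdp.le.trans h6))
    · intro m hm m' hm' hmm
      have h1 := (hmem m hm).1
      have h2 := (hmem m' hm').1
      simp only at hmm
      omega
  · intro l hl
    rw [Finset.mem_image] at hl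
    obtain ⟨m, hm, rfl⟩ := hl
    obtain ⟨h1, h2⟩ := hmem m hm
    exact ⟨⟨by omega, by omega⟩,
      h2.trans (mul_le_mul_of_nonneg_right heε.le hN0'.le), by omega⟩

/-- Describes the cycles following the long one: the base tends to one as `K → ∞`, so nothing is
lost in the limit. -/
theorem bulkGe_replicate (h : HeavyTail α β s c μ) (K j : ℕ) :
    BulkGe μ (fun N => lexMass α β N (List.replicate j (Set.Icc 1 K)))
      (((∑ l ∈ Finset.Icc 1 K, β l) / μ) ^ j) := by
  induction j with
  | zero => simpa [lexMass] using! h.bulkGe_massFn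
  | succ j ih =>
    rw [pow_succ']
    exact h.bulkGe_step (fun N => h.lexMass_nonneg N _) ih K

theorem localGe_replicate_append (h : HeavyTail α β s c μ) (K : ℕ) {As : ℕ → List (Set ℕ)} {d : ℝ}
    (hd : LocalGe s (fun N => lexMass α β N (As N)) d) (i : ℕ) :
    LocalGe s (fun N => lexMass α β N (List.replicate i (Set.Icc 1 K) ++ As N))
      ((∑ l ∈ Finset.Icc 1 K, β l) ^ i * d) := by
  induction i with
  | zero => simpa using hd
  | succ i ih =>
    rw [pow_succ', mul_assoc]
    exact h.localGe_step_short (fun N => h.lexMass_nonneg N _) ih K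

/-- Conditioning on total size `N` is division by `massFn α β N N`; both sides have order `N^{-s}`,
and the local limit at `k = 0` supplies the constant. -/
theorem eventually_le_div_massFn (h : HeavyTail α β s c μ) {F : ℕ → ℕ → ℝ} {d : ℝ}
    (hF : LocalGe s F (c * (1 - μ) ^ (-s) / (1 - μ) * d)) {d' : ℝ} (hd' : d' < d) :
    ∀ᶠ N : ℕ in atTop, d' ≤ F N N / massFn α β N N := by
  have hν : 0 < 1 - μ := sub_pos.2 h.mu_lt
  have hc := h.c_pos
  set L := c * (1 - μ) ^ (-s) / (1 - μ) with hL
  have hL0 : 0 < L := by positivity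
  have h0 := h.tendsto_massFn_mul_rpow 0
  obtain ⟨e, he, hed⟩ := exists_between hd'
  have h1 := hF 0 (L * e) (mul_lt_mul_of_pos_left hed hL0)
  have h2 : Tendsto (fun N : ℕ => L * e / (massFn α β N (N - 0) * (N : ℝ) ^ s)) atTop
      (𝓝 (L * e / L)) := tendsto_const_nhds.div h0 hL0.ne'
  rw [mul_div_cancel_left₀ _ hL0.ne'] at h2
  filter_upwards [h1, h2.eventually (le_mem_nhds he), h0.eventually (lt_mem_nhds hL0),
    eventually_gt_atTop 0] with N h3 h4 h5 hN
  rw [Nat.sub_zero] at h3 h4 h5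
  have hN0' : (0 : ℝ) < N := by exact_mod_cast hN
  have hs0 : 0 < (N : ℝ) ^ s := by positivity
  refine h4.trans ((div_le_div_of_nonneg_right h3 h5.le).trans (le_of_eq ?_))
  rw [mul_div_mul_right _ _ hs0.ne']

theorem eventually_massFn_pos (h : HeavyTail α β s c μ) :
    ∀ᶠ N : ℕ in atTop, 0 < massFn α β N N := by
  have hν : 0 < 1 - μ := sub_pos.2 h.mu_lt
  have hc := h.c_pos
  have hL0 : 0 < c * (1 - μ) ^ (-s) / (1 - μ) := by positivity
  filter_upwards [(h.tendsto_massFn_mul_rpow 0).eventually (lt_mem_nhds hL0)] with N hN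
  exact pos_of_mul_pos_left hN (by positivity)

theorem tendsto_sum_beta (h : HeavyTail α β s c μ) :
    Tendsto (fun K => ∑ l ∈ Finset.Icc 1 K, β l) atTop (𝓝 μ) := by
  have h1 := (tendsto_add_atTop_iff_nat 1).2 h.hasSum.tendsto_sum_nat
  refine h1.congr fun K => ?_
  rw [Finset.range_eq_Ico, Finset.sum_eq_sum_Ico_succ_bot (by omega), h.beta_zero, zero_add]
  rfl

/-- Asymptotically, with probability at least about `μ^m` the first `m` cycles are short. -/
theorem exists_eventually_short (h : HeavyTail α β s c μ) (m : ℕ) {d : ℝ} (hd : d < μ ^ m) :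
    ∃ K : ℕ, ∀ᶠ N : ℕ in atTop,
      d ≤ lexMass α β N (List.replicate m (Set.Icc 1 K)) N / massFn α β N N := by
  obtain ⟨K, hK⟩ := ((h.tendsto_sum_beta.pow m).eventually (lt_mem_nhds hd)).exists
  refine ⟨K, h.eventually_le_div_massFn (F := fun N => lexMass α β N (List.replicate m (Set.Icc 1 K)))
    ?_ hK⟩
  have := h.localGe_replicate_append (As := fun _ => []) K h.localGe_massFn m
  simpa [mul_comm] using this

/-- Asymptotically, with probability at least about `μ^i (1 - μ)` the first long cycle is preceded
by `i` short cycles and followed by short ones. -/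
theorem exists_eventually_long (h : HeavyTail α β s c μ) (i j : ℕ) {d : ℝ}
    (hd : d < μ ^ i * (1 - μ)) {ε : ℝ} (hε : 0 < ε) :
    ∃ K : ℕ, ∀ᶠ N : ℕ in atTop,
      d ≤ lexMass α β N (List.replicate i (Set.Icc 1 K) ++ longWindow μ ε N ::
        List.replicate j (Set.Icc 1 K)) N / massFn α β N N := by
  have hν : 0 < 1 - μ := sub_pos.2 h.mu_lt
  have hμ := h.mu_pos
  have hlim : Tendsto (fun K => (∑ l ∈ Finset.Icc 1 K, β l) ^ i * (1 - μ) *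
      ((∑ l ∈ Finset.Icc 1 K, β l) / μ) ^ j) atTop (𝓝 (μ ^ i * (1 - μ) * (μ / μ) ^ j)) :=
    ((h.tendsto_sum_beta.pow i).mul_const _).mul ((h.tendsto_sum_beta.div_const μ).pow j)
  rw [div_self hμ.ne', one_pow, mul_one] at hlim
  obtain ⟨K, hK⟩ := (hlim.eventually (lt_mem_nhds hd)).exists
  refine ⟨K, h.eventually_le_div_massFn (F := fun N => lexMass α β N
    (List.replicate i (Set.Icc 1 K) ++ longWindow μ ε N :: List.replicate j (Set.Icc 1 K)))
    ?_ hK⟩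
  have h1 := h.localGe_step_long (fun N => h.lexMass_nonneg N _)
    (h.bulkGe_replicate K j) hε
  have h2 := h.localGe_replicate_append (As := fun N => longWindow μ ε N ::
    List.replicate j (Set.Icc 1 K)) K h1 i
  -- The constant `c (1 - μ)^{-s}` of a long step is `1 - μ` times the local limit of `massFn`; this
  -- ratio is the success probability.
  convert h2 using 1
  field_simp

end HeavyTail

/-! ### Power series on a disk -/

theorem hasFPowerSeriesOnBall_of_hasSum {e : ℕ → ℂ} {E : ℂ → ℂ} {R : ℝ} (hR : 0 < R)
    (h : ∀ z : ℂ, ‖z‖ < R → HasSum (fun k => e k * z ^ k) (E z)) :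
    HasFPowerSeriesOnBall E (FormalMultilinearSeries.ofScalars ℂ e) 0 (ENNReal.ofReal R) where
  r_le := by
    refine ENNReal.le_of_forall_nnreal_lt fun r hr => ?_
    have hr' : (r : ℝ) < R := by
      rwa [← ENNReal.ofReal_coe_nnreal, ENNReal.ofReal_lt_ofReal_iff hR] at hr
    have h1 := (h (r : ℂ) (by simpa using hr')).summable.tendsto_atTop_zero.norm
    refine FormalMultilinearSeries.le_radius_of_tendsto _ (l := 0) ?_
    simpa [FormalMultilinearSeries.ofScalars_norm] using h1
  r_pos := ENNReal.ofReal_pos.2 hR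
  hasSum := by
    intro y hy
    rw [Metric.eball_ofReal, mem_ball_zero_iff] at hy
    simpa [FormalMultilinearSeries.ofScalars, zero_add] using! h y hy

theorem coeff_unique {e e' : ℕ → ℂ} {E : ℂ → ℂ} {R : ℝ} (hR : 0 < R)
    (h : ∀ z : ℂ, ‖z‖ < R → HasSum (fun k => e k * z ^ k) (E z))
    (h' : ∀ z : ℂ, ‖z‖ < R → HasSum (fun k => e' k * z ^ k) (E z)) : e = e' :=
  FormalMultilinearSeries.ofScalars_series_injective (𝕜 := ℂ) (E := ℂ)
    (HasFPowerSeriesAt.eq_formalMultilinearSeries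
      (hasFPowerSeriesOnBall_of_hasSum hR h).hasFPowerSeriesAt
      (hasFPowerSeriesOnBall_of_hasSum hR h').hasFPowerSeriesAt)

theorem hasSum_iteratedDeriv_on_ball {f : ℂ → ℂ} {R : ℝ}
    (hf : DifferentiableOn ℂ f (Metric.ball 0 R)) {z : ℂ} (hz : ‖z‖ < R) :
    HasSum (fun k => iteratedDeriv k f 0 / k.factorial * z ^ k) (f z) := by
  have := Complex.hasSum_taylorSeries_on_ball hf (mem_ball_zero_iff.2 hz)
  convert! this using 2 with k
  simp only [sub_zero, smul_eq_mul]
  ring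

theorem analyticOnNhd_iteratedDeriv {f : ℂ → ℂ} {U : Set ℂ} (hU : IsOpen U)
    (hf : DifferentiableOn ℂ f U) (n : ℕ) : AnalyticOnNhd ℂ (iteratedDeriv n f) U := by
  rw [iteratedDeriv_eq_iterate]
  exact (hf.analyticOnNhd hU).iterated_deriv n

theorem hasSum_iteratedDeriv {e : ℕ → ℂ} {f : ℂ → ℂ} {R : ℝ} (hR : 0 < R)
    (h : ∀ z : ℂ, ‖z‖ < R → HasSum (fun k => e k * z ^ k) (f z)) (n : ℕ) {z : ℂ} (hz : ‖z‖ < R) :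
    HasSum (fun k => ((n + k).descFactorial n : ℂ) * e (n + k) * z ^ k) (iteratedDeriv n f z) := by
  have hf : DifferentiableOn ℂ f (Metric.ball 0 R) := by
    have := (hasFPowerSeriesOnBall_of_hasSum hR h).differentiableOn
    rwa [Metric.eball_ofReal] at this
  have h1 := coeff_unique hR h (fun z hz => hasSum_iteratedDeriv_on_ball hf hz)
  have h2 : DifferentiableOn ℂ (iteratedDeriv n f) (Metric.ball 0 R) :=
    (analyticOnNhd_iteratedDeriv Metric.isOpen_ball hf n).differentiableOn
  convert! hasSum_iteratedDeriv_on_ball h2 hz using 2 with k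
  congr 1
  have h3 : iteratedDeriv k (iteratedDeriv n f) = iteratedDeriv (n + k) f := by
    simp only [iteratedDeriv_eq_iterate]
    rw [add_comm n k, Function.iterate_add_apply]
  have h4 : ((n + k).factorial : ℂ) = k.factorial * (n + k).descFactorial n := by
    have := Nat.factorial_mul_descFactorial (Nat.le_add_right n k)
    rw [Nat.add_sub_cancel_left] at this
    exact_mod_cast this.symm
  have hk : (k.factorial : ℂ) ≠ 0 := by exact_mod_cast k.factorial_ne_zero
  have hd : ((n + k).descFactorial n : ℂ) ≠ 0 := by
    intro h0
    rw [h0, mul_zero] at h4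
    exact (n + k).factorial_ne_zero (by exact_mod_cast h4)
  rw [h3, h1]
  simp only
  rw [h4]
  field_simp

/-! ### Singularity analysis -/

/-- The Poisson kernel has circle average one. On the unit circle `|w - ρ| = |1 - ρ w|`, because `w`
times the conjugate of `w - ρ` is `1 - ρ w`. -/
theorem integral_inv_norm_one_sub_circleMap_sq {ρ : ℝ} (h0 : 0 ≤ ρ) (h1 : ρ < 1) :
    ∫ θ in (0 : ℝ)..2 * Real.pi, (‖1 - circleMap 0 ρ θ‖ ^ 2)⁻¹
      = 2 * Real.pi * (1 - ρ ^ 2)⁻¹ := by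
  have hd : DiffContOnCl ℂ (fun _ : ℂ => (1 : ℂ)) (Metric.ball (0 : ℂ) 1) := diffContOnCl_const
  have hρ : (ρ : ℂ) ∈ Metric.ball (0 : ℂ) 1 := by
    rw [mem_ball_zero_iff, Complex.norm_real, Real.norm_eq_abs, abs_of_nonneg h0]
    exact h1
  have h2 : 0 < 1 - ρ ^ 2 := by nlinarith
  have h := hd.circleAverage_poissonKernel_smul' hρ
  rw [Real.circleAverage_def] at h
  have h3 : ∀ θ : ℝ, ‖circleMap 0 1 θ - (ρ : ℂ)‖ = ‖1 - circleMap 0 ρ θ‖ := by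
    intro θ
    have h4 : 1 - circleMap 0 ρ θ
        = circleMap 0 1 θ * (starRingEnd ℂ) (circleMap 0 1 θ - (ρ : ℂ)) := by
      have h5 : circleMap 0 1 θ * (starRingEnd ℂ) (circleMap 0 1 θ) = 1 := by
        rw [Complex.mul_conj, Complex.normSq_eq_norm_sq]
        simp
      rw [map_sub, mul_sub, h5, Complex.conj_ofReal]
      simp [circleMap]
      ring
    rw [h4, norm_mul, Complex.norm_conj]
    simp
  have h4 : ∀ θ : ℝ, ((‖circleMap 0 1 θ - 0‖ ^ 2 - ‖(ρ : ℂ) - 0‖ ^ 2) /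
      ‖circleMap 0 1 θ - 0 - ((ρ : ℂ) - 0)‖ ^ 2) • (1 : ℂ)
      = (((1 - ρ ^ 2) * (‖1 - circleMap 0 ρ θ‖ ^ 2)⁻¹ : ℝ) : ℂ) := by
    intro θ
    rw [sub_zero, sub_zero, h3]
    simp [div_eq_mul_inv]
  simp only [h4] at h
  rw [intervalIntegral.integral_ofReal, intervalIntegral.integral_const_mul] at h
  have h5 : (2 * Real.pi)⁻¹ * ((1 - ρ ^ 2) *
      ∫ θ in (0 : ℝ)..2 * Real.pi, (‖1 - circleMap 0 ρ θ‖ ^ 2)⁻¹) = 1 := by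
    rw [Complex.real_smul] at h
    exact_mod_cast h
  have hpi := Real.pi_pos
  field_simp at h5 ⊢
  linarith

/-- Coefficients of a function of moderate growth at the point `1` of the unit circle. -/
theorem exists_coeff_le_of_norm_le {e : ℕ → ℂ} {E : ℂ → ℂ} {C b : ℝ} (hb : 2 ≤ b)
    (hE : ∀ w : ℂ, ‖w‖ < 1 → HasSum (fun k => e k * w ^ k) (E w))
    (hbound : ∀ w : ℂ, ‖w‖ < 1 → ‖E w‖ ≤ C * ‖1 - w‖ ^ (-b)) :
    ∃ C', ∀ k : ℕ, 2 ≤ k → ‖e k‖ ≤ C' * (k : ℝ) ^ (b - 1) := by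
  have hC : 0 ≤ C := by
    have := (norm_nonneg _).trans (hbound 0 (by simp))
    simpa using this
  refine ⟨C * Real.exp 2, fun k hk => ?_⟩
  have hk0 : (2 : ℝ) ≤ k := by exact_mod_cast hk
  -- On the circle of radius `1 - 1/k` the factor `ρ^{-k}` in Cauchy's estimate stays bounded, while
  -- `|1 - w| ≥ 1/k`.
  set ρ : ℝ := 1 - 1 / k with hρ
  have hk1 : 1 - ρ = 1 / k := by rw [hρ]; ring
  have hkinv : 0 < 1 / (k : ℝ) := by positivity
  have hkhalf : 1 / (k : ℝ) ≤ 1 / 2 := one_div_le_one_div_of_le two_pos hk0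
  have hρ0 : 0 < ρ := by linarith
  have hρ1 : ρ < 1 := by linarith
  have hp := hasFPowerSeriesOnBall_of_hasSum one_pos hE
  have hdiff : DifferentiableOn ℂ E (Metric.ball 0 1) := by
    have := hp.differentiableOn
    rwa [Metric.eball_ofReal] at this
  set r : ℝ≥0 := ⟨ρ, hρ0.le⟩ with hr
  have hsub : Metric.closedBall (0 : ℂ) r ⊆ Metric.ball 0 1 := Metric.closedBall_subset_ball hρ1
  have hc := (hdiff.mono hsub).hasFPowerSeriesOnBall (show 0 < r from hρ0)
  have heq := hp.hasFPowerSeriesAt.eq_formalMultilinearSeries hc.hasFPowerSeriesAt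
  have h1 : ‖e k‖ = ‖cauchyPowerSeries E 0 ρ k‖ := by
    have : ‖FormalMultilinearSeries.ofScalars ℂ e k‖ = ‖e k‖ :=
      FormalMultilinearSeries.ofScalars_norm _ _ _
    rw [← this, heq]
    rfl
  have h2 : ∀ θ : ℝ, ‖E (circleMap 0 ρ θ)‖
      ≤ C * (1 / (k : ℝ)) ^ (2 - b) * (‖1 - circleMap 0 ρ θ‖ ^ 2)⁻¹ := by
    intro θ
    have hn : ‖circleMap 0 ρ θ‖ = ρ := by
      simp [abs_of_pos hρ0]
    have h3 : 1 / (k : ℝ) ≤ ‖1 - circleMap 0 ρ θ‖ := by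
      have := norm_sub_norm_le (1 : ℂ) (circleMap 0 ρ θ)
      rw [hn, norm_one, hk1] at this
      exact this
    have h4 : 0 < ‖1 - circleMap 0 ρ θ‖ := hkinv.trans_le h3
    refine (hbound _ (by rw [hn]; exact hρ1)).trans ?_
    rw [mul_assoc]
    refine mul_le_mul_of_nonneg_left ?_ hC
    -- Two powers are kept for the Poisson integral, which contributes at most `k`; since `b ≥ 2`,
    -- the remaining ones are at most `k^{b-2}` pointwise.
    have h5 : ‖1 - circleMap 0 ρ θ‖ ^ (-b)
        = ‖1 - circleMap 0 ρ θ‖ ^ (2 - b) * (‖1 - circleMap 0 ρ θ‖ ^ 2)⁻¹ := by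
      rw [show -b = (2 - b) - 2 by ring, Real.rpow_sub h4, div_eq_mul_inv]
      norm_num
    rw [h5]
    refine mul_le_mul_of_nonneg_right ?_ (by positivity)
    exact Real.rpow_le_rpow_of_nonpos hkinv h3 (by linarith)
  have hcont1 : Continuous fun θ : ℝ => ‖E (circleMap 0 ρ θ)‖ := by
    refine Continuous.norm ?_
    refine (hdiff.continuousOn.mono hsub).comp_continuous (continuous_circleMap 0 ρ) fun θ => ?_
    exact circleMap_mem_closedBall 0 hρ0.le θ
  have hcont2 : Continuous fun θ : ℝ => (‖1 - circleMap 0 ρ θ‖ ^ 2)⁻¹ := by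
    refine Continuous.inv₀ (by fun_prop) fun θ => ?_
    have hn : ‖circleMap 0 ρ θ‖ = ρ := by simp [abs_of_pos hρ0]
    have h3 : 1 / (k : ℝ) ≤ ‖1 - circleMap 0 ρ θ‖ := by
      have := norm_sub_norm_le (1 : ℂ) (circleMap 0 ρ θ)
      rw [hn, norm_one, hk1] at this
      exact this
    have := hkinv.trans_le h3
    positivity
  have hpi := Real.pi_pos
  have h6 : ∫ θ in (0 : ℝ)..2 * Real.pi, ‖E (circleMap 0 ρ θ)‖
      ≤ C * (1 / (k : ℝ)) ^ (2 - b) * (2 * Real.pi * (1 - ρ ^ 2)⁻¹) := by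
    rw [← integral_inv_norm_one_sub_circleMap_sq hρ0.le hρ1, ← intervalIntegral.integral_const_mul]
    exact intervalIntegral.integral_mono_on (by positivity) (hcont1.intervalIntegrable _ _)
      ((hcont2.const_mul _).intervalIntegrable _ _) fun θ _ => h2 θ
  have h7 : (1 - ρ ^ 2)⁻¹ ≤ (k : ℝ) := by
    rw [inv_le_comm₀ (by nlinarith) (by linarith), ← one_div]
    nlinarith
  have h8 : |ρ|⁻¹ ^ k ≤ Real.exp 2 := by
    rw [abs_of_pos hρ0]
    have h9 : ρ⁻¹ ≤ Real.exp (2 / k) := by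
      have h10 : ρ⁻¹ ≤ 1 + 2 / k := by
        rw [inv_le_iff_one_le_mul₀ hρ0, hρ]
        have : (2 : ℝ) / k = 2 * (1 / k) := by ring
        rw [this]
        nlinarith
      exact h10.trans (by linarith [Real.add_one_le_exp (2 / (k : ℝ))])
    refine (pow_le_pow_left₀ (by positivity) h9 k).trans (le_of_eq ?_)
    rw [← Real.exp_nat_mul]
    congr 1
    field_simp
  rw [h1]
  refine (norm_cauchyPowerSeries_le E 0 ρ k).trans ?_
  have h9 : (2 * Real.pi)⁻¹ * ∫ θ in (0 : ℝ)..2 * Real.pi, ‖E (circleMap 0 ρ θ)‖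
      ≤ C * (k : ℝ) ^ (b - 1) := by
    rw [inv_mul_le_iff₀ (by positivity)]
    refine h6.trans ?_
    have h10 : (1 / (k : ℝ)) ^ (2 - b) * k = (k : ℝ) ^ (b - 1) := by
      rw [one_div, Real.inv_rpow (by linarith), ← Real.rpow_neg (by linarith)]
      nth_rewrite 2 [← Real.rpow_one (k : ℝ)]
      rw [← Real.rpow_add (by linarith)]
      congr 1
      ring
    rw [← h10]
    have h11 : 0 ≤ C * (1 / (k : ℝ)) ^ (2 - b) * (2 * Real.pi) := by positivity
    have h12 := mul_le_mul_of_nonneg_left h7 h11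
    linarith
  refine (mul_le_mul h9 h8 (by positivity) (by positivity)).trans (le_of_eq ?_)
  ring

/-! ### Binomial coefficients, and undoing differentiation of power series -/

theorem ascPochhammer_smeval_eq_prod (r : ℂ) (n : ℕ) :
    (ascPochhammer ℕ n).smeval r = ∏ j ∈ Finset.range n, (r + j) := by
  induction n with
  | zero => simp
  | succ n ih =>
    rw [ascPochhammer_succ_right, Polynomial.smeval_mul, ih, Finset.prod_range_succ]
    simp [Polynomial.smeval_natCast]

/-- The coefficients of `(1 - w)^{-α}`. -/
noncomputable def negBinom (α : ℝ) (k : ℕ) : ℝ := (∏ j ∈ Finset.range k, (α + j)) / k.factorial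

theorem hasSum_negBinom (α : ℝ) {w : ℂ} (hw : ‖w‖ < 1) :
    HasSum (fun k => (negBinom α k : ℂ) * w ^ k) ((1 - w) ^ (-(α : ℂ))) := by
  have h := (Complex.one_div_one_sub_cpow_hasFPowerSeriesOnBall_zero (α : ℂ)).hasSum (y := w) (by
    rw [← ENNReal.ofReal_one, Metric.eball_ofReal]
    simpa using hw)
  simp only [zero_add] at h
  rw [Complex.cpow_neg, ← one_div]
  convert! h using 2 with k
  have h1 : (k.factorial : ℂ) ≠ 0 := by exact_mod_cast k.factorial_ne_zero
  have h2 := Ring.factorial_nsmul_multichoose_eq_ascPochhammer (α : ℂ) k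
  rw [Ring.multichoose_eq, ascPochhammer_smeval_eq_prod, nsmul_eq_mul] at h2
  have h3 : (negBinom α k : ℂ) = Ring.choose ((α : ℂ) + k - 1) k := by
    rw [negBinom]
    push_cast
    rw [← h2]
    field_simp
  rw [h3]
  simp [FormalMultilinearSeries.ofScalars]

/-- This is Euler's limit formula for the Gamma function, up to the factor `k / (k + α)`. -/
theorem tendsto_negBinom {α : ℝ} (hα : 0 < α) :
    Tendsto (fun k : ℕ => negBinom α k / (k : ℝ) ^ (α - 1)) atTop (𝓝 (Real.Gamma α)⁻¹) := by
  have h1 := (Real.GammaSeq_tendsto_Gamma α).inv₀ (Real.Gamma_pos_of_pos hα).ne'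
  have h2 : Tendsto (fun k : ℕ => (k : ℝ) / (k + α)) atTop (𝓝 1) := tendsto_natCast_div_add_atTop α
  have h3 := h2.mul h1
  rw [one_mul] at h3
  refine h3.congr' ?_
  filter_upwards [eventually_gt_atTop 0] with k hk
  have hk' : (0 : ℝ) < k := by exact_mod_cast hk
  have hf : (k.factorial : ℝ) ≠ 0 := by exact_mod_cast k.factorial_ne_zero
  have hp : 0 < ∏ j ∈ Finset.range k, (α + j) := Finset.prod_pos fun j _ => by positivity
  have hka : 0 < (k : ℝ) ^ α := by positivity
  rw [Real.GammaSeq, negBinom, Finset.prod_range_succ, Real.rpow_sub hk', Real.rpow_one]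
  have : 0 < α + k := by positivity
  have : 0 < k + α := by positivity
  field_simp
  ring

/-- Recovers the original coefficients after `n` differentiations: the falling factorial is
asymptotic to `k^n`, and the index shift is harmless since `(n + k) / k → 1`. -/
theorem tendsto_of_tendsto_descFactorial {p : ℕ → ℝ} {n : ℕ} {s c : ℝ}
    (h : Tendsto (fun k : ℕ => ((n + k).descFactorial n : ℝ) * p (n + k) / (k : ℝ) ^ (n - s - 1))
      atTop (𝓝 c)) : Tendsto (fun j : ℕ => p j * (j : ℝ) ^ (s + 1)) atTop (𝓝 c) := by
  have hratio : Tendsto (fun k : ℕ => ((n : ℝ) + k) / k) atTop (𝓝 1) := by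
    have h1 := (tendsto_const_div_atTop_nhds_zero_nat (n : ℝ)).add_const 1
    rw [zero_add] at h1
    refine h1.congr' ?_
    filter_upwards [eventually_gt_atTop 0] with k hk
    have hk' : (k : ℝ) ≠ 0 := by exact_mod_cast hk.ne'
    field_simp
  have hdesc : Tendsto (fun k : ℕ => ((n + k).descFactorial n : ℝ) / (k : ℝ) ^ n) atTop (𝓝 1) := by
    have h2 := hratio.pow n
    rw [one_pow] at h2
    refine tendsto_of_tendsto_of_tendsto_of_le_of_le' tendsto_const_nhds h2 ?_ ?_
    · filter_upwards [eventually_gt_atTop 0] with k hk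
      have hk' : (0 : ℝ) < k := by exact_mod_cast hk
      rw [le_div_iff₀ (by positivity), one_mul]
      have h3 := Nat.pow_sub_le_descFactorial (n + k) n
      rw [show n + k + 1 - n = k + 1 by omega] at h3
      have h4 : k ^ n ≤ (n + k).descFactorial n := (Nat.pow_le_pow_left (Nat.le_succ k) n).trans h3
      exact_mod_cast h4
    · filter_upwards [eventually_gt_atTop 0] with k hk
      rw [div_pow]
      refine div_le_div_of_nonneg_right ?_ (by positivity)
      exact_mod_cast Nat.descFactorial_le_pow (n + k) n
  have h1 := (h.mul (hdesc.inv₀ one_ne_zero)).mul (hratio.rpow_const (p := s + 1) (Or.inl one_ne_zero))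
  rw [inv_one, mul_one, Real.one_rpow, mul_one] at h1
  rw [← tendsto_add_atTop_iff_nat n]
  refine h1.congr' ?_
  filter_upwards [eventually_gt_atTop 0] with k hk
  have hk' : (0 : ℝ) < k := by exact_mod_cast hk
  have hd : ((n + k).descFactorial n : ℝ) ≠ 0 := by
    exact_mod_cast (Nat.pos_of_ne_zero fun h0 => by
      rw [Nat.descFactorial_eq_zero_iff_lt] at h0; omega).ne'
  have hnk : (0 : ℝ) < n + k := by positivity
  rw [add_comm k n, Real.div_rpow hnk.le hk'.le, show (n : ℝ) - s - 1 = n - (s + 1) by ring,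
    Real.rpow_sub hk', Real.rpow_natCast]
  have h3 : 0 < (k : ℝ) ^ (s + 1) := by positivity
  push_cast
  field_simp

/-! ### The domain of holomorphy -/

/-- Replacing the argument by its cosine gives a condition continuous in `z`, whence openness; the
strict inequality already excludes `z = R`. -/
theorem mem_deltaDomain_iff {R η φ : ℝ} (hφ : 0 < φ) (hφ' : φ < Real.pi / 2) {z : ℂ} :
    z ∈ deltaDomain R η φ ↔ ‖z‖ < ‖(R : ℂ) * (1 + η * Complex.exp (φ * Complex.I))‖ ∧
      (z - R).re < Real.cos φ * ‖z - R‖ := by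
  have hpi := Real.pi_pos
  refine and_congr_right fun _ => ?_
  by_cases hz : z = R
  · simp [hz]
  have hz' : z - R ≠ 0 := sub_ne_zero.2 hz
  have h1 : φ < |Complex.arg (z - R)| ↔ Real.cos |Complex.arg (z - R)| < Real.cos φ :=
    (Real.strictAntiOn_cos.lt_iff_gt ⟨abs_nonneg _, Complex.abs_arg_le_pi _⟩
      ⟨hφ.le, by linarith⟩).symm
  rw [Real.cos_abs, Complex.cos_arg hz', div_lt_iff₀ (norm_pos_iff.2 hz')] at h1
  simp only [ne_eq, hz, not_false_eq_true, true_and, h1]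

theorem isOpen_deltaDomain {R η φ : ℝ} (hφ : 0 < φ) (hφ' : φ < Real.pi / 2) :
    IsOpen (deltaDomain R η φ) := by
  have : deltaDomain R η φ = {z : ℂ | ‖z‖ < ‖(R : ℂ) * (1 + η * Complex.exp (φ * Complex.I))‖ ∧
      (z - R).re < Real.cos φ * ‖z - R‖} := Set.ext fun z => mem_deltaDomain_iff hφ hφ'
  rw [this]
  refine IsOpen.and (isOpen_lt (by fun_prop) (by fun_prop)) (isOpen_lt ?_ (by fun_prop))
  exact Complex.continuous_re.comp (by fun_prop)

/-- The closed disk lies in the half-plane `Re z ≤ R` and touches its boundary only at `R`. The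
coefficient estimates below use no other part of `Δ₀`. -/
theorem mem_deltaDomain_of_norm_le {R η φ : ℝ} (hR : 0 < R) (hη : 0 < η) (hφ : 0 < φ)
    (hφ' : φ < Real.pi / 2) {z : ℂ} (hz : ‖z‖ ≤ R) (hzR : z ≠ R) : z ∈ deltaDomain R η φ := by
  have hcos : 0 < Real.cos φ := Real.cos_pos_of_mem_Ioo ⟨by linarith, hφ'⟩
  rw [mem_deltaDomain_iff hφ hφ']
  refine ⟨hz.trans_lt ?_, ?_⟩
  · refine lt_of_lt_of_le ?_ (Complex.re_le_norm _)
    rw [Complex.re_ofReal_mul, Complex.add_re, Complex.one_re, Complex.re_ofReal_mul,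
      Complex.exp_ofReal_mul_I_re]
    have := mul_pos hR (mul_pos hη hcos)
    linarith
  · have h1 : z.re ≤ R := (Complex.re_le_norm z).trans hz
    have h2 : z.re ≠ R := by
      intro h
      refine hzR (Complex.ext (by simpa using h) ?_)
      have h3 := Complex.sq_norm z
      rw [Complex.normSq_apply, h] at h3
      have h4 : ‖z‖ ^ 2 ≤ R ^ 2 := pow_le_pow_left₀ (norm_nonneg _) hz 2
      have h5 : z.im * z.im ≤ 0 := by nlinarith
      simpa using mul_self_eq_zero.1 (le_antisymm h5 (mul_self_nonneg _))
    have h3 : (z - R).re < 0 := by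
      rw [Complex.sub_re, Complex.ofReal_re]
      exact sub_neg.2 (lt_of_le_of_ne h1 h2)
    exact h3.trans_le (by positivity)

/-- By compactness the function is holomorphic on a larger disk, so `e_j R^j` decays geometrically.
-/
theorem exists_coeff_mul_rpow_le_of_analyticAt {e : ℕ → ℂ} {g : ℂ → ℂ} {R : ℝ} (hR : 0 < R)
    (hg : ∀ z : ℂ, ‖z‖ < R → HasSum (fun j => e j * z ^ j) (g z))
    (han : ∀ z : ℂ, ‖z‖ ≤ R → AnalyticAt ℂ g z) (t : ℝ) :
    ∃ C, ∀ j : ℕ, ‖e j‖ * R ^ j * (j : ℝ) ^ t ≤ C := by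
  obtain ⟨δ, hδ, hsub⟩ := (isCompact_closedBall (0 : ℂ) R).exists_thickening_subset_open
    (isOpen_analyticAt ℂ g) fun z hz => han z (mem_closedBall_zero_iff.1 hz)
  rw [thickening_closedBall hδ hR.le] at hsub
  have hd : DifferentiableOn ℂ g (Metric.ball 0 (R + δ)) := fun z hz =>
    (hsub (by rwa [add_comm] at hz)).differentiableAt.differentiableWithinAt
  have he := coeff_unique hR hg fun z hz =>
    hasSum_iteratedDeriv_on_ball hd (hz.trans (by linarith))
  set r : ℝ := R + δ / 2 with hr
  have hr0 : 0 < r := by positivity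
  have h1 : Tendsto (fun j : ℕ => ‖e j‖ * r ^ j) atTop (𝓝 0) := by
    have h2 : Summable fun j => e j * (r : ℂ) ^ j := by
      rw [he]
      refine (hasSum_iteratedDeriv_on_ball hd ?_).summable
      rw [Complex.norm_real, Real.norm_eq_abs, abs_of_pos hr0]
      linarith
    have := h2.tendsto_atTop_zero.norm
    simpa [abs_of_pos hr0] using this
  obtain ⟨k, hk⟩ := exists_nat_ge t
  have h3 : Tendsto (fun j : ℕ => (j : ℝ) ^ k * (R / r) ^ j) atTop (𝓝 0) := by
    refine tendsto_pow_const_mul_const_pow_of_abs_lt_one k ?_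
    rw [abs_of_pos (by positivity), div_lt_one hr0]
    linarith
  have h4 := h1.mul h3
  rw [mul_zero] at h4
  obtain ⟨C, hC⟩ := h4.bddAbove_range
  -- The index `0` is treated apart because `0 ^ t` need not be at most `0 ^ k`.
  refine ⟨max C (‖e 0‖ * (0 : ℝ) ^ t), fun j => ?_⟩
  rcases Nat.eq_zero_or_pos j with rfl | hj
  · simp
  refine le_trans ?_ ((hC ⟨j, rfl⟩).trans (le_max_left _ _))
  have hj' : (1 : ℝ) ≤ j := by exact_mod_cast hj
  have h5 : (j : ℝ) ^ t ≤ (j : ℝ) ^ k := by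
    rw [← Real.rpow_natCast]
    exact Real.rpow_le_rpow_of_exponent_le hj' hk
  calc ‖e j‖ * R ^ j * (j : ℝ) ^ t ≤ ‖e j‖ * R ^ j * (j : ℝ) ^ k := by gcongr
    _ = _ := by
      simp only [div_pow]
      field_simp

/-! ### The tail of the coefficients -/

theorem norm_genCoeff (x : ℕ → ℝ≥0) (j : ℕ) : ‖genCoeff x j‖ = (x j : ℝ) / j := by
  simp [genCoeff]

theorem singularExpansion_of_le {R s a : ℝ} {b : ℕ → ℝ} {n : ℕ} (h : ⌈s⌉₊ ≤ n) (z : ℂ) :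
    singularExpansion R s a b n z = (z / R) ^ n *
      (((Real.Gamma (-s + n) * a / Real.Gamma (-s) : ℝ) : ℂ) * (1 - z / R) ^ (-((n - s : ℝ) : ℂ))) := by
  rw [singularExpansion, Finset.Ico_eq_empty (by omega), Finset.sum_empty, zero_add,
    ← Complex.ofReal_neg, neg_sub]

/-- Away from its singularity at `1`, a function is bounded. -/
theorem exists_norm_le_of_singularity {D : ℂ → ℂ} {b C : ℝ} (hb : 0 ≤ b)
    (hcont : ∀ w : ℂ, ‖w‖ ≤ 1 → w ≠ 1 → ContinuousAt D w)
    (hnear : ∀ᶠ w in 𝓝 (1 : ℂ), ‖w‖ < 1 → ‖D w‖ ≤ C * ‖1 - w‖ ^ (-b)) :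
    ∃ C', ∀ w : ℂ, ‖w‖ < 1 → ‖D w‖ ≤ C' * ‖1 - w‖ ^ (-b) := by
  obtain ⟨ε, hε, hball⟩ := Metric.eventually_nhds_iff_ball.1 hnear
  have hcomp : IsCompact (Metric.closedBall (0 : ℂ) 1 \ Metric.ball 1 ε) :=
    (isCompact_closedBall _ _).diff Metric.isOpen_ball
  have hco : ContinuousOn D (Metric.closedBall (0 : ℂ) 1 \ Metric.ball 1 ε) := fun w hw =>
    (hcont w (mem_closedBall_zero_iff.1 hw.1) fun h => hw.2 (by simp [h, hε])).continuousWithinAt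
  obtain ⟨M, hM⟩ := hcomp.exists_bound_of_continuousOn hco
  refine ⟨max C (M * 2 ^ b), fun w hw => ?_⟩
  have hw1 : 0 < ‖1 - w‖ := norm_pos_iff.2 (sub_ne_zero.2 fun h => by simp [← h] at hw)
  by_cases hwε : w ∈ Metric.ball 1 ε
  · exact (hball w hwε hw).trans (mul_le_mul_of_nonneg_right (le_max_left _ _) (by positivity))
  · have h1 := hM w ⟨mem_closedBall_zero_iff.2 hw.le, hwε⟩
    have hM0 : 0 ≤ M := (norm_nonneg _).trans h1
    have h2 : ‖1 - w‖ ≤ 2 := (norm_sub_le _ _).trans (by rw [norm_one]; linarith)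
    have h3 : (2 : ℝ) ^ (-b) ≤ ‖1 - w‖ ^ (-b) :=
      Real.rpow_le_rpow_of_nonpos hw1 h2 (by linarith)
    calc ‖D w‖ ≤ M := h1
      _ = M * 2 ^ b * 2 ^ (-b) := by
        rw [mul_assoc, ← Real.rpow_add two_pos, add_neg_cancel, Real.rpow_zero, mul_one]
      _ ≤ M * 2 ^ b * ‖1 - w‖ ^ (-b) := by gcongr
      _ ≤ _ := mul_le_mul_of_nonneg_right (le_max_right _ _) (by positivity)

/-- The binomial series of `A (1 - w)^{-α}` carries the asymptotics. The difference is smaller by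
`|1 - w|^δ` near `1` and bounded elsewhere, so its coefficients are `O(k^{α - δ - 1})`. -/
theorem tendsto_coeff_of_singularity {d : ℕ → ℝ} {D : ℂ → ℂ} {A α δ C : ℝ} (hα : 3 ≤ α) (hδ : 0 < δ)
    (hD : ∀ w : ℂ, ‖w‖ < 1 → HasSum (fun k => (d k : ℂ) * w ^ k) (D w))
    (hcont : ∀ w : ℂ, ‖w‖ ≤ 1 → w ≠ 1 → ContinuousAt D w)
    (hnear : ∀ᶠ w in 𝓝 (1 : ℂ), ‖w‖ < 1 →
      ‖D w - A * (1 - w) ^ (-(α : ℂ))‖ ≤ C * ‖1 - w‖ ^ (-α + δ)) :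
    Tendsto (fun k : ℕ => d k / (k : ℝ) ^ (α - 1)) atTop (𝓝 (A / Real.Gamma α)) := by
  -- This keeps the remainder exponent `α - δ` at least `2`, as the coefficient estimate demands.
  wlog hδ1 : δ ≤ 1 generalizing δ C with H
  · refine H (C := max C 0) one_pos ?_ le_rfl
    have hev : ∀ᶠ w in 𝓝 (1 : ℂ), ‖1 - w‖ < 1 := by
      have : ContinuousAt (fun w : ℂ => ‖1 - w‖) 1 := by fun_prop
      exact this.eventually_lt continuousAt_const (by simp)
    filter_upwards [hnear, hev] with w h1 h2 hw
    have hw1 : 0 < ‖1 - w‖ := norm_pos_iff.2 (sub_ne_zero.2 fun h => by simp [← h] at hw)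
    refine (h1 hw).trans ?_
    refine (mul_le_mul_of_nonneg_right (le_max_left C 0) (by positivity)).trans ?_
    refine mul_le_mul_of_nonneg_left ?_ (le_max_right _ _)
    exact Real.rpow_le_rpow_of_exponent_ge hw1 h2.le (by linarith)
  set E : ℂ → ℂ := fun w => D w - A * (1 - w) ^ (-(α : ℂ)) with hE
  have hEs : ∀ w : ℂ, ‖w‖ < 1 →
      HasSum (fun k => ((d k - A * negBinom α k : ℝ) : ℂ) * w ^ k) (E w) := by
    intro w hw
    have := (hD w hw).sub ((hasSum_negBinom α hw).mul_left (A : ℂ))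
    convert! this using 2 with k
    push_cast
    ring
  have hEc : ∀ w : ℂ, ‖w‖ ≤ 1 → w ≠ 1 → ContinuousAt E w := by
    intro w hw hw1
    refine (hcont w hw hw1).sub (continuousAt_const.mul ?_)
    refine ContinuousAt.cpow (by fun_prop) continuousAt_const ?_
    rw [Complex.mem_slitPlane_iff]
    by_contra! hcon
    have h1 : w.im = 0 := by simpa using hcon.2
    have h2 : 1 ≤ w.re := by simpa using hcon.1
    have h3 : w.re ≤ 1 := (Complex.re_le_norm w).trans hw
    exact hw1 (Complex.ext (by simp; linarith) (by simp [h1]))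
  obtain ⟨C', hC'⟩ := exists_norm_le_of_singularity (b := α - δ) (by linarith) hEc (by
    simpa only [neg_sub, neg_add_eq_sub] using hnear)
  obtain ⟨C'', hC''⟩ := exists_coeff_le_of_norm_le (by linarith) hEs hC'
  have h1 : Tendsto (fun k : ℕ => (d k - A * negBinom α k) / (k : ℝ) ^ (α - 1)) atTop (𝓝 0) := by
    have h2 : Tendsto (fun k : ℕ => C'' * (k : ℝ) ^ (-δ)) atTop (𝓝 (C'' * 0)) :=
      ((tendsto_rpow_neg_atTop hδ).comp tendsto_natCast_atTop_atTop).const_mul _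
    rw [mul_zero] at h2
    refine squeeze_zero_norm' ?_ h2
    filter_upwards [eventually_ge_atTop 2] with k hk
    have hk' : (0 : ℝ) < k := by exact_mod_cast (by omega : 0 < k)
    have h3 := hC'' k hk
    rw [Complex.norm_real] at h3
    rw [norm_div, Real.norm_of_nonneg (by positivity : 0 ≤ (k : ℝ) ^ (α - 1)),
      div_le_iff₀ (by positivity), mul_assoc, ← Real.rpow_add hk',
      show -δ + (α - 1) = α - δ - 1 by ring]
    exact h3
  have h2 := ((tendsto_negBinom (α := α) (by linarith)).const_mul A).add h1
  rw [add_zero, ← div_eq_mul_inv] at h2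
  refine h2.congr fun k => ?_
  ring

theorem tendsto_coeff_of_singularExpansion {e : ℕ → ℝ} {g : ℂ → ℂ} {R η φ s a : ℝ} {b : ℕ → ℝ}
    (hR : 0 < R) (hη : 0 < η) (hφ : 0 < φ) (hφ' : φ < Real.pi / 2)
    (hg : ∀ z : ℂ, ‖z‖ < R → HasSum (fun j => (e j : ℂ) * z ^ j) (g z))
    (hol : DifferentiableOn ℂ g (deltaDomain R η φ))
    (hexp : ∀ n : ℕ, ∃ δ : ℝ, 0 < δ ∧
      (fun z : ℂ => modDeriv n g z - singularExpansion R s a b n z)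
        =O[𝓝[deltaDomain R η φ] (R : ℂ)] (fun z : ℂ => ‖1 - z / (R : ℂ)‖ ^ (s - n + δ))) :
    Tendsto (fun j : ℕ => e j * R ^ j * (j : ℝ) ^ (s + 1)) atTop (𝓝 (a / Real.Gamma (-s))) := by
  have hRc : (R : ℂ) ≠ 0 := by exact_mod_cast hR.ne'
  -- After this many derivatives the polynomial part of the expansion is empty and the singular
  -- exponent `n - s` is at least `3`.
  set n : ℕ := ⌈s⌉₊ + 3 with hn
  have hα : 3 ≤ (n : ℝ) - s := by
    have := Nat.le_ceil s
    rw [hn]; push_cast; linarith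
  obtain ⟨δ, hδ, hO⟩ := hexp n
  obtain ⟨C, hC⟩ := hO.bound
  have key := tendsto_coeff_of_singularity (d := fun k => ((n + k).descFactorial n : ℝ) *
      (e (n + k) * R ^ (n + k))) (D := fun w => R ^ n * iteratedDeriv n g (R * w))
      (A := Real.Gamma (-s + n) * a / Real.Gamma (-s)) (α := n - s) (δ := δ) (C := C * 2 ^ n)
      hα hδ ?_ ?_ ?_
  · have hG : Real.Gamma (n - s) ≠ 0 := (Real.Gamma_pos_of_pos (by linarith)).ne'
    have hval : Real.Gamma (-s + n) * a / Real.Gamma (-s) / Real.Gamma (n - s)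
        = a / Real.Gamma (-s) := by
      rw [neg_add_eq_sub]
      field_simp
    rw [hval] at key
    exact tendsto_of_tendsto_descFactorial key
  · intro w hw
    have hz : ‖(R : ℂ) * w‖ < R := by
      rw [norm_mul, Complex.norm_real, Real.norm_of_nonneg hR.le]
      nlinarith
    convert! (hasSum_iteratedDeriv hR hg n hz).mul_left ((R : ℂ) ^ n) using 2 with k
    push_cast
    ring
  · intro w hw hw1
    have hz : (R : ℂ) * w ∈ deltaDomain R η φ := by
      refine mem_deltaDomain_of_norm_le hR hη hφ hφ' ?_ ?_
      · rw [norm_mul, Complex.norm_real, Real.norm_of_nonneg hR.le]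
        nlinarith
      · intro h
        exact hw1 (mul_left_cancel₀ hRc (by rw [h, mul_one]))
    have h1 := (analyticOnNhd_iteratedDeriv (isOpen_deltaDomain hφ hφ') hol n _ hz).continuousAt
    exact continuousAt_const.mul (ContinuousAt.comp' h1 (by fun_prop))
  · rw [eventually_nhdsWithin_iff] at hC
    have hmap : Tendsto (fun w : ℂ => (R : ℂ) * w) (𝓝 1) (𝓝 (R : ℂ)) := by
      have : ContinuousAt (fun w : ℂ => (R : ℂ) * w) 1 := by fun_prop
      simpa [ContinuousAt] using this
    -- The modified derivative carries an extra factor `w^n`; dividing it out near `1` costs at most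
    -- `2^n`.
    have hhalf : ∀ᶠ w in 𝓝 (1 : ℂ), 1 / 2 < ‖w‖ := by
      have : ContinuousAt (fun w : ℂ => ‖w‖) 1 := by fun_prop
      exact continuousAt_const.eventually_lt this (by norm_num)
    filter_upwards [hmap.eventually hC, hhalf] with w h1 h2 hw
    have hw1 : w ≠ 1 := fun h => by simp [h] at hw
    have hmem : (R : ℂ) * w ∈ deltaDomain R η φ := by
      refine mem_deltaDomain_of_norm_le hR hη hφ hφ' ?_ ?_
      · rw [norm_mul, Complex.norm_real, Real.norm_of_nonneg hR.le]
        nlinarith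
      · intro h
        exact hw1 (mul_left_cancel₀ hRc (by rw [h, mul_one]))
    have h3 := h1 hmem
    rw [singularExpansion_of_le (by omega), modDeriv, mul_div_cancel_left₀ _ hRc, mul_pow] at h3
    rw [mul_comm ((R : ℂ) ^ n), mul_assoc, ← mul_sub, norm_mul, norm_pow, Real.norm_of_nonneg
      (by positivity), show s - n + δ = -(n - s) + δ by ring] at h3
    have h4 : (1 / 2 : ℝ) ^ n ≤ ‖w‖ ^ n := pow_le_pow_left₀ (by norm_num) h2.le n
    have h5 := (mul_le_mul_of_nonneg_right h4 (norm_nonneg _)).trans h3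
    rw [one_div, inv_pow, inv_mul_le_iff₀ (by positivity)] at h5
    refine h5.trans (le_of_eq ?_)
    ring

/-! ### Scaled weights -/

/-- The weights `x_j R^j`, `j ≥ 1`. -/
noncomputable def scaledCoeff (x : ℕ → ℝ≥0) (R : ℝ) (j : ℕ) : ℝ := if j = 0 then 0 else x j * R ^ j

theorem scaledCoeff_nonneg (x : ℕ → ℝ≥0) {R : ℝ} (hR : 0 < R) (j : ℕ) : 0 ≤ scaledCoeff x R j := by
  rw [scaledCoeff]
  split_ifs
  · exact le_rfl
  · positivity

theorem scaledCoeff_of_ne_zero (x : ℕ → ℝ≥0) (R : ℝ) {j : ℕ} (hj : j ≠ 0) :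
    scaledCoeff x R j = x j * R ^ j := if_neg hj

theorem scaledCoeff_mul_rpow (x : ℕ → ℝ≥0) (R s : ℝ) (j : ℕ) :
    scaledCoeff x R j * (j : ℝ) ^ s = (x j : ℝ) / j * R ^ j * (j : ℝ) ^ (s + 1) := by
  rcases Nat.eq_zero_or_pos j with rfl | hj
  · simp [scaledCoeff]
  · have hj' : (0 : ℝ) < j := by exact_mod_cast hj
    rw [scaledCoeff_of_ne_zero x R hj.ne', Real.rpow_add_one hj'.ne']
    field_simp

/-- The tail asymptotics give summability; Abel's theorem then identifies the sum with the boundary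
value of `z g'(z)`, whose coefficients are the `κ_j`. -/
theorem hasSum_scaledCoeff {κ : ℕ → ℝ≥0} {g : ℂ → ℂ} {R s c μ : ℝ} (hR : 0 < R) (hs : 1 < s)
    (hg : ∀ z : ℂ, ‖z‖ < R → HasSum (fun j : ℕ => genCoeff κ j * z ^ j) (g z))
    (hc : Tendsto (fun l : ℕ => scaledCoeff κ R l * (l : ℝ) ^ s) atTop (𝓝 c))
    (hμ : Tendsto (fun r : ℝ => (modDeriv 1 g (r : ℂ)).re) (𝓝[<] R) (𝓝 μ)) :
    HasSum (scaledCoeff κ R) μ := by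
  have hsum : Summable (scaledCoeff κ R) := by
    obtain ⟨C, hC⟩ := hc.bddAbove_range
    refine Summable.of_nonneg_of_le (scaledCoeff_nonneg κ hR) (fun l => ?_)
      ((Real.summable_nat_rpow.2 (by linarith : -s < -1)).mul_left C)
    rcases Nat.eq_zero_or_pos l with rfl | hl
    · rw [scaledCoeff, if_pos rfl, Nat.cast_zero, Real.zero_rpow (by linarith), mul_zero]
    · have hl' : (0 : ℝ) < l := by exact_mod_cast hl
      rw [Real.rpow_neg hl'.le, ← div_eq_mul_inv, le_div_iff₀ (by positivity)]
      exact hC ⟨l, rfl⟩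
  have h1 := Real.tendsto_tsum_powerSeries_nhdsWithin_lt hsum.hasSum.tendsto_sum_nat
  have h2 : Tendsto (fun r : ℝ => r / R) (𝓝[<] R) (𝓝[<] 1) := by
    refine tendsto_nhdsWithin_iff.2 ⟨?_, ?_⟩
    · have : ContinuousAt (fun r : ℝ => r / R) R := by fun_prop
      have := this.tendsto
      rw [div_self hR.ne'] at this
      exact this.mono_left nhdsWithin_le_nhds
    · filter_upwards [self_mem_nhdsWithin] with r hr
      exact (div_lt_one hR).2 hr
  have h3 : (fun r : ℝ => ∑' n, scaledCoeff κ R n * (r / R) ^ n) =ᶠ[𝓝[<] R]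
      fun r : ℝ => (modDeriv 1 g (r : ℂ)).re := by
    filter_upwards [Ioo_mem_nhdsLT hR] with r hr
    have hrn : ‖(r : ℂ)‖ < R := by
      rw [Complex.norm_real, Real.norm_of_nonneg hr.1.le]
      exact hr.2
    have h4 := (hasSum_iteratedDeriv hR hg 1 hrn).mul_left ((r : ℂ) ^ 1)
    have h5 : HasSum (fun k : ℕ => ((scaledCoeff κ R (k + 1) * (r / R) ^ (k + 1) : ℝ) : ℂ))
        (modDeriv 1 g r) := by
      rw [modDeriv]
      convert! h4 using 2 with k
      rw [Nat.descFactorial_one, add_comm 1 k, scaledCoeff_of_ne_zero κ R k.succ_ne_zero, genCoeff]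
      have h6 : ((k + 1 : ℕ) : ℂ) ≠ 0 := by exact_mod_cast k.succ_ne_zero
      have h7 : (R : ℂ) ≠ 0 := by exact_mod_cast hR.ne'
      rw [div_pow]
      push_cast at h6 ⊢
      field_simp
      ring
    have h6 := Complex.reCLM.hasSum h5
    simp only [Complex.reCLM_apply, Complex.ofReal_re] at h6
    have h7 := (hasSum_nat_add_iff (f := fun n => scaledCoeff κ R n * (r / R) ^ n) 1).1 h6
    simp only [Finset.range_one, Finset.sum_singleton, pow_zero, mul_one] at h7
    rw [show scaledCoeff κ R 0 = 0 from if_pos rfl, add_zero] at h7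
    exact h7.tsum_eq
  have h4 : ∑' l, scaledCoeff κ R l = μ :=
    tendsto_nhds_unique ((h1.comp h2).congr' h3) hμ
  rw [← h4]
  exact hsum.hasSum

theorem heavyTail_scaledCoeff {θ κ : ℕ → ℝ≥0} {R η φ s a : ℝ} {b : ℕ → ℝ} {gθ gκ : ℂ → ℂ}
    (hR : 0 < R) (hη : 0 < η) (hφ : 0 < φ) (hφ' : φ < Real.pi / 2)
    (hgθ : ∀ z : ℂ, ‖z‖ < R → HasSum (fun j : ℕ => genCoeff θ j * z ^ j) (gθ z))
    (hgκ : ∀ z : ℂ, ‖z‖ < R → HasSum (fun j : ℕ => genCoeff κ j * z ^ j) (gκ z))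
    (hgθ_hol : DifferentiableOn ℂ gθ (deltaDomain R η φ))
    (hgκ_hol : DifferentiableOn ℂ gκ (deltaDomain R η φ))
    (hgθ_reg : AnalyticAt ℂ gθ (R : ℂ)) (hs : 1 < s) (hs' : ∀ k : ℕ, s ≠ k)
    (hb : Tendsto (fun r : ℝ => (modDeriv 1 gκ (r : ℂ)).re) (𝓝[<] R) (𝓝 (b 1)))
    (ha : a ≠ 0)
    (hexp : ∀ n : ℕ, ∃ δ : ℝ, 0 < δ ∧
      (fun z : ℂ => modDeriv n gκ z - singularExpansion R s a b n z)
        =O[𝓝[deltaDomain R η φ] (R : ℂ)] (fun z : ℂ => ‖1 - z / (R : ℂ)‖ ^ (s - n + δ)))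
    (hsuper : b 1 < 1) :
    HeavyTail (scaledCoeff θ R) (scaledCoeff κ R) s (a / Real.Gamma (-s)) (b 1) := by
  have hgκ' : ∀ z : ℂ, ‖z‖ < R → HasSum (fun j : ℕ => (((κ j : ℝ) / j : ℝ) : ℂ) * z ^ j) (gκ z) := by
    intro z hz
    convert! hgκ z hz using 4
    rw [genCoeff]
    push_cast
    rfl
  have htend : Tendsto (fun l : ℕ => scaledCoeff κ R l * (l : ℝ) ^ s) atTop
      (𝓝 (a / Real.Gamma (-s))) := by
    simp only [scaledCoeff_mul_rpow κ R s]
    exact tendsto_coeff_of_singularExpansion hR hη hφ hφ' hgκ' hgκ_hol hexp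
  have hΓ : Real.Gamma (-s) ≠ 0 := Real.Gamma_ne_zero fun k h => hs' k (neg_injective h)
  refine ⟨scaledCoeff_nonneg θ hR, scaledCoeff_nonneg κ hR, if_pos rfl, if_pos rfl, hs, ?_, htend, ?_,
    hasSum_scaledCoeff hR hs hgκ htend hb, hsuper⟩
  -- As a limit of nonnegative terms the constant `c` is nonnegative, and it is nonzero because `a ≠
  -- 0` and `Γ(-s) ≠ 0` for non-integer `s`.
  · refine lt_of_le_of_ne (ge_of_tendsto' htend fun l => ?_) (div_ne_zero ha hΓ).symm
    exact mul_nonneg (scaledCoeff_nonneg κ hR l) (by positivity)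
  · obtain ⟨C, hC⟩ := exists_coeff_mul_rpow_le_of_analyticAt hR hgθ (fun z hz => by
      by_cases hzR : z = R
      · rwa [hzR]
      · exact hgθ_hol.analyticAt ((isOpen_deltaDomain hφ hφ').mem_nhds
          (mem_deltaDomain_of_norm_le hR hη hφ hφ' hz hzR))) (s + 1)
    refine ⟨C, fun l => ?_⟩
    rw [scaledCoeff_mul_rpow θ R s, ← norm_genCoeff]
    exact hC l

/-! ### Invariance of the probabilities under geometric rescaling of the weights -/

theorem cycleStep_scale {x y f g : ℕ → ℝ} {r : ℝ} (hxy : ∀ l, l ≠ 0 → y l = x l * r ^ l) (A : Set ℕ)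
    {n : ℕ} (hfg : ∀ m < n, g m = f m * r ^ m) : cycleStep y A g n = cycleStep x A f n * r ^ n := by
  classical
  rw [cycleStep, cycleStep, div_mul_eq_mul_div, Finset.sum_mul]
  congr 1
  refine Finset.sum_congr rfl fun l hl => ?_
  simp only [Finset.mem_filter, Finset.mem_Icc] at hl
  have h1 : r ^ n = r ^ l * r ^ (n - l) := by rw [← pow_add, Nat.add_sub_cancel' hl.1.2]
  rw [hxy l (by omega), hfg (n - l) (by omega), h1]
  ring

theorem expCoeff_scale {x y : ℕ → ℝ} {r : ℝ} (hxy : ∀ l, l ≠ 0 → y l = x l * r ^ l) (n : ℕ) :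
    expCoeff y n = expCoeff x n * r ^ n := by
  induction n using Nat.strong_induction_on with
  | _ n ih =>
    rcases eq_or_ne n 0 with rfl | hn
    · simp [expCoeff]
    · rw [expCoeff_eq_cycleStep y hn, expCoeff_eq_cycleStep x hn]
      exact cycleStep_scale hxy _ ih

theorem lexCoeff_scale {x y : ℕ → ℝ} {r : ℝ} (hxy : ∀ l, l ≠ 0 → y l = x l * r ^ l)
    (As : List (Set ℕ)) (n : ℕ) : lexCoeff y As n = lexCoeff x As n * r ^ n := by
  induction As generalizing n with
  | nil => exact expCoeff_scale hxy n
  | cons A As ih => exact cycleStep_scale hxy A fun m _ => ih m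

theorem affineWeight_scaledCoeff (θ κ : ℕ → ℝ≥0) (R : ℝ) (N : ℕ) {l : ℕ} (hl : l ≠ 0) :
    affineWeight (scaledCoeff θ R) (scaledCoeff κ R) N l = cycleWeight θ κ N l * R ^ l := by
  rw [affineWeight, scaledCoeff_of_ne_zero θ R hl, scaledCoeff_of_ne_zero κ R hl, cycleWeight]
  ring

/-- Numerator and denominator both pick up `R^N` from the rescaling and the same total mass from the
normalization, so the ratio is unchanged. -/
theorem lexCoeff_div_expCoeff (θ κ : ℕ → ℝ≥0) {R : ℝ} (hR : 0 < R) {N : ℕ}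
    (hN : massFn (scaledCoeff θ R) (scaledCoeff κ R) N N ≠ 0) (As : List (Set ℕ)) :
    lexCoeff (cycleWeight θ κ N) As N / expCoeff (cycleWeight θ κ N) N
      = lexMass (scaledCoeff θ R) (scaledCoeff κ R) N As N
        / massFn (scaledCoeff θ R) (scaledCoeff κ R) N N := by
  have hsc := fun l (hl : l ≠ 0) => affineWeight_scaledCoeff θ κ R N hl
  have hZ := (div_ne_zero_iff.1 hN).2
  rw [lexMass_eq, massFn, div_div_div_cancel_right₀ hZ, lexCoeff_scale hsc, expCoeff_scale hsc,
    mul_div_mul_right _ _ (pow_ne_zero N hR.ne')]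

theorem normConst_pos_of_massFn (θ κ : ℕ → ℝ≥0) (R : ℝ) {N : ℕ}
    (hN : massFn (scaledCoeff θ R) (scaledCoeff κ R) N N ≠ 0) : 0 < normConst θ κ N := by
  refine pos_iff_ne_zero.2 fun h0 => (div_ne_zero_iff.1 hN).1 ?_
  rw [expCoeff_scale fun l hl => affineWeight_scaledCoeff θ κ R N hl, ← normConst_eq_expCoeff, h0]
  simp

/-! ### The fraction of points in long cycles -/

/-- The complement is a finite sum: each length `l ≤ K` has probability `(x_l / N) u(N - l) / u(N) →
β_l`, since the local limit does not depend on the shift. -/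
theorem HeavyTail.tendsto_lexMass_Ioi {α β : ℕ → ℝ} {s c μ : ℝ} (h : HeavyTail α β s c μ) (K : ℕ) :
    Tendsto (fun N : ℕ => lexMass α β N [Set.Ioi K] N / massFn α β N N) atTop
      (𝓝 (1 - ∑ l ∈ Finset.Icc 1 K, β l)) := by
  classical
  have hν : 0 < 1 - μ := sub_pos.2 h.mu_lt
  have hc := h.c_pos
  have hL : c * (1 - μ) ^ (-s) / (1 - μ) ≠ 0 := by positivity
  have hratio : ∀ l : ℕ, Tendsto (fun N : ℕ => massFn α β N (N - l) / massFn α β N N) atTop (𝓝 1) := by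
    intro l
    have h1 := (h.tendsto_massFn_mul_rpow l).div (h.tendsto_massFn_mul_rpow 0) hL
    rw [div_self hL] at h1
    refine h1.congr' ?_
    filter_upwards [eventually_gt_atTop 0] with N hN
    have hN' : (0 : ℝ) < N := by exact_mod_cast hN
    have : (N : ℝ) ^ s ≠ 0 := (Real.rpow_pos_of_pos hN' s).ne'
    simp only [Pi.div_apply, Nat.sub_zero]
    rw [mul_div_mul_right _ _ this]
  have hw : ∀ l : ℕ, Tendsto (fun N : ℕ => affineWeight α β N l / N) atTop (𝓝 (β l)) := by
    intro l
    have h1 := (tendsto_const_div_atTop_nhds_zero_nat (α l)).add_const (β l)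
    rw [zero_add] at h1
    refine h1.congr' ?_
    filter_upwards [eventually_gt_atTop 0] with N hN
    have hN' : (N : ℝ) ≠ 0 := by exact_mod_cast hN.ne'
    rw [affineWeight]
    field_simp
  have h1 := (tendsto_finsetSum (Finset.Icc 1 K) fun l _ => (hw l).mul (hratio l)).const_sub 1
  simp only [mul_one] at h1
  refine h1.congr' ?_
  filter_upwards [eventually_gt_atTop K, h.eventually_massFn_pos] with N hN hpos
  have hN' : (0 : ℝ) < N := by exact_mod_cast (by omega : 0 < N)
  have h2 : (∑ l ∈ Finset.Icc 1 K, affineWeight α β N l * massFn α β N (N - l))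
      + ∑ l ∈ (Finset.Icc 1 N).filter (· ∈ Set.Ioi K), affineWeight α β N l * massFn α β N (N - l)
      = N * massFn α β N N := by
    rw [nat_mul_massFn, ← Finset.sum_filter_not_add_sum_filter (Finset.Icc 1 N) (· ∈ Set.Ioi K)]
    congr 1
    refine Finset.sum_congr ?_ fun _ _ => rfl
    ext l
    simp only [Finset.mem_filter, Finset.mem_Icc, Set.mem_Ioi]
    omega
  have h3 : ∑ l ∈ Finset.Icc 1 K, affineWeight α β N l / N * (massFn α β N (N - l) / massFn α β N N)
      = (∑ l ∈ Finset.Icc 1 K, affineWeight α β N l * massFn α β N (N - l)) / N / massFn α β N N := by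
    rw [Finset.sum_div, Finset.sum_div]
    refine Finset.sum_congr rfl fun l _ => ?_
    field_simp
  have h4 : lexMass α β N [Set.Ioi K] N = (∑ l ∈ (Finset.Icc 1 N).filter (· ∈ Set.Ioi K),
      affineWeight α β N l * massFn α β N (N - l)) / N := by
    simp only [lexMass, cycleStep]
    congr! 2
    ext
    simp
  rw [h3, h4, eq_sub_iff_add_eq'.2 h2]
  field_simp

theorem tendsto_longFraction {θ κ : ℕ → ℝ≥0} {R s c μ : ℝ} (hR : 0 < R)
    (h : HeavyTail (scaledCoeff θ R) (scaledCoeff κ R) s c μ) :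
    Tendsto (longFraction θ κ) atTop (𝓝 (1 - μ)) := by
  refine (h.tendsto_sum_beta.const_sub 1).congr fun K => ?_
  rw [longFraction]
  -- For each fixed `K` the lower limit is an actual limit, `1 - ∑_{l ≤ K} β_l`.
  refine (Tendsto.liminf_eq ?_).symm
  refine (h.tendsto_lexMass_Ioi K).congr' ?_
  filter_upwards [eventually_gt_atTop 0, h.eventually_massFn_pos] with N hN hpos
  have hN' : (N : ℝ) ≠ 0 := by exact_mod_cast hN.ne'
  rw [integral_sum_mul_cycleCount θ κ (normConst_pos_of_massFn θ κ R hpos.ne').ne' K,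
    ← mul_assoc, one_div_mul_cancel hN', one_mul, ← lexCoeff_div_expCoeff θ κ hR hpos.ne']
  rfl

theorem measureReal_lexLength_eq_lexMass (θ κ : ℕ → ℝ≥0) {R : ℝ} (hR : 0 < R) {N : ℕ}
    (hN : massFn (scaledCoeff θ R) (scaledCoeff κ R) N N ≠ 0) (As : List (Set ℕ))
    (h0 : ∀ A ∈ As, 0 ∉ A) :
    (surrogateMeasure θ κ N).real {σ | ∀ (i : ℕ) (hi : i < As.length), lexLength σ i ∈ As[i]}
      = lexMass (scaledCoeff θ R) (scaledCoeff κ R) N As N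
        / massFn (scaledCoeff θ R) (scaledCoeff κ R) N N := by
  rw [measureReal_lexLength θ κ (normConst_pos_of_massFn θ κ R hN).ne' As h0,
    lexCoeff_div_expCoeff θ κ hR hN]

/-! ### The first success -/

/-- A value `k + 1` rules out the filler value zero, which is the infimum of the empty set, so no
null event has to be removed. -/
theorem firstSuccess_eq_succ_iff {Ω : Type*} (ξ : ℕ → Ω → Bool) (ω : Ω) (k : ℕ) :
    firstSuccess ξ ω = k + 1 ↔ (∀ i < k, ξ i ω = false) ∧ ξ k ω = true := by
  rw [firstSuccess]
  constructor
  · intro h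
    obtain ⟨n, hn, hξ⟩ := Nat.sInf_mem (Nat.nonempty_of_sInf_eq_succ h)
    rw [h] at hn
    obtain rfl : k = n := by omega
    refine ⟨fun i hi => ?_, hξ⟩
    by_contra hne
    have : sInf {k | ∃ n, k = n + 1 ∧ ξ n ω = true} ≤ i + 1 :=
      Nat.sInf_le ⟨i, rfl, by simpa using hne⟩
    omega
  · rintro ⟨h1, h2⟩
    refine le_antisymm (Nat.sInf_le ⟨k, rfl, h2⟩) (le_csInf ⟨_, k, rfl, h2⟩ ?_)
    rintro _ ⟨n, rfl, hn⟩
    by_contra! hlt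
    simp [h1 n (by omega)] at hn

theorem forall_firstSuccess_ne_iff {Ω : Type*} (ξ : ℕ → Ω → Bool) (ω : Ω) (m : ℕ) :
    (∀ i < m, firstSuccess ξ ω ≠ i + 1) ↔ ∀ i < m, ξ i ω = false := by
  constructor
  · intro h i
    induction i using Nat.strong_induction_on with
    | _ i ih =>
      intro hi
      by_contra hne
      exact h i hi ((firstSuccess_eq_succ_iff ξ ω i).2
        ⟨fun j hj => ih j hj (hj.trans hi), by simpa using hne⟩)
  · intro h i hi heq
    exact absurd (h i hi) (by simp [((firstSuccess_eq_succ_iff ξ ω i).1 heq).2])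

section Trials

variable {Ω : Type*} [MeasurableSpace Ω] {P : Measure Ω} [IsProbabilityMeasure P] {ξ : ℕ → Ω → Bool}
  {μ : ℝ}

theorem measurableSet_firstSuccess_eq (hξm : ∀ n, Measurable (ξ n)) (k : ℕ) :
    MeasurableSet {ω | firstSuccess ξ ω = k + 1} := by
  have : {ω | firstSuccess ξ ω = k + 1} = (⋂ i ∈ Finset.range k, ξ i ⁻¹' {false}) ∩ ξ k ⁻¹' {true} := by
    ext ω
    simp [firstSuccess_eq_succ_iff]
  rw [this]
  refine MeasurableSet.inter (Finset.measurableSet_biInter _ fun i _ => ?_) ?_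
  · exact hξm i (measurableSet_singleton _)
  · exact hξm k (measurableSet_singleton _)

theorem measure_false (hμ1 : μ ≤ 1) (hξm : ∀ n, Measurable (ξ n))
    (hξ : ∀ n, P {ω | ξ n ω = true} = ENNReal.ofReal (1 - μ)) (n : ℕ) :
    P (ξ n ⁻¹' {false}) = ENNReal.ofReal μ := by
  have h1 : ξ n ⁻¹' {false} = {ω | ξ n ω = true}ᶜ := by
    ext ω
    simp
  have h2 : MeasurableSet {ω | ξ n ω = true} := hξm n (measurableSet_singleton true)
  rw [h1, prob_compl_eq_one_sub h2, hξ, ← ENNReal.ofReal_one,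
    ← ENNReal.ofReal_sub _ (by linarith), sub_sub_cancel]

theorem measure_forall_false (hμ : 0 ≤ μ) (hμ1 : μ ≤ 1) (hξm : ∀ n, Measurable (ξ n))
    (hind : iIndepFun ξ P) (hξ : ∀ n, P {ω | ξ n ω = true} = ENNReal.ofReal (1 - μ)) (m : ℕ) :
    P {ω | ∀ i < m, ξ i ω = false} = ENNReal.ofReal (μ ^ m) := by
  have h1 : {ω | ∀ i < m, ξ i ω = false} = ⋂ i ∈ Finset.range m, ξ i ⁻¹' {false} := by
    ext ω
    simp
  rw [h1, hind.measure_inter_preimage_eq_mul _ fun i _ => measurableSet_singleton _]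
  simp only [measure_false hμ1 hξm hξ, Finset.prod_const, Finset.card_range]
  rw [ENNReal.ofReal_pow hμ]

theorem measure_firstSuccess_eq (hμ : 0 ≤ μ) (hμ1 : μ ≤ 1) (hξm : ∀ n, Measurable (ξ n))
    (hind : iIndepFun ξ P) (hξ : ∀ n, P {ω | ξ n ω = true} = ENNReal.ofReal (1 - μ)) (k : ℕ) :
    P {ω | firstSuccess ξ ω = k + 1} = ENNReal.ofReal (μ ^ k * (1 - μ)) := by
  have h1 : {ω | firstSuccess ξ ω = k + 1}
      = ⋂ i ∈ Finset.range (k + 1), ξ i ⁻¹' (if i = k then {true} else {false}) := by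
    ext ω
    simp only [Set.mem_ofPred_eq, firstSuccess_eq_succ_iff, Set.mem_iInter, Finset.mem_range,
      Set.mem_preimage]
    constructor
    · rintro ⟨h1, h2⟩ i hi
      split_ifs with h
      · simpa [h] using h2
      · simpa using h1 i (by omega)
    · intro h
      refine ⟨fun i hi => ?_, by simpa using h k (by omega)⟩
      have := h i (by omega)
      rw [if_neg hi.ne] at this
      simpa using this
  have h2 : P (ξ k ⁻¹' {true}) = ENNReal.ofReal (1 - μ) := hξ k
  rw [h1, hind.measure_inter_preimage_eq_mul _ fun i _ => MeasurableSet.of_discrete,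
    Finset.prod_range_succ, if_pos rfl, h2, ENNReal.ofReal_mul (by positivity), ENNReal.ofReal_pow hμ]
  congr 1
  rw [Finset.prod_congr rfl (g := fun _ => ENNReal.ofReal μ), Finset.prod_const, Finset.card_range]
  intro i hi
  rw [if_neg (Finset.mem_range.1 hi).ne, measure_false hμ1 hξm hξ]

end Trials

/-! ### Convergence to a discrete limit -/

/-- Convergence in distribution to a finitely valued limit follows from lower bounds for the
probabilities of neighbourhoods of its values. -/
theorem tendstoInDistribution_of_eventually_le {ι : Type*} [Finite ι] {E : Type*}
    [PseudoEMetricSpace E] [T2Space E] [MeasurableSpace E] [BorelSpace E]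
    {S : ℕ → Type*} [∀ N, MeasurableSpace (S N)] {ν : (N : ℕ) → Measure (S N)}
    [∀ N, IsProbabilityMeasure (ν N)] {Ω : Type*} [MeasurableSpace Ω] {P : Measure Ω}
    [IsProbabilityMeasure P] {X : (N : ℕ) → S N → E} {Z : Ω → E} {x : ι → E}
    (hx : Function.Injective x) (hX : ∀ N, Measurable (X N)) (hZ : Measurable Z)
    (hZx : ∀ ω, ∃ j, Z ω = x j)
    (h : ∀ j, ∀ U ∈ 𝓝 (x j), ∀ d < P.real (Z ⁻¹' {x j}),
      ∀ᶠ N in atTop, d ≤ (ν N).real (X N ⁻¹' U)) :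
    TendstoInDistribution X atTop Z ν P where
  forall_aemeasurable := fun N => (hX N).aemeasurable
  aemeasurable_limit := hZ.aemeasurable
  tendsto := by
    classical
    have := Fintype.ofFinite ι
    -- By the portmanteau theorem lower bounds on open sets suffice; disjoint neighbourhoods of the
    -- finitely many values then let the individual bounds be added.
    refine tendsto_of_forall_isOpen_le_liminf' fun G hG => ?_
    obtain ⟨U, hU, hdisj⟩ := (Set.finite_range x).t2_separation
    set J : Finset ι := Finset.univ.filter fun j => x j ∈ G with hJ
    have key : ∀ d < P.real (Z ⁻¹' G), ∀ᶠ N in atTop, d ≤ (ν N).real (X N ⁻¹' G) := by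
      intro d hd
      have h1 : P.real (Z ⁻¹' G) ≤ ∑ j ∈ J, P.real (Z ⁻¹' {x j}) := by
        refine (measureReal_mono ?_ (measure_ne_top _ _)).trans (measureReal_biUnion_finset_le J _)
        intro ω hω
        obtain ⟨j, hj⟩ := hZx ω
        rw [Set.mem_preimage, hj] at hω
        simp only [Set.mem_iUnion]
        exact ⟨j, by simpa [hJ] using hω, hj⟩
      -- Dividing the slack by `J.card + 1` keeps the total loss `J.card * t` below it.
      set t : ℝ := (∑ j ∈ J, P.real (Z ⁻¹' {x j}) - d) / (J.card + 1) with ht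
      have ht0 : 0 < t := div_pos (by linarith) (by positivity)
      have h2 : ∀ᶠ N in atTop, ∀ j ∈ J,
          P.real (Z ⁻¹' {x j}) - t ≤ (ν N).real (X N ⁻¹' (U (x j) ∩ G)) := by
        refine (Filter.eventually_all_finset J).2 fun j hj => ?_
        refine h j _ ?_ _ (by linarith)
        have hjG : x j ∈ G := by simpa [hJ] using hj
        exact ((hU (x j)).2.inter hG).mem_nhds ⟨(hU (x j)).1, hjG⟩
      filter_upwards [h2] with N hN
      have h3 := Finset.sum_le_sum hN
      rw [← measureReal_biUnion_finset] at h3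
      · have h4 : (ν N).real (⋃ j ∈ J, X N ⁻¹' (U (x j) ∩ G)) ≤ (ν N).real (X N ⁻¹' G) := by
          refine measureReal_mono ?_ (measure_ne_top _ _)
          intro σ hσ
          simp only [Set.mem_iUnion] at hσ
          obtain ⟨j, _, hj⟩ := hσ
          exact hj.2
        have h5 : ∑ j ∈ J, (P.real (Z ⁻¹' {x j}) - t)
            = ∑ j ∈ J, P.real (Z ⁻¹' {x j}) - J.card * t := by
          rw [Finset.sum_sub_distrib, Finset.sum_const, nsmul_eq_mul]
        have h6 : (J.card + 1) * t = ∑ j ∈ J, P.real (Z ⁻¹' {x j}) - d := by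
          rw [ht]
          field_simp
        linarith
      · intro i _ j _ hij
        have h4 := hdisj (Set.mem_range_self i) (Set.mem_range_self j) (hx.ne hij)
        exact Disjoint.preimage _ (h4.mono Set.inter_subset_left Set.inter_subset_left)
      · exact fun j _ => hX N ((hU (x j)).2.inter hG).measurableSet
    change (P.map Z) G ≤ liminf (fun N => ((ν N).map (X N)) G) atTop
    rw [Measure.map_apply hZ hG.measurableSet]
    refine le_of_forall_lt fun e he => ?_
    obtain ⟨e', he1, he2⟩ := exists_between he
    refine lt_of_lt_of_le he1 (le_liminf_of_le (by isBoundedDefault) ?_)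
    have he3 : e' ≠ ⊤ := ne_top_of_lt he2
    filter_upwards [key e'.toReal ((ENNReal.toReal_lt_toReal he3 (measure_ne_top _ _)).2 he2)] with N hN
    rw [Measure.map_apply (hX N) hG.measurableSet]
    exact (ENNReal.toReal_le_toReal he3 (measure_ne_top _ _)).1 hN

/-! ### Cycle lengths -/

theorem getElem_replicate_append_cons {T : Type*} (A B : T) {i j k : ℕ}
    (hk : k < (List.replicate i A ++ B :: List.replicate j A).length) :
    (List.replicate i A ++ B :: List.replicate j A)[k] = if k = i then B else A := by
  rw [List.getElem_append]
  simp only [List.length_replicate, List.getElem_cons, List.getElem_replicate]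
  split_ifs <;> first | rfl | omega

theorem HeavyTail.tendstoInDistribution_lexLength {θ κ : ℕ → ℝ≥0} {R s c μ : ℝ} (hR : 0 < R)
    (h : HeavyTail (scaledCoeff θ R) (scaledCoeff κ R) s c μ)
    {Ω : Type*} [MeasurableSpace Ω] {P : Measure Ω} [IsProbabilityMeasure P] {ξ : ℕ → Ω → Bool}
    (hξm : ∀ n, Measurable (ξ n)) (hind : iIndepFun ξ P)
    (hξ : ∀ n, P {ω | ξ n ω = true} = ENNReal.ofReal (1 - μ)) (m : ℕ) :
    TendstoInDistribution
      (fun (N : ℕ) (σ : Equiv.Perm (Fin N)) (i : Fin m) =>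
        (lexLength σ (i : ℕ) : ℝ) / ((N : ℝ) * (1 - μ)))
      atTop
      (fun (ω : Ω) (i : Fin m) => if firstSuccess ξ ω = (i : ℕ) + 1 then (1 : ℝ) else 0)
      (fun N : ℕ => surrogateMeasure θ κ N) P := by
  have hν : 0 < 1 - μ := sub_pos.2 h.mu_lt
  have hμ := h.mu_pos
  set Z : Ω → Fin m → ℝ := fun ω i => if firstSuccess ξ ω = (i : ℕ) + 1 then (1 : ℝ) else 0 with hZ
  -- The possible limits: `none` is the zero vector, no long cycle among the first `m`, and `some i`
  -- is the `i`-th unit vector.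
  set x : Option (Fin m) → Fin m → ℝ := fun j => j.elim 0 fun i => Pi.single i 1 with hx
  have hZsome : ∀ ω (i : Fin m), Z ω = x (some i) ↔ firstSuccess ξ ω = (i : ℕ) + 1 := by
    intro ω i
    constructor
    · intro hω
      have := congrFun hω i
      by_contra hne
      simp [hZ, hx, hne] at this
    · intro hω
      funext k
      by_cases hk : k = i
      · simp [hZ, hx, hω, hk]
      · have : (i : ℕ) ≠ k := fun h => hk (Fin.ext h.symm)
        simp [hZ, hx, hω, hk, this]
  have hZnone : ∀ ω, Z ω = x none ↔ ∀ i < m, firstSuccess ξ ω ≠ i + 1 := by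
    intro ω
    constructor
    · intro hω i hi hne
      have := congrFun hω ⟨i, hi⟩
      simp [hZ, hx, hne] at this
    · intro hω
      funext k
      simp [hZ, hx, hω k k.2]
  have hclose : ∀ ε > 0, ∀ K : ℕ, ∀ᶠ N : ℕ in atTop, 0 < (N : ℝ) ∧ ∀ L : ℕ, L ≤ K →
      |(L : ℝ) / ((N : ℝ) * (1 - μ))| < ε := by
    intro ε hε K
    have h1 := ((tendsto_const_div_atTop_nhds_zero_nat ((K : ℝ) / (1 - μ))).eventually
      (gt_mem_nhds hε))
    filter_upwards [h1, eventually_gt_atTop 0] with N hN hN0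
    have hN0' : (0 : ℝ) < N := by exact_mod_cast hN0
    refine ⟨hN0', fun L hL => ?_⟩
    have hL' : (L : ℝ) ≤ K := by exact_mod_cast hL
    rw [abs_of_nonneg (by positivity)]
    refine lt_of_le_of_lt ?_ hN
    rw [div_div, mul_comm (1 - μ)]
    gcongr
  have hSK : ∀ K : ℕ, 0 ∉ Set.Icc 1 K := fun K h0 => absurd h0.1 (by omega)
  refine tendstoInDistribution_of_eventually_le (x := x) ?_ (fun N => measurable_of_finite _) ?_ ?_ ?_
  · intro j k hjk
    have hne : ∀ i : Fin m, (0 : Fin m → ℝ) ≠ Pi.single i 1 := fun i h0 => by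
      have := congrFun h0 i
      simp at this
    rcases j with _ | j <;> rcases k with _ | k
    · rfl
    · exact absurd hjk (hne k)
    · exact absurd hjk.symm (hne j)
    · by_contra hcon
      have h1 := congrFun hjk j
      have h2 : j ≠ k := fun h => hcon (by rw [h])
      simp [hx, h2] at h1
  · refine measurable_pi_iff.2 fun i => ?_
    exact Measurable.ite (measurableSet_firstSuccess_eq hξm i) measurable_const measurable_const
  · intro ω
    by_cases hω : ∀ i < m, firstSuccess ξ ω ≠ i + 1
    · exact ⟨none, (hZnone ω).2 hω⟩
    · push Not at hω
      obtain ⟨i, hi, hωi⟩ := hω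
      exact ⟨some ⟨i, hi⟩, (hZsome ω ⟨i, hi⟩).2 hωi⟩
  · intro j U hU d hd
    obtain ⟨ε, hε, hball⟩ := Metric.mem_nhds_iff.1 hU
    rcases j with _ | i
    · have h1 : P.real (Z ⁻¹' {x none}) = μ ^ m := by
        have : Z ⁻¹' {x none} = {ω | ∀ i < m, ξ i ω = false} := by
          ext ω
          rw [Set.mem_preimage, Set.mem_singleton_iff, hZnone, forall_firstSuccess_ne_iff]
          rfl
        rw [this, measureReal_def, measure_forall_false hμ.le h.mu_lt.le hξm hind hξ,
          ENNReal.toReal_ofReal (by positivity)]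
      obtain ⟨K, hK⟩ := h.exists_eventually_short m (h1 ▸ hd)
      filter_upwards [hK, h.eventually_massFn_pos, hclose ε hε K] with N hN hpos hcl
      rw [← measureReal_lexLength_eq_lexMass θ κ hR hpos.ne' _ fun A hA => by
        rw [List.eq_of_mem_replicate hA]; exact hSK K] at hN
      refine hN.trans (measureReal_mono (fun σ hσ => hball ?_) (measure_ne_top _ _))
      rw [Metric.mem_ball, dist_pi_lt_iff hε]
      intro k
      have h2 := hσ k (by simp)
      rw [List.getElem_replicate] at h2
      simp only [hx, Option.elim_none, Pi.zero_apply, Real.dist_eq, sub_zero]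
      exact hcl.2 _ h2.2
    · have h1 : P.real (Z ⁻¹' {x (some i)}) = μ ^ (i : ℕ) * (1 - μ) := by
        have : Z ⁻¹' {x (some i)} = {ω | firstSuccess ξ ω = (i : ℕ) + 1} := by
          ext ω
          exact hZsome ω i
        rw [this, measureReal_def, measure_firstSuccess_eq hμ.le h.mu_lt.le hξm hind hξ,
          ENNReal.toReal_ofReal (by positivity)]
      have hlen : (i : ℕ) + (m - 1 - i + 1) = m := by have := i.2; omega
      -- The window has radius `ε / 2 * (1 - μ)`, so division by `N (1 - μ)` leaves a deviation of
      -- at most `ε / 2`; the long cycle is followed by `m - 1 - i` short ones.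
      obtain ⟨K, hK⟩ := h.exists_eventually_long i (m - 1 - i) (h1 ▸ hd)
        (ε := ε / 2 * (1 - μ)) (by positivity)
      filter_upwards [hK, h.eventually_massFn_pos, hclose ε hε K] with N hN hpos hcl
      have hN0 := hcl.1
      rw [← measureReal_lexLength_eq_lexMass θ κ hR hpos.ne' _ fun A hA => by
        rcases List.mem_append.1 hA with hA | hA
        · rw [List.eq_of_mem_replicate hA]; exact hSK K
        · rcases List.mem_cons.1 hA with rfl | hA
          · exact fun h0 => absurd h0.2 (by omega)
          · rw [List.eq_of_mem_replicate hA]; exact hSK K] at hN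
      refine hN.trans (measureReal_mono (fun σ hσ => hball ?_) (measure_ne_top _ _))
      rw [Metric.mem_ball, dist_pi_lt_iff hε]
      intro k
      have h2 := hσ k (by simp [hlen])
      rw [getElem_replicate_append_cons] at h2
      by_cases hk : k = i
      · subst hk
        rw [if_pos rfl] at h2
        have h3 := h2.1
        simp only [hx, Option.elim_some, Pi.single_eq_same, Real.dist_eq]
        have h4 : (lexLength σ (k : ℕ) : ℝ) / ((N : ℝ) * (1 - μ)) - 1
            = ((lexLength σ (k : ℕ) : ℝ) - (1 - μ) * N) / ((N : ℝ) * (1 - μ)) := by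
          field_simp
        rw [h4, abs_div, abs_of_pos (by positivity : 0 < (N : ℝ) * (1 - μ)),
          div_lt_iff₀ (by positivity)]
        refine h3.trans_lt ?_
        have : 0 < ε * (N * (1 - μ)) := by positivity
        linarith
      · rw [if_neg fun h => hk (Fin.ext h)] at h2
        simp only [hx, Option.elim_some, Pi.single_eq_of_ne hk, Real.dist_eq, sub_zero]
        exact hcl.2 _ h2.2

end SurrogateSpatial

/-! ### The main theorem -/

theorem mainTheorem7
    (θ κ : ℕ → ℝ≥0)
    -- `κ` is non-arithmetic and non-degenerate
    (hna : ¬ ∃ j₀ : ℕ, 1 < j₀ ∧ ∀ j, 1 ≤ j → κ j ≠ 0 → j₀ ∣ j)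
    (hnd : ∃ j, 2 ≤ j ∧ 0 < κ j)
    -- `R` is the radius of convergence of the generating function of `κ`
    (R : ℝ) (hR : 0 < R)
    (hrad : (FormalMultilinearSeries.ofScalars ℂ (SurrogateSpatial.genCoeff κ)).radius
      = ENNReal.ofReal R)
    -- both generating functions are holomorphic in `Δ₀`, and that of `θ` is regular at `R`
    (η φ : ℝ) (hη : 0 < η) (hφ : 0 < φ) (hφ' : φ < Real.pi / 2)
    (gθ gκ : ℂ → ℂ)
    (hgθ : ∀ z : ℂ, ‖z‖ < R → HasSum (fun j : ℕ => SurrogateSpatial.genCoeff θ j * z ^ j) (gθ z))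
    (hgκ : ∀ z : ℂ, ‖z‖ < R → HasSum (fun j : ℕ => SurrogateSpatial.genCoeff κ j * z ^ j) (gκ z))
    (hgθ_hol : DifferentiableOn ℂ gθ (SurrogateSpatial.deltaDomain R η φ))
    (hgκ_hol : DifferentiableOn ℂ gκ (SurrogateSpatial.deltaDomain R η φ))
    (hgθ_reg : AnalyticAt ℂ gθ (R : ℂ))
    -- `b n` is the boundary value of the `n`-th modified derivative of `gκ`, finite for `n < s`
    (s : ℝ) (hs : 1 < s) (hs' : ∀ k : ℕ, s ≠ k)
    (b : ℕ → ℝ)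
    (hb : ∀ n : ℕ, (n : ℝ) < s →
      Tendsto (fun r : ℝ => (SurrogateSpatial.modDeriv n gκ (r : ℂ)).re) (𝓝[<] R) (𝓝 (b n)))
    (hinf : ∀ n : ℕ, s < n →
      Tendsto (fun r : ℝ => (SurrogateSpatial.modDeriv n gκ (r : ℂ)).re) (𝓝[<] R) atTop)
    -- the expansions of `gκ` and of its derivatives at `R`
    (a : ℝ) (ha : a ≠ 0)
    (hexp : ∀ n : ℕ, ∃ δ : ℝ, 0 < δ ∧
      (fun z : ℂ => SurrogateSpatial.modDeriv n gκ z
          - SurrogateSpatial.singularExpansion R s a b n z)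
        =O[𝓝[SurrogateSpatial.deltaDomain R η φ] (R : ℂ)]
      (fun z : ℂ => ‖1 - z / (R : ℂ)‖ ^ (s - n + δ)))
    -- the supercritical case
    (hsuper : b 1 < 1)
    -- independent Bernoulli trials with success probability `1 - b 1`
    {Ω : Type*} [MeasurableSpace Ω] (P : Measure Ω) [IsProbabilityMeasure P]
    (ξ : ℕ → Ω → Bool) (hξm : ∀ n, Measurable (ξ n)) (hξ_indep : iIndepFun ξ P)
    (hξ : ∀ n, P {ω | ξ n ω = true} = ENNReal.ofReal (1 - b 1)) :
    (∀ᶠ N : ℕ in atTop, 0 < SurrogateSpatial.normConst θ κ N) ∧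
    Tendsto (SurrogateSpatial.longFraction θ κ) atTop (𝓝 (1 - b 1)) ∧
    (∀ k : ℕ, 1 ≤ k → P {ω | SurrogateSpatial.firstSuccess ξ ω = k}
      = ENNReal.ofReal ((1 - (1 - b 1)) ^ (k - 1) * (1 - b 1))) ∧
    ∀ m : ℕ, TendstoInDistribution
      (fun (N : ℕ) (σ : Equiv.Perm (Fin N)) (i : Fin m) =>
        (SurrogateSpatial.lexLength σ (i : ℕ) : ℝ) / ((N : ℝ) * (1 - b 1)))
      atTop
      (fun (ω : Ω) (i : Fin m) =>
        if SurrogateSpatial.firstSuccess ξ ω = (i : ℕ) + 1 then (1 : ℝ) else 0)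
      (fun N : ℕ => SurrogateSpatial.surrogateMeasure θ κ N) P := by
  have h := SurrogateSpatial.heavyTail_scaledCoeff (b := b) hR hη hφ hφ' hgθ hgκ hgθ_hol hgκ_hol
    hgθ_reg hs hs' (hb 1 (by exact_mod_cast hs)) ha hexp hsuper
  refine ⟨?_, SurrogateSpatial.tendsto_longFraction hR h, fun k hk => ?_, fun m =>
    h.tendstoInDistribution_lexLength hR hξm hξ_indep hξ m⟩
  · filter_upwards [h.eventually_massFn_pos] with N hN
    exact SurrogateSpatial.normConst_pos_of_massFn θ κ R hN.ne'
  · obtain ⟨n, rfl⟩ : ∃ n, k = n + 1 := ⟨k - 1, by omega⟩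
    rw [sub_sub_cancel, Nat.add_sub_cancel]
    exact SurrogateSpatial.measure_firstSuccess_eq h.mu_pos.le hsuper.le hξm hξ_indep hξ n
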